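/- **Theorem 1.1.** Let $G\subset S^2$ be a finite planar graph (possibly disconnected, loops and multiple edges allowed) with vertex set $V$ and edge set $E$. For each $v\in V$ let $D(v)\subset S^2$ be a closed disc around $v$, these discs being pairwise disjoint, and for each $e\in E$ let $C(e)\subset S^2$ be a simple curve joining an interior point of the disc of one end of $e$ to an interior point of the disc of the other end, these curves being pairwise disjoint, such that shrinking the discs to points gives back $G\subset S^2$. Write $S^3=B_+\cup_{S^2}B_-$ as the union of two balls, and push the curves $C(e)$, keeping their end points fixed, to disjoint curves $C_+(e)$ in $B_+$ and $C_-(e)$ in $B_-$ (simultaneously isotopic to the $C(e)$ in $B_+$, respectively in $B_-$). The *flat fully augmented chainmail link* of $G$ is the link $$L=\bigcup_{v\in V}\partial D(v)\ \cup\ \bigcup_{e\in E}\bigl(C_+(e)\cup C_-(e)\bigr)\subset S^3 ,$$ with vertex loops $\partial D(v)$ and edge loops $C_+(e)\cup C_-(e)$. An *alternating surgery* on $L$ is a Dehn surgery along all components of $L$, with rational slopes measured with respect to the meridian and the preferred longitude of each component, such that * the slope of every edge loop is negative, * the slope of every vertex loop is nonnegative, and * every connected component of $G$ contains a vertex whose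 vertex loop has positive slope. Then the fundamental group of the closed 3-manifold obtained by an alternating surgery on $L$ is not left-orderable. (A group is left-orderable if it is nontrivial and admits a total order $\le$ such that $g\le h$ implies $fg\le fh$ for all $f,g,h$.) -/

import Mathlib

noncomputable section

/-- A group is left-orderable if it is nontrivial and carries a total order invariant under
left multiplication. -/
def LeftOrderable (G : Type*) [Group G] : Prop :=
  Nontrivial G ∧ ∃ _ : LinearOrder G, ∀ f g h : G, g ≤ h → f * g ≤ f * h

/-- The 3-sphere, as the one-point compactification of three-space `ℂ × ℝ` (horizontal plane `ℂ`,
vertical axis `ℝ`).  Three-space has the usual orientation: `ℂ` is oriented by `(1, i)` and the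
vertical axis points up. -/
abbrev ThreeSphere : Type := OnePoint (ℂ × ℝ)

/-- The closed unit disc of the plane. -/
abbrev UnitDisc : Type := Metric.closedBall (0 : ℂ) 1

namespace UnitDisc

/-- The centre of the disc. -/
def zero : UnitDisc := ⟨0, by simp⟩

/-- A point of the boundary circle, as a point of the disc. -/
def ofCircle (z : Circle) : UnitDisc := ⟨z, by simp [Circle.norm_coe]⟩

end UnitDisc

/-- A framed link in the 3-sphere: disjointly embedded closed solid tori `Circle × UnitDisc`, one
for each index.  (The tubes are continuous and jointly injective, hence, by compactness,
embeddings with disjoint images.) -/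
structure FramedLink (ι : Type*) where
  /-- The solid torus around the `i`-th component. -/
  tube : ι → Circle × UnitDisc → ThreeSphere
  continuous_tube : ∀ i, Continuous (tube i)
  injective_tube : Function.Injective fun p : ι × (Circle × UnitDisc) => tube p.1 p.2

namespace FramedLink

variable {ι : Type*} (L : FramedLink ι)

/-- The `i`-th component of the link: the core of the `i`-th solid torus. -/
def component (i : ι) : Set ThreeSphere :=
  Set.range fun u : Circle => L.tube i (u, UnitDisc.zero)

/-- The exterior of the link: the 3-sphere minus the interiors of the solid tori. -/
def Exterior : Type :=
  {x : ThreeSphere // ∀ (i : ι) (u : Circle) (w : UnitDisc), ‖(w : ℂ)‖ < 1 → L.tube i (u, w) ≠ x}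

instance : TopologicalSpace L.Exterior :=
  inferInstanceAs (TopologicalSpace {x : ThreeSphere //
    ∀ (i : ι) (u : Circle) (w : UnitDisc), ‖(w : ℂ)‖ < 1 → L.tube i (u, w) ≠ x})

/-- The gluing homeomorphism `∂D² × S¹ → S¹ × ∂D²` of slope `p / q`, the first factor on the right
being the longitude and the second one the meridian.  The meridian `∂D² × 1` of the new solid torus
is sent to the curve `z ↦ (z ^ q, z ^ p)`, which winds `p` times in the direction of the meridian
and `q` times in the direction of the longitude.  The remaining exponents are Bézout coefficients,
so that the exponent matrix has determinant `1`. -/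
def gluingMap (s : ℚ) (z w : Circle) : Circle × Circle :=
  (z ^ (s.den : ℤ) * w ^ (-Int.gcdA s.num s.den), z ^ s.num * w ^ Int.gcdB s.num s.den)

theorem gluingMap_det (s : ℚ) :
    (s.den : ℤ) * Int.gcdB s.num s.den - s.num * -Int.gcdA s.num s.den = 1 := by
  have h := Int.gcd_eq_gcd_ab s.num s.den
  have h2 : Int.gcd s.num s.den = 1 := by
    simpa [Int.gcd] using s.reduced
  rw [h2] at h
  push_cast at h
  linarith

/-- The exterior and the new solid tori `D² × S¹`, before gluing. -/
abbrev Pieces : Type _ := L.Exterior ⊕ (Σ _ : ι, UnitDisc × Circle)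

/-- The boundary of the `i`-th new solid torus is glued to the `i`-th boundary torus of the
exterior by the gluing map of slope `s i`. -/
inductive Glue (s : ι → ℚ) : L.Pieces → L.Pieces → Prop
  | glue (i : ι) (z w : Circle) (x : L.Exterior)
      (hx : x.1 = L.tube i ((gluingMap (s i) z w).1, UnitDisc.ofCircle (gluingMap (s i) z w).2)) :
      Glue s (Sum.inr ⟨i, UnitDisc.ofCircle z, w⟩) (Sum.inl x)

/-- Dehn surgery on a framed link with rational slopes, measured with respect to the framing: the
interiors of the solid tori are removed, and solid tori are glued back in such a way that
`p · meridian + q · longitude` bounds a disc in the `i`-th one, where `s i = p / q`. -/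
def Surgery (s : ι → ℚ) : Type _ := Quot (L.Glue s)

instance (s : ι → ℚ) : TopologicalSpace (L.Surgery s) :=
  inferInstanceAs (TopologicalSpace (Quot (L.Glue s)))

end FramedLink

/-- A planar drawing of a graph with vertex set `V` and edge set `E` (loops and multiple edges
allowed, edges arbitrarily oriented), with fat vertices and edges.  The vertex `v` is drawn as a
round disc.  The edge `e` is drawn as an embedded band `[-5/4, 5/4] × [-1/4, 1/4] → ℂ`, whose core
`[-1, 1] × {0}` is the curve joining the discs of its ends.  The band runs radially out of the disc
of the source and radially into the disc of the target; it crosses the boundaries of these discs at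
the parameters `-1/2` and `1/2`, and stays away from all discs in between.  By its form at the two
ends, each band preserves the orientation.  Up to isotopy, every finite graph embedded in the plane
(or in the 2-sphere) has such a drawing. -/
structure PlanarGraph (V E : Type*) where
  /-- The initial vertex of an edge. -/
  src : E → V
  /-- The terminal vertex of an edge. -/
  tgt : E → V
  /-- The centre of the disc of a vertex. -/
  center : V → ℂ
  /-- The radius of the disc of a vertex. -/
  radius : V → ℝ
  radius_pos : ∀ v, 0 < radius v
  /-- The discs, enlarged by the factor `5/4`, are pairwise disjoint. -/
  disc_disjoint : ∀ v w, v ≠ w →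
    5 / 4 * radius v + 5 / 4 * radius w < dist (center v) (center w)
  /-- The band of an edge. -/
  band : E → ℝ × ℝ → ℂ
  continuousOn_band : ∀ e,
    ContinuousOn (band e) (Set.Icc (-5 / 4) (5 / 4) ×ˢ Set.Icc (-1 / 4) (1 / 4))
  /-- The bands are embedded and pairwise disjoint. -/
  band_injective : ∀ e e',
    ∀ p ∈ Set.Icc (-5 / 4 : ℝ) (5 / 4) ×ˢ Set.Icc (-1 / 4 : ℝ) (1 / 4),
    ∀ p' ∈ Set.Icc (-5 / 4 : ℝ) (5 / 4) ×ˢ Set.Icc (-1 / 4 : ℝ) (1 / 4),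
    band e p = band e' p' → e = e' ∧ p = p'
  /-- The direction in which an edge leaves its source. -/
  srcAngle : E → ℝ
  /-- The angular width of a band at its source. -/
  srcWidth : E → ℝ
  srcWidth_pos : ∀ e, 0 < srcWidth e
  /-- The direction, as seen from the target, from which an edge enters its target. -/
  tgtAngle : E → ℝ
  /-- The angular width of a band at its target. -/
  tgtWidth : E → ℝ
  tgtWidth_pos : ∀ e, 0 < tgtWidth e
  band_src : ∀ e, ∀ t ∈ Set.Icc (-5 / 4 : ℝ) (-1 / 4), ∀ s ∈ Set.Icc (-1 / 4 : ℝ) (1 / 4),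
    band e (t, s) = center (src e) +
      (radius (src e) * (3 / 2 + t) : ℝ) * Circle.exp (srcAngle e + srcWidth e * s)
  band_tgt : ∀ e, ∀ t ∈ Set.Icc (1 / 4 : ℝ) (5 / 4), ∀ s ∈ Set.Icc (-1 / 4 : ℝ) (1 / 4),
    band e (t, s) = center (tgt e) +
      (radius (tgt e) * (3 / 2 - t) : ℝ) * Circle.exp (tgtAngle e - tgtWidth e * s)
  band_middle : ∀ e, ∀ t ∈ Set.Ioo (-1 / 4 : ℝ) (1 / 4), ∀ s ∈ Set.Icc (-1 / 4 : ℝ) (1 / 4),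
    ∀ v, 5 / 4 * radius v < dist (band e (t, s)) (center v)

namespace PlanarGraph

variable {V E : Type*} (G : PlanarGraph V E)

/-- Two vertices lie in the same connected component of the graph. -/
def Joined : V → V → Prop :=
  Relation.EqvGen fun v w => ∃ e, G.src e = v ∧ G.tgt e = w

/-- The vertex loop of `v`: the boundary of the disc of `v`, in the horizontal plane. -/
def vertexLoop (v : V) : Set ThreeSphere :=
  {x | ∃ a : ℂ, dist a (G.center v) = G.radius v ∧ x = ((a, (0 : ℝ)) : ℂ × ℝ)}

/-- The upper arc of `e`: the curve of the edge, pushed into the upper half-space with its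
end points fixed. -/
def upperArc (e : E) : Set ThreeSphere :=
  {x | ∃ t ∈ Set.Icc (-1 : ℝ) 1, x = ((G.band e (t, 0), √(1 - t ^ 2)) : ℂ × ℝ)}

/-- The lower arc of `e`: the curve of the edge, pushed into the lower half-space with its
end points fixed. -/
def lowerArc (e : E) : Set ThreeSphere :=
  {x | ∃ t ∈ Set.Icc (-1 : ℝ) 1, x = ((G.band e (t, 0), -√(1 - t ^ 2)) : ℂ × ℝ)}

/-- The round solid torus around the vertex loop of `v`.  It preserves the orientation, and the
longitude `w = 1` is a circle in the horizontal plane parallel to the vertex loop, with linking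
number zero with it. -/
def vertexTube (v : V) (p : Circle × UnitDisc) : ThreeSphere :=
  ((G.center v + (G.radius v * (1 + (p.2 : ℂ).re / 8) : ℝ) * (p.1 : ℂ), -(p.2 : ℂ).im / 8) : ℂ × ℝ)

/-- The solid torus around the edge loop of `e`.  It preserves the orientation, and the longitude
`w = 1` is parallel to the edge loop in the vertical strip over the edge, hence has linking number
zero with it. -/
def edgeTube (e : E) (p : Circle × UnitDisc) : ThreeSphere :=
  ((G.band e ((1 + (p.2 : ℂ).re / 8) * (p.1 : ℂ).re, (p.2 : ℂ).im / 8),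
    (1 + (p.2 : ℂ).re / 8) * (p.1 : ℂ).im) : ℂ × ℝ)

/-- The solid tori of all vertex loops and edge loops. -/
def tube : V ⊕ E → Circle × UnitDisc → ThreeSphere
  | Sum.inl v => G.vertexTube v
  | Sum.inr e => G.edgeTube e

theorem disc_bounds (w : UnitDisc) :
    -1 ≤ (w : ℂ).re ∧ (w : ℂ).re ≤ 1 ∧ -1 ≤ (w : ℂ).im ∧ (w : ℂ).im ≤ 1 := by
  have h : ‖(w : ℂ)‖ ≤ 1 := mem_closedBall_zero_iff.1 w.2
  have h1 := abs_le.1 ((Complex.abs_re_le_norm (w : ℂ)).trans h)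
  have h2 := abs_le.1 ((Complex.abs_im_le_norm (w : ℂ)).trans h)
  exact ⟨h1.1, h1.2, h2.1, h2.2⟩

theorem circle_sq (u : Circle) : (u : ℂ).re ^ 2 + (u : ℂ).im ^ 2 = 1 := by
  have h := Circle.normSq_coe u
  rw [Complex.normSq_apply] at h
  nlinarith

theorem circle_bounds (u : Circle) : -1 ≤ (u : ℂ).re ∧ (u : ℂ).re ≤ 1 := by
  have h := circle_sq u
  constructor <;> nlinarith [sq_nonneg (u : ℂ).im]

theorem edge_mem (p : Circle × UnitDisc) :
    ((1 + (p.2 : ℂ).re / 8) * (p.1 : ℂ).re, (p.2 : ℂ).im / 8) ∈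
      Set.Icc (-5 / 4 : ℝ) (5 / 4) ×ˢ Set.Icc (-1 / 4 : ℝ) (1 / 4) := by
  obtain ⟨h1, h2, h3, h4⟩ := disc_bounds p.2
  obtain ⟨h5, h6⟩ := circle_bounds p.1
  refine ⟨⟨?_, ?_⟩, ⟨?_, ?_⟩⟩ <;> dsimp only <;> nlinarith

/-- Scaled points of the circle determine the scale and the point. -/
theorem scaled_circle_inj {a b : ℝ} (ha : 0 < a) (hb : 0 < b) {u u' : Circle}
    (h : (a : ℂ) * u = b * u') : a = b ∧ u = u' := by
  have h1 : a = b := by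
    have := congrArg norm h
    simpa [Circle.norm_coe, abs_of_pos ha, abs_of_pos hb] using this
  subst h1
  refine ⟨rfl, ?_⟩
  have : (a : ℂ) ≠ 0 := by exact_mod_cast ha.ne'
  exact Circle.ext (mul_left_cancel₀ this h)

theorem norm_scaled (a : ℝ) (ha : 0 ≤ a) (u : Circle) : ‖(a : ℂ) * (u : ℂ)‖ = a := by
  simp [Circle.norm_coe, abs_of_nonneg ha]

/-- The vertex tube lies over the annulus of radii `7/8` and `9/8` around the vertex. -/
theorem vertex_dist (v : V) (p : Circle × UnitDisc) :
    dist (G.center v + (G.radius v * (1 + (p.2 : ℂ).re / 8) : ℝ) * (p.1 : ℂ)) (G.center v) =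
      G.radius v * (1 + (p.2 : ℂ).re / 8) := by
  obtain ⟨h1, -⟩ := disc_bounds p.2
  have := G.radius_pos v
  rw [dist_self_add_left, norm_scaled]
  exact mul_nonneg this.le (by linarith)

theorem vertexTube_inj {v v' : V} {p p' : Circle × UnitDisc}
    (h : G.vertexTube v p = G.vertexTube v' p') : v = v' ∧ p = p' := by
  have h' := OnePoint.coe_injective h
  rw [Prod.mk.injEq] at h'
  obtain ⟨hx, hz⟩ := h'
  have r := G.radius_pos v
  have r' := G.radius_pos v'
  obtain ⟨a1, a2, a3, a4⟩ := disc_bounds p.2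
  obtain ⟨b1, b2, b3, b4⟩ := disc_bounds p'.2
  have d := G.vertex_dist v p
  have d' := G.vertex_dist v' p'
  have hv : v = v' := by
    by_contra hne
    have h1 := G.disc_disjoint v v' hne
    have h2 := dist_triangle_left (G.center v) (G.center v')
      (G.center v + (G.radius v * (1 + (p.2 : ℂ).re / 8) : ℝ) * (p.1 : ℂ))
    rw [d, hx, d'] at h2
    nlinarith
  subst hv
  refine ⟨rfl, ?_⟩
  obtain ⟨h1, h2⟩ := scaled_circle_inj (mul_pos r (by linarith)) (mul_pos r (by linarith))
    (add_left_cancel hx)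
  have h3 := mul_left_cancel₀ r.ne' h1
  refine Prod.ext h2 (Subtype.ext (Complex.ext ?_ ?_)) <;> linarith

theorem edgeTube_inj {e e' : E} {p p' : Circle × UnitDisc}
    (h : G.edgeTube e p = G.edgeTube e' p') : e = e' ∧ p = p' := by
  have h' := OnePoint.coe_injective h
  rw [Prod.mk.injEq] at h'
  obtain ⟨hx, hz⟩ := h'
  obtain ⟨he, hp⟩ := G.band_injective e e' _ (edge_mem p) _ (edge_mem p') hx
  rw [Prod.mk.injEq] at hp
  obtain ⟨ht, hs⟩ := hp
  obtain ⟨a1, -⟩ := disc_bounds p.2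
  obtain ⟨b1, -⟩ := disc_bounds p'.2
  refine ⟨he, ?_⟩
  obtain ⟨h1, h2⟩ := scaled_circle_inj (a := 1 + (p.2 : ℂ).re / 8) (b := 1 + (p'.2 : ℂ).re / 8)
    (by linarith) (by linarith) (u := p.1) (u' := p'.1)
    (Complex.ext (by rw [Complex.re_ofReal_mul, Complex.re_ofReal_mul]; exact ht)
      (by rw [Complex.im_ofReal_mul, Complex.im_ofReal_mul]; exact hz))
  refine Prod.ext h2 (Subtype.ext (Complex.ext ?_ ?_)) <;> linarith

theorem vertexTube_ne_edgeTube (v : V) (e : E) (p p' : Circle × UnitDisc) :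
    G.vertexTube v p ≠ G.edgeTube e p' := by
  intro h
  have h' := OnePoint.coe_injective h
  rw [Prod.mk.injEq] at h'
  obtain ⟨hx, hz⟩ := h'
  obtain ⟨a1, a2, a3, a4⟩ := disc_bounds p.2
  obtain ⟨⟨m1, m2⟩, ms⟩ := edge_mem p'
  obtain ⟨b1, b2, -⟩ := disc_bounds p'.2
  have hu := circle_sq p'.1
  have d := G.vertex_dist v p
  rw [hx] at d
  set k := 1 + (p'.2 : ℂ).re / 8
  set t := k * (p'.1 : ℂ).re with ht
  set y := k * (p'.1 : ℂ).im with hy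
  have hsum : t ^ 2 + y ^ 2 = k ^ 2 := by
    rw [ht, hy]
    linear_combination k ^ 2 * hu
  have hk : 7 / 8 ≤ k := by simp only [k]; linarith
  have hy2 : y ^ 2 ≤ 1 / 64 := by rw [← hz]; nlinarith
  have ht2 : 48 / 64 ≤ t ^ 2 := by nlinarith
  -- A point of the band close to one of its ends lies deep inside the disc of a vertex.
  have key : ∀ w : V, ∀ ρ : ℝ, 0 ≤ ρ → ρ ≤ 3 / 4 →
      dist (G.band e (t, (p'.2 : ℂ).im / 8)) (G.center w) = G.radius w * ρ → False := by
    intro w ρ h0 h1 hd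
    have r := G.radius_pos v
    have r' := G.radius_pos w
    by_cases hvw : v = w
    · subst hvw
      rw [d] at hd
      have := mul_left_cancel₀ r.ne' hd
      linarith
    · have h2 := G.disc_disjoint v w hvw
      have h3 := dist_triangle_left (G.center v) (G.center w)
        (G.band e (t, (p'.2 : ℂ).im / 8))
      rw [d, hd] at h3
      nlinarith
  dsimp only at m1 m2
  rcases le_total t 0 with hneg | hpos
  · have ht3 : t ≤ -3 / 4 := by nlinarith
    refine key (G.src e) (3 / 2 + t) (by linarith) (by linarith) ?_
    rw [G.band_src e t ⟨m1, by linarith⟩ _ ms, dist_self_add_left, norm_scaled]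
    exact mul_nonneg (G.radius_pos _).le (by linarith)
  · have ht3 : 3 / 4 ≤ t := by nlinarith
    refine key (G.tgt e) (3 / 2 - t) (by linarith) (by linarith) ?_
    rw [G.band_tgt e t ⟨by linarith, m2⟩ _ ms, dist_self_add_left, norm_scaled]
    exact mul_nonneg (G.radius_pos _).le (by linarith)

/-- The flat fully augmented chainmail link of a planar graph: its components are the vertex loops
and the edge loops, each with its meridian and its preferred (linking number zero) longitude. -/
def chainmailLink : FramedLink (V ⊕ E) where
  tube := G.tube
  continuous_tube := by
    rintro (v | e)
    · refine OnePoint.continuous_coe.comp ?_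
      fun_prop
    · refine OnePoint.continuous_coe.comp (Continuous.prodMk ?_ (by fun_prop))
      exact (G.continuousOn_band e).comp_continuous (by fun_prop) edge_mem
  injective_tube := by
    rintro ⟨v | e, p⟩ ⟨v' | e', p'⟩ h
    · obtain ⟨rfl, rfl⟩ := G.vertexTube_inj h
      rfl
    · exact (G.vertexTube_ne_edgeTube _ _ _ _ h).elim
    · exact (G.vertexTube_ne_edgeTube _ _ _ _ h.symm).elim
    · obtain ⟨rfl, rfl⟩ := G.edgeTube_inj h
      rfl

theorem component_vertex (v : V) : G.chainmailLink.component (Sum.inl v) = G.vertexLoop v := by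
  ext x
  constructor
  · rintro ⟨u, rfl⟩
    refine ⟨G.center v + G.radius v * (u : ℂ), ?_, ?_⟩
    · rw [dist_self_add_left, norm_scaled _ (G.radius_pos v).le]
    · simp [chainmailLink, tube, vertexTube, UnitDisc.zero]
  · rintro ⟨a, ha, rfl⟩
    have hr : (G.radius v : ℂ) ≠ 0 := by exact_mod_cast (G.radius_pos v).ne'
    have hu : ‖(a - G.center v) / G.radius v‖ = 1 := by
      rw [norm_div, ← dist_eq_norm, ha, Complex.norm_real, Real.norm_eq_abs,
        abs_of_pos (G.radius_pos v), div_self (G.radius_pos v).ne']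
    refine ⟨⟨(a - G.center v) / G.radius v, by simpa [Submonoid.unitSphere] using hu⟩, ?_⟩
    simp [chainmailLink, tube, vertexTube, UnitDisc.zero, mul_div_cancel₀ _ hr]

theorem component_edge (e : E) :
    G.chainmailLink.component (Sum.inr e) = G.upperArc e ∪ G.lowerArc e := by
  ext x
  constructor
  · rintro ⟨u, rfl⟩
    have h := circle_sq u
    have hs : 1 - (u : ℂ).re ^ 2 = (u : ℂ).im ^ 2 := by linarith
    rcases le_total 0 (u : ℂ).im with h0 | h0
    · refine Or.inl ⟨(u : ℂ).re, circle_bounds u, ?_⟩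
      rw [hs, Real.sqrt_sq h0]
      simp [chainmailLink, tube, edgeTube, UnitDisc.zero]
    · refine Or.inr ⟨(u : ℂ).re, circle_bounds u, ?_⟩
      rw [hs, Real.sqrt_sq_eq_abs, abs_of_nonpos h0]
      simp [chainmailLink, tube, edgeTube, UnitDisc.zero]
  · have main : ∀ t ∈ Set.Icc (-1 : ℝ) 1, ∀ y : ℝ, y ^ 2 = 1 - t ^ 2 →
        (((G.band e (t, 0), y) : ℂ × ℝ) : ThreeSphere) ∈ G.chainmailLink.component (Sum.inr e) := by
      intro t _ y hy
      have hu : ‖(⟨t, y⟩ : ℂ)‖ = 1 := by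
        rw [← sq_eq_sq₀ (norm_nonneg _) zero_le_one, ← Complex.normSq_eq_norm_sq,
          Complex.normSq_apply]
        dsimp only
        nlinarith
      refine ⟨⟨⟨t, y⟩, by simpa [Submonoid.unitSphere] using hu⟩, ?_⟩
      simp [chainmailLink, tube, edgeTube, UnitDisc.zero]
    rintro (⟨t, ht, rfl⟩ | ⟨t, ht, rfl⟩)
    · exact main t ht _ (Real.sq_sqrt (by nlinarith [ht.1, ht.2]))
    · exact main t ht _ (by rw [neg_sq]; exact Real.sq_sqrt (by nlinarith [ht.1, ht.2]))

/-- The slopes of an alternating surgery: negative on the edge loops, nonnegative on the vertex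
loops, and positive on at least one vertex loop in each connected component of the graph. -/
structure IsAlternating (a : V → ℚ) (b : E → ℚ) : Prop where
  edge_neg : ∀ e, b e < 0
  vertex_nonneg : ∀ v, 0 ≤ a v
  exists_pos : ∀ v, ∃ w, G.Joined v w ∧ 0 < a w

end PlanarGraph

end

set_option autoImplicit false

open Topology Set

theorem isSimplyConnected_univ (X : Type*) [TopologicalSpace X] [SimplyConnectedSpace X] :
    IsSimplyConnected (univ : Set X) :=
  (Homeomorph.Set.univ X).toHomotopyEquiv.simplyConnectedSpace

theorem StarConvex.isSimplyConnected {F : Type*} [AddCommGroup F] [Module ℝ F]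
    [TopologicalSpace F] [ContinuousAdd F] [ContinuousSMul ℝ F] {x : F} {s : Set F}
    (h : StarConvex ℝ x s) (hx : x ∈ s) : IsSimplyConnected s := by
  have := h.contractibleSpace ⟨x, hx⟩
  exact inferInstanceAs (SimplyConnectedSpace s)

instance : ContractibleSpace unitInterval :=
  (convex_Icc (0 : ℝ) 1).contractibleSpace ⟨0, by simp⟩

/-- A homotopy invariant and multiplicative assignment of group elements to the paths of a space. -/
structure Holonomy (M G : Type*) [TopologicalSpace M] [Group G] where
  /-- The element assigned to a path. -/
  hol : ∀ {a b : M}, Path a b → G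
  hol_trans : ∀ {a b c : M} (γ : Path a b) (δ : Path b c), hol (γ.trans δ) = hol γ * hol δ
  hol_homotopic : ∀ {a b : M} (γ δ : Path a b), γ.Homotopic δ → hol γ = hol δ

namespace Holonomy

variable {M G X X' : Type*} [TopologicalSpace M] [Group G] [TopologicalSpace X]
  [TopologicalSpace X'] (H : Holonomy M G)

theorem hol_refl (a : M) : H.hol (Path.refl a) = 1 := by
  have h := H.hol_trans (Path.refl a) (Path.refl a)
  rw [Path.refl_trans_refl] at h
  exact left_eq_mul.1 h

/-- A continuous curve, as a path. -/
def pathOf {c : unitInterval → M} (hc : Continuous c) : Path (c 0) (c 1) := ⟨⟨c, hc⟩, rfl, rfl⟩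

/-- A function on `S` with values in the group is a section if it is parallel along the curves
in `S`. -/
def IsSection (f : X → M) (S : Set X) (σ : X → G) : Prop :=
  ∀ γ : unitInterval → X, Continuous γ → (∀ t, γ t ∈ S) → ∀ hc : Continuous (f ∘ γ),
    σ (γ 0) = H.hol (pathOf hc) * σ (γ 1)

variable {H} {f f' : X → M} {S T : Set X} {σ τ : X → G}

namespace IsSection

theorem mono (h : H.IsSection f S σ) (hT : T ⊆ S) : H.IsSection f T σ :=
  fun γ hγ hm hc => h γ hγ (fun t => hT (hm t)) hc

theorem comp (h : H.IsSection f S σ) {g : X' → X} {S' : Set X'} (hg : ContinuousOn g S')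
    (hm : MapsTo g S' S) : H.IsSection (f ∘ g) S' (σ ∘ g) :=
  fun γ hγ hS hc => h (g ∘ γ) (hg.comp_continuous hγ hS) (fun t => hm (hS t)) hc

theorem congr_map (h : H.IsSection f S σ) (hf : EqOn f f' S) : H.IsSection f' S σ := by
  intro γ hγ hm hc
  have e : f ∘ γ = f' ∘ γ := funext fun t => hf (hm t)
  have key : ∀ c : unitInterval → M, ∀ hc' : Continuous c, f ∘ γ = c →
      σ (γ 0) = H.hol (pathOf hc') * σ (γ 1) := by
    rintro c hc' rfl
    exact h γ hγ hm hc'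
  exact key _ hc e

theorem congr (h : H.IsSection f S σ) (hσ : EqOn σ τ S) : H.IsSection f S τ := by
  intro γ hγ hm hc
  rw [← hσ (hm 0), ← hσ (hm 1)]
  exact h γ hγ hm hc

theorem mul_right (h : H.IsSection f S σ) (g : G) : H.IsSection f S fun x => σ x * g := by
  intro γ hγ hm hc
  dsimp only
  rw [h γ hγ hm hc, mul_assoc]

theorem eq_hol (h : H.IsSection f S σ) (hf : ContinuousOn f S) {x y : X} (γ : Path x y)
    (hm : ∀ t, γ t ∈ S) :
    σ x = H.hol ((pathOf (hf.comp_continuous γ.continuous hm)).cast (congrArg f γ.source).symm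
      (congrArg f γ.target).symm) * σ y := by
  have := h γ γ.continuous hm (hf.comp_continuous γ.continuous hm)
  obtain ⟨⟨γ, hγ⟩, rfl, rfl⟩ := γ
  exact this

end IsSection

theorem exists_forall_eq_mul (hf : ContinuousOn f S) {x y : X} (hxy : JoinedIn S x y) :
    ∃ g : G, ∀ σ : X → G, H.IsSection f S σ → σ x = g * σ y := by
  obtain ⟨γ, hγ⟩ := hxy
  exact ⟨_, fun σ h => h.eq_hol hf γ hγ⟩

namespace IsSection

theorem mul_eq (h : H.IsSection f S σ) (h' : H.IsSection f S τ) (hf : ContinuousOn f S)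
    (hS : IsPathConnected S) {x y : X} (hx : x ∈ S) (hy : y ∈ S) :
    (σ x)⁻¹ * τ x = (σ y)⁻¹ * τ y := by
  obtain ⟨g, hg⟩ := exists_forall_eq_mul (H := H) hf (hS.joinedIn x hx y hy)
  rw [hg σ h, hg τ h']
  group

theorem exists_const (h : H.IsSection f S σ) (h' : H.IsSection f S τ) (hf : ContinuousOn f S)
    (hS : IsPathConnected S) : ∃ c : G, ∀ x ∈ S, τ x = σ x * c := by
  obtain ⟨y, hy, -⟩ := id hS
  refine ⟨(σ y)⁻¹ * τ y, fun x hx => ?_⟩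
  rw [← h.mul_eq h' hf hS hx hy, mul_inv_cancel_left]

theorem eqOn (h : H.IsSection f S σ) (h' : H.IsSection f S τ) (hf : ContinuousOn f S)
    (hS : IsPathConnected S) {x : X} (hx : x ∈ S) (e : σ x = τ x) : EqOn σ τ S := by
  intro y hy
  have := h.mul_eq h' hf hS hx hy
  rw [e, inv_mul_cancel] at this
  exact (eq_of_inv_mul_eq_one this.symm)

end IsSection

theorem exists_section (hS : IsSimplyConnected S) (hf : ContinuousOn f S) (x₀ : X) (hx₀ : x₀ ∈ S)
    (g : G) : ∃ σ : X → G, H.IsSection f S σ ∧ σ x₀ = g := by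
  classical
  have : SimplyConnectedSpace S := hS.simplyConnectedSpace
  have hc : Continuous fun x : S => f x := hf.domRestrict
  let γ : ∀ x : S, Path x ⟨x₀, hx₀⟩ := fun x => PathConnectedSpace.somePath _ _
  refine ⟨fun x => if h : x ∈ S then (H.hol ((γ ⟨x, h⟩).map hc) *
    (H.hol ((γ ⟨x₀, hx₀⟩).map hc))⁻¹) * g else 1, ?_, by simp [hx₀]⟩
  intro δ hδ hm hc'
  dsimp only
  rw [dif_pos (hm 0), dif_pos (hm 1)]
  let δ' : Path (⟨δ 0, hm 0⟩ : S) ⟨δ 1, hm 1⟩ :=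
    ⟨⟨fun t => ⟨δ t, hm t⟩, hδ.subtype_mk hm⟩, rfl, rfl⟩
  have h1 : H.hol (pathOf hc') = H.hol (δ'.map hc) := rfl
  have h2 : H.hol ((γ ⟨δ 0, hm 0⟩).map hc) =
      H.hol (δ'.map hc) * H.hol ((γ ⟨δ 1, hm 1⟩).map hc) := by
    rw [← H.hol_trans, ← Path.map_trans]
    exact H.hol_homotopic _ _ ((SimplyConnectedSpace.paths_homotopic _ _).map ⟨_, hc⟩)
  rw [h1, h2]
  group

theorem IsSection.of_local (hf : ContinuousOn f S)
    (h : ∀ x ∈ S, ∃ U : Set X, IsOpen U ∧ x ∈ U ∧ H.IsSection f (U ∩ S) σ) :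
    H.IsSection f S σ := by
  intro γ hγ hm hc
  let c : ℝ → X := fun t => γ (projIcc 0 1 zero_le_one t)
  have hcc : Continuous c := hγ.comp continuous_projIcc
  have hcS : ∀ t, c t ∈ S := fun t => hm _
  have hfc : Continuous (f ∘ c) := hf.comp_continuous hcc hcS
  obtain ⟨ξ, hξ, -⟩ := exists_section (H := H) (f := f ∘ c) (S := univ) (X := ℝ)
    (isSimplyConnected_univ ℝ) hfc.continuousOn 0 (mem_univ _) 1
  have hloc : IsLocallyConstant fun t => (ξ t)⁻¹ * σ (c t) := by
    rw [IsLocallyConstant.iff_eventually_eq]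
    intro t
    obtain ⟨U, hU, ht, hs⟩ := h (c t) (hcS t)
    obtain ⟨ε, hε, hb⟩ := Metric.isOpen_iff.1 (hU.preimage hcc) t ht
    filter_upwards [Metric.ball_mem_nhds t hε] with s hs'
    have h1 : H.IsSection (f ∘ c) (Metric.ball t ε) (σ ∘ c) :=
      hs.comp hcc.continuousOn fun r hr => ⟨hb hr, hcS r⟩
    exact (hξ.mono (subset_univ _)).mul_eq h1 hfc.continuousOn
      ((convex_ball t ε).isPathConnected ⟨t, Metric.mem_ball_self hε⟩) hs'
      (Metric.mem_ball_self hε)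
  have h01 := hloc.apply_eq_of_preconnectedSpace 0 1
  have hi := hξ (fun t : unitInterval => (t : ℝ)) continuous_subtype_val (fun _ => mem_univ _)
    (hfc.comp continuous_subtype_val)
  have e : (f ∘ c) ∘ (fun t : unitInterval => (t : ℝ)) = f ∘ γ := by
    funext t
    simp [c]
  have c0 : c 0 = γ 0 := by simp [c]
  have c1 : c 1 = γ 1 := by simp [c]
  have hh : ∀ d : unitInterval → M, ∀ hd : Continuous d, d = f ∘ γ →
      ∀ a b : G, a = H.hol (pathOf hd) * b → a = H.hol (pathOf hc) * b := by
    rintro _ hd rfl a b hab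
    exact hab
  have hi' := hh _ _ e _ _ hi
  rw [c0, c1] at h01
  have e0 : ((0 : unitInterval) : ℝ) = 0 := rfl
  have e1 : ((1 : unitInterval) : ℝ) = 1 := rfl
  rw [e0, e1] at hi'
  have : σ (γ 0) = ξ 0 * ((ξ 1)⁻¹ * σ (γ 1)) := by rw [← h01]; group
  rw [this, hi']
  group

/-- Sections on the members of an open cover which agree on the overlaps can be glued. -/
theorem exists_glue {κ : Type*} (U : κ → Set X) (s : κ → X → G) (hU : ∀ k, IsOpen (U k))
    (hf : ContinuousOn f (⋃ k, U k)) (hs : ∀ k, H.IsSection f (U k) (s k))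
    (hag : ∀ k l, EqOn (s k) (s l) (U k ∩ U l)) :
    ∃ σ : X → G, H.IsSection f (⋃ k, U k) σ ∧ ∀ k, EqOn σ (s k) (U k) := by
  classical
  let σ : X → G := fun x => if h : ∃ k, x ∈ U k then s h.choose x else 1
  have hσ : ∀ k, EqOn σ (s k) (U k) := by
    intro k x hx
    have h : ∃ k, x ∈ U k := ⟨k, hx⟩
    simp only [σ, dif_pos h]
    exact hag _ _ ⟨h.choose_spec, hx⟩
  refine ⟨σ, IsSection.of_local hf fun x hx => ?_, hσ⟩
  obtain ⟨k, hk⟩ := mem_iUnion.1 hx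
  exact ⟨U k, hU k, hk, ((hs k).congr (hσ k).symm).mono inter_subset_left⟩

/-- Transport of a section along the tracks of a homotopy. -/
theorem IsSection.of_homotopy {R : X × unitInterval → M} (hR : ContinuousOn R (S ×ˢ univ))
    (h0 : ∀ x ∈ S, R (x, 0) = f x) (h1 : ∀ x ∈ S, R (x, 1) = f' x) (h : H.IsSection f' S τ)
    (hσ : ∀ x ∈ S, ∀ hc : Continuous fun s : unitInterval => R (x, s),
      σ x = H.hol (pathOf hc) * τ x) : H.IsSection f S σ := by
  intro γ hγ hm hc
  have hF : Continuous fun q : unitInterval × unitInterval => R (γ q.1, q.2) :=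
    hR.comp_continuous (by fun_prop) fun q => ⟨hm _, mem_univ _⟩
  have hsc : IsSimplyConnected (univ : Set (unitInterval × unitInterval)) :=
    isSimplyConnected_univ _
  obtain ⟨ξ, hξ, hξ1⟩ := exists_section (H := H) hsc hF.continuousOn (1, 1) (mem_univ _)
    (τ (γ 1))
  have hpc : IsPathConnected (univ : Set unitInterval) := by
    rw [← pathConnectedSpace_iff_univ]; infer_instance
  have e1 : EqOn (fun t : unitInterval => ξ (t, 1)) (fun t => τ (γ t)) univ := by
    refine IsSection.eqOn (H := H) (f := f' ∘ γ) ?_ ?_ ?_ hpc (mem_univ 1) hξ1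
    · refine (hξ.comp (g := fun t : unitInterval => (t, (1 : unitInterval))) (by fun_prop)
        (fun _ _ => mem_univ _)).congr_map fun t _ => h1 _ (hm t)
    · exact h.comp hγ.continuousOn fun t _ => hm t
    · have : Continuous fun t : unitInterval => R (γ t, 1) :=
        hF.comp (Continuous.prodMk continuous_id continuous_const)
      exact (this.congr fun t => h1 _ (hm t)).continuousOn
  have e0 : ∀ t, ξ (t, 0) = σ (γ t) := by
    intro t
    have hct : Continuous fun s : unitInterval => R (γ t, s) :=
      hF.comp (Continuous.prodMk continuous_const continuous_id)
    have e := e1 (mem_univ t)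
    dsimp only at e
    rw [hσ _ (hm t) hct, ← e]
    exact hξ (fun s => (t, s)) (by fun_prop) (fun _ => mem_univ _) hct
  have hc0 : Continuous ((fun q : unitInterval × unitInterval => R (γ q.1, q.2)) ∘
      fun t : unitInterval => (t, (0 : unitInterval))) := hF.comp (by fun_prop)
  have hi := hξ (fun t => (t, 0)) (by fun_prop) (fun _ => mem_univ _) hc0
  have hh : ∀ d : unitInterval → M, ∀ hd : Continuous d, d = f ∘ γ →
      ∀ a b : G, a = H.hol (pathOf hd) * b → a = H.hol (pathOf hc) * b := by
    rintro _ hd rfl a b hab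
    exact hab
  have := hh _ hc0 (funext fun t => h0 _ (hm t)) _ _ hi
  rwa [e0, e0] at this

end Holonomy

namespace PlaneDomain

open Complex

theorem exists_log {A : Type*} [TopologicalSpace A] [SimplyConnectedSpace A]
    [LocallyPathConnectedSpace A] {F : A → ℂ} (hF : Continuous F) (h0 : ∀ a, F a ≠ 0) :
    ∃ L : A → ℂ, Continuous L ∧ ∀ a, exp (L a) = F a := by
  obtain ⟨a₀⟩ : Nonempty A := inferInstance
  obtain ⟨L, ⟨-, hL⟩, -⟩ := isCoveringMapOn_exp.existsUnique_continuousMap_lifts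
    (f := ⟨F, hF⟩) (a₀ := a₀) (e₀ := log (F a₀)) (exp_log (h0 a₀)) (by simpa using fun a => h0 a)
  exact ⟨L, L.continuous, fun a => congrFun hL a⟩

theorem eq_of_exp_eq_one {A : Type*} [TopologicalSpace A] [SimplyConnectedSpace A]
    [LocallyPathConnectedSpace A] {D : A → ℂ} (hD : Continuous D) (h : ∀ a, exp (D a) = 1)
    (a b : A) : D a = D b := by
  obtain ⟨L, -, hL⟩ := isCoveringMapOn_exp.existsUnique_continuousMap_lifts
    (f := ContinuousMap.const A (1 : ℂ)) (a₀ := b) (e₀ := D b) (h b) (by simp)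
  have h1 := hL ⟨D, hD⟩ ⟨rfl, funext h⟩
  have h2 := hL (ContinuousMap.const A (D b)) ⟨rfl, funext fun _ => h b⟩
  have := congrArg (fun f : C(A, ℂ) => f a) (h1.trans h2.symm)
  exact this

/-- A loop (parametrised by the angle) in the punctured plane which has a logarithm. -/
def IsNullLoop (g : ℝ → ℂ) : Prop :=
  ∃ l : ℝ → ℂ, Continuous l ∧ (∀ θ, exp (l θ) = g θ) ∧ ∀ θ, l (θ + 2 * Real.pi) = l θ

theorem isNullLoop_const {c : ℂ} (hc : c ≠ 0) : IsNullLoop fun _ => c :=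
  ⟨fun _ => log c, continuous_const, fun _ => exp_log hc, fun _ => rfl⟩

theorem IsNullLoop.homotopy {F : ℝ × ℝ → ℂ} (hF : Continuous F) (h0 : ∀ a, F a ≠ 0)
    (hp : ∀ s θ, F (s, θ + 2 * Real.pi) = F (s, θ)) {s t : ℝ}
    (h : IsNullLoop fun θ => F (s, θ)) : IsNullLoop fun θ => F (t, θ) := by
  obtain ⟨L, hL, hLF⟩ := exists_log hF h0
  obtain ⟨l, hl, hlF, hlp⟩ := h
  have h1 : ∀ θ θ', L (s, θ) - l θ = L (s, θ') - l θ' :=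
    eq_of_exp_eq_one (by fun_prop) fun θ => by
      rw [exp_sub, hLF, hlF, div_self (h0 _)]
  have h2 : ∀ a b : ℝ × ℝ, L (a.1, a.2 + 2 * Real.pi) - L a = L (b.1, b.2 + 2 * Real.pi) - L b :=
    eq_of_exp_eq_one (by fun_prop) fun a => by
      rw [exp_sub, hLF, hLF, hp, div_self (h0 _)]
  refine ⟨fun θ => L (t, θ), by fun_prop, fun θ => hLF _, fun θ => ?_⟩
  have h3 := h2 (t, θ) (s, 0)
  have h4 := h1 (0 + 2 * Real.pi) 0
  rw [hlp] at h4
  dsimp only at h3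
  rw [sub_left_inj.1 h4, sub_self] at h3
  exact sub_eq_zero.1 h3

theorem not_isNullLoop_of_odd {g : ℝ → ℂ} (h : ∀ θ, g (θ + Real.pi) = -g θ) :
    ¬ IsNullLoop g := by
  rintro ⟨l, hl, hlg, hp⟩
  have h0 : ∀ θ, g θ ≠ 0 := fun θ => by rw [← hlg]; exact exp_ne_zero _
  have h1 : ∀ θ θ', l (θ + Real.pi) - l θ - Real.pi * I = l (θ' + Real.pi) - l θ' - Real.pi * I :=
    eq_of_exp_eq_one (by fun_prop) fun θ => by
      rw [exp_sub, exp_sub, hlg, hlg, h, exp_pi_mul_I, neg_div, div_self (h0 _), div_self (by simp)]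
  have h2 := h1 (0 + Real.pi) 0
  have h3 := hp 0
  have h4 : (0 : ℝ) + Real.pi + Real.pi = 0 + 2 * Real.pi := by ring
  rw [h4, h3] at h2
  have h5 : l (0 + Real.pi) = l 0 := by linear_combination (-1 / 2 : ℂ) * h2
  have h6 := h 0
  rw [← hlg, ← hlg, h5] at h6
  exact exp_ne_zero _ (self_eq_neg.1 h6)

/-- An injective continuous map of a closed disc to the plane covers a neighbourhood of the image
of the centre. -/
theorem mem_nhds_image_closedBall {f : ℂ → ℂ} {x : ℂ} {r : ℝ} (hr : 0 < r)
    (hf : ContinuousOn f (Metric.closedBall x r)) (hi : InjOn f (Metric.closedBall x r)) :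
    f '' Metric.closedBall x r ∈ 𝓝 (f x) := by
  let e : ℝ → ℂ := fun θ => exp (θ * I)
  have he : Continuous e := by fun_prop
  have hen : ∀ θ, ‖e θ‖ = 1 := fun θ => norm_exp_ofReal_mul_I θ
  have hep : ∀ θ, e (θ + 2 * Real.pi) = e θ := fun θ => by
    simp only [e]; push_cast; rw [add_mul, exp_add, exp_two_pi_mul_I, mul_one]
  have heo : ∀ θ, e (θ + Real.pi) = -e θ := fun θ => by
    simp only [e]; push_cast; rw [add_mul, exp_add, exp_pi_mul_I, mul_neg_one]
  let c : ℝ → ℝ := fun s => max 0 (min s 1)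
  have hc : Continuous c := by fun_prop
  have hc0 : ∀ s, 0 ≤ c s := fun s => le_max_left _ _
  have hc1 : ∀ s, c s ≤ 1 := fun s => max_le zero_le_one (min_le_right _ _)
  have hmem : ∀ a : ℝ, |a| ≤ 1 → ∀ θ, x + r * a * e θ ∈ Metric.closedBall x r := by
    intro a ha θ
    rw [mem_closedBall_iff_norm, add_sub_cancel_left, norm_mul, norm_mul, hen, norm_real, norm_real,
      Real.norm_eq_abs, Real.norm_eq_abs, abs_of_pos hr, mul_one]
    nlinarith
  have hne : ∀ a b : ℝ, |a| ≤ 1 → |b| ≤ 1 → a ≠ b → ∀ θ,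
      f (x + r * a * e θ) - f (x + r * b * e θ) ≠ 0 := by
    intro a b ha hb hab θ h
    have h1 := hi (hmem a ha θ) (hmem b hb θ) (sub_eq_zero.1 h)
    have h2 : (r : ℂ) * e θ * (a - b) = 0 := by linear_combination h1
    have h3 : e θ ≠ 0 := exp_ne_zero _
    have h4 : (r : ℂ) ≠ 0 := by exact_mod_cast hr.ne'
    rcases mul_eq_zero.1 h2 with h5 | h5
    · exact (mul_ne_zero h4 h3) h5
    · exact hab (by exact_mod_cast sub_eq_zero.1 h5)
  have hcomp : ∀ a : ℝ × ℝ → ℝ, Continuous a → (∀ q, |a q| ≤ 1) →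
      Continuous fun q : ℝ × ℝ => f (x + r * a q * e q.2) := by
    intro a ha h1
    exact hf.comp_continuous (by fun_prop) fun q => hmem _ (h1 q) _
  obtain ⟨y, hy, hmin⟩ := (isCompact_sphere x r).exists_isMinOn
    (f := fun y => ‖f y - f x‖) ⟨x + r, by simp [abs_of_pos hr]⟩
    ((hf.mono Metric.sphere_subset_closedBall).sub continuousOn_const).norm
  have hm : 0 < ‖f y - f x‖ := by
    rw [norm_pos_iff, sub_ne_zero]
    intro h
    have := hi (Metric.sphere_subset_closedBall hy) (Metric.mem_closedBall_self hr.le) h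
    rw [this] at hy
    simp [hr.ne] at hy
  refine Filter.mem_of_superset (Metric.ball_mem_nhds _ hm) fun w hw => ?_
  by_contra hwn
  rw [mem_ball_iff_norm] at hw
  have habs : ∀ s, |c s| ≤ 1 := fun s => abs_le.2 ⟨by linarith [hc0 s], hc1 s⟩
  -- the boundary loop, seen from a point outside the image, is null
  have n1 : IsNullLoop fun θ => f (x + r * (1 : ℝ) * e θ) - w := by
    have := IsNullLoop.homotopy (F := fun q => f (x + r * (c q.1 : ℝ) * e q.2) - w) (s := 0)
      (t := 1)
      ((hcomp (fun q => c q.1) (by fun_prop) fun q => habs _).sub continuous_const)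
      (fun q h => hwn ⟨_, hmem _ (habs _) _, sub_eq_zero.1 h⟩) (fun s θ => by simp only [hep])
    simp only [c, min_eq_left zero_le_one, max_self, min_self, max_eq_right zero_le_one] at this
    refine this ?_
    simp only [ofReal_zero, mul_zero, zero_mul, add_zero]
    exact isNullLoop_const fun h =>
      hwn ⟨x, Metric.mem_closedBall_self hr.le, sub_eq_zero.1 h⟩
  have n2 : IsNullLoop fun θ => f (x + r * (1 : ℝ) * e θ) - f x := by
    have := IsNullLoop.homotopy (s := 0) (t := 1)
      (F := fun q => f (x + r * (1 : ℝ) * e q.2) - (w + (c q.1 : ℝ) * (f x - w)))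
      ((hcomp (fun q => 1) (by fun_prop) fun q => by simp).sub (by fun_prop))
      (fun q h => ?_) (fun s θ => by simp only [hep])
    · simp only [c, min_eq_left zero_le_one, max_self, min_self, max_eq_right zero_le_one] at this
      simp only [ofReal_zero, zero_mul, add_zero, ofReal_one, one_mul, add_sub_cancel] at this
      simpa using this (by simpa using n1)
    · have h1 := hmin (show x + r * (1 : ℝ) * e q.2 ∈ Metric.sphere x r by
        rw [mem_sphere_iff_norm, add_sub_cancel_left, norm_mul, norm_mul, hen, norm_real,
          Real.norm_eq_abs, abs_of_pos hr]; simp)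
      have h2 : f (x + r * (1 : ℝ) * e q.2) - f x = (1 - (c q.1 : ℝ)) * (w - f x) := by
        linear_combination h
      simp only [mem_ofPred_eq] at h1
      rw [h2, norm_mul] at h1
      have h3 : ‖(1 : ℂ) - (c q.1 : ℝ)‖ ≤ 1 := by
        rw [← ofReal_one, ← ofReal_sub, norm_real, Real.norm_eq_abs]
        exact abs_le.2 ⟨by linarith [hc1 q.1], by linarith [hc0 q.1]⟩
      nlinarith [norm_nonneg (w - f x)]
  have n3 := IsNullLoop.homotopy (s := 0) (t := 1)
    (F := fun q => f (x + r * ((1 + c q.1)⁻¹ : ℝ) * e q.2) -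
      f (x + r * (-(c q.1 * (1 + c q.1)⁻¹) : ℝ) * e q.2)) ?_ ?_ (fun s θ => by simp only [hep])
    (by simpa [c] using n2)
  · refine not_isNullLoop_of_odd (fun θ => ?_) n3
    simp only [c, heo, min_self, max_eq_right zero_le_one]
    rw [neg_sub]
    congr 2 <;> · push_cast; ring
  · have hc' : Continuous fun q : ℝ × ℝ => (1 + c q.1)⁻¹ :=
      Continuous.inv₀ (by fun_prop) fun q => by have := hc0 q.1; positivity
    refine (hcomp (fun q => (1 + c q.1)⁻¹) hc' fun q => ?_).sub
      (hcomp (fun q => -(c q.1 * (1 + c q.1)⁻¹)) (by fun_prop) fun q => ?_)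
    · have := hc0 q.1
      rw [abs_of_nonneg (by positivity)]
      exact inv_le_one_of_one_le₀ (by linarith)
    · have := hc0 q.1
      rw [abs_neg, abs_of_nonneg (by positivity), ← div_eq_mul_inv, div_le_one (by positivity)]
      linarith
  · intro q
    have := hc0 q.1
    refine hne _ _ ?_ ?_ ?_ _
    · rw [abs_of_nonneg (by positivity)]
      exact inv_le_one_of_one_le₀ (by linarith)
    · rw [abs_neg, abs_of_nonneg (by positivity), ← div_eq_mul_inv, div_le_one (by positivity)]
      linarith
    · have h1 : 0 < (1 + c q.1)⁻¹ := by positivity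
      have h2 : 0 ≤ c q.1 * (1 + c q.1)⁻¹ := by positivity
      linarith

/-- Invariance of domain in the plane. -/
theorem isOpen_image {f : ℂ → ℂ} {U : Set ℂ} (hU : IsOpen U) (hf : ContinuousOn f U)
    (hi : InjOn f U) : IsOpen (f '' U) := by
  rw [isOpen_iff_mem_nhds]
  rintro _ ⟨x, hx, rfl⟩
  obtain ⟨r, hr, hb⟩ := Metric.nhds_basis_closedBall.mem_iff.1 (hU.mem_nhds hx)
  exact Filter.mem_of_superset (mem_nhds_image_closedBall hr (hf.mono hb) (hi.mono hb))
    (image_mono hb)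

end PlaneDomain

theorem continuous_sum_prod {A B Y Z : Type*} [TopologicalSpace A] [TopologicalSpace B]
    [TopologicalSpace Y] [TopologicalSpace Z] {f : (A ⊕ B) × Y → Z}
    (h1 : Continuous fun p : A × Y => f (Sum.inl p.1, p.2))
    (h2 : Continuous fun p : B × Y => f (Sum.inr p.1, p.2)) : Continuous f := by
  have h : Continuous (Sum.elim (fun p : A × Y => f (Sum.inl p.1, p.2))
      fun p : B × Y => f (Sum.inr p.1, p.2)) := h1.sumElim h2
  refine (h.comp (Homeomorph.sumProdDistrib (X := A) (Y := B) (Z := Y)).continuous).congr ?_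
  rintro ⟨a | b, y⟩ <;> rfl

theorem continuous_sigma_prod {κ Y Z : Type*} {A : κ → Type*} [∀ k, TopologicalSpace (A k)]
    [TopologicalSpace Y] [TopologicalSpace Z] {f : (Σ k, A k) × Y → Z}
    (h : ∀ k, Continuous fun p : A k × Y => f (⟨k, p.1⟩, p.2)) : Continuous f := by
  have h' : Continuous fun q : Σ k, A k × Y => f (⟨q.1, q.2.1⟩, q.2.2) := continuous_sigma h
  exact (h'.comp (Homeomorph.sigmaProdDistrib (X := A) (Y := Y)).continuous).congr fun _ => rfl

/-- A function on the image of an embedding is continuous if its pullback is. -/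
theorem Topology.IsEmbedding.continuousOn_image {A X Z : Type*} [TopologicalSpace A]
    [TopologicalSpace X] [TopologicalSpace Z] {j : A → X} (hj : IsEmbedding j) {f : X → Z}
    {T : Set A} (h : ContinuousOn (f ∘ j) T) : ContinuousOn f (j '' T) := by
  rintro _ ⟨a, ha, rfl⟩
  rw [ContinuousWithinAt, ← hj.map_nhdsWithin_eq T a, Filter.tendsto_map'_iff]
  exact h a ha

instance : ContractibleSpace UnitDisc :=
  (convex_closedBall (0 : ℂ) 1).contractibleSpace ⟨0, by simp⟩

instance : CompactSpace UnitDisc := isCompact_iff_compactSpace.1 (isCompact_closedBall 0 1)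

theorem Circle.isPathConnected_univ : IsPathConnected (univ : Set Circle) := by
  rw [← Circle.exp_surjective.range_eq]
  exact isPathConnected_range Circle.exp.continuous

namespace UnitDisc

@[simp] theorem coe_ofCircle (z : Circle) : (ofCircle z : ℂ) = z := rfl

theorem norm_le_one (z : UnitDisc) : ‖(z : ℂ)‖ ≤ 1 := mem_closedBall_zero_iff.1 z.2

theorem continuous_ofCircle : Continuous ofCircle :=
  Continuous.subtype_mk continuous_subtype_val _

/-- The points of the segment joining two points of the disc. -/
noncomputable def blend (z z' : UnitDisc) (s : unitInterval) : UnitDisc :=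
  ⟨(1 - (s : ℝ)) • (z : ℂ) + (s : ℝ) • (z' : ℂ),
    convex_closedBall (0 : ℂ) 1 z.2 z'.2 (by linarith [s.2.2]) s.2.1 (by ring)⟩

@[simp] theorem blend_zero (z z' : UnitDisc) : blend z z' 0 = z := Subtype.ext (by simp [blend])

@[simp] theorem blend_one (z z' : UnitDisc) : blend z z' 1 = z' := Subtype.ext (by simp [blend])

@[simp] theorem blend_self (z : UnitDisc) (s : unitInterval) : blend z z s = z :=
  Subtype.ext (by simp only [blend]; rw [← add_smul]; simp)

theorem continuous_blend {A : Type*} [TopologicalSpace A] {f g : A → UnitDisc}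
    {s : A → unitInterval} (hf : Continuous f) (hg : Continuous g) (hs : Continuous s) :
    Continuous fun a => blend (f a) (g a) (s a) := by
  refine Continuous.subtype_mk ?_ _
  fun_prop

/-- The radial map of the disc which stretches the inner half onto the disc. -/
noncomputable def stretch (z : UnitDisc) : UnitDisc :=
  ⟨(z : ℂ) / (max ‖(z : ℂ)‖ (1 / 2) : ℝ), by
    rw [mem_closedBall_zero_iff, norm_div, Complex.norm_real, Real.norm_eq_abs,
      abs_of_pos (by positivity)]
    exact div_le_one_of_le₀ (le_max_left _ _) (by positivity)⟩

theorem continuous_stretch : Continuous stretch := by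
  refine Continuous.subtype_mk ?_ _
  refine continuous_subtype_val.div (by fun_prop) fun z => ?_
  have : (0 : ℝ) < max ‖(z : ℂ)‖ (1 / 2) := by positivity
  exact_mod_cast this.ne'

theorem norm_stretch {z : UnitDisc} (hz : 1 / 2 ≤ ‖(z : ℂ)‖) : ‖(stretch z : ℂ)‖ = 1 := by
  simp only [stretch]
  rw [norm_div, Complex.norm_real, Real.norm_eq_abs, abs_of_pos (by positivity), max_eq_left hz,
    div_self (by linarith)]

theorem stretch_eq_self {z : UnitDisc} (hz : ‖(z : ℂ)‖ = 1) : stretch z = z := by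
  refine Subtype.ext ?_
  simp only [stretch]
  rw [hz, max_eq_left (by norm_num)]
  simp

theorem exists_ofCircle {z : UnitDisc} (hz : ‖(z : ℂ)‖ = 1) : ∃ u : Circle, ofCircle u = z :=
  ⟨⟨z, by simpa [Submonoid.unitSphere] using hz⟩, rfl⟩

/-- The radial projection of the disc minus its centre to the boundary circle. -/
noncomputable def radial (z : UnitDisc) : UnitDisc :=
  ⟨(z : ℂ) / (‖(z : ℂ)‖ : ℝ), by
    rw [mem_closedBall_zero_iff, norm_div, Complex.norm_real, Real.norm_eq_abs, abs_norm]
    exact div_self_le_one _⟩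

theorem norm_radial {z : UnitDisc} (hz : (z : ℂ) ≠ 0) : ‖(radial z : ℂ)‖ = 1 := by
  simp only [radial]
  rw [norm_div, Complex.norm_real, Real.norm_eq_abs, abs_norm, div_self (norm_ne_zero_iff.2 hz)]

theorem radial_eq_self {z : UnitDisc} (hz : ‖(z : ℂ)‖ = 1) : radial z = z :=
  Subtype.ext (by simp [radial, hz])

theorem continuousOn_radial : ContinuousOn radial {z | (z : ℂ) ≠ 0} := by
  rw [continuousOn_iff_continuous_domRestrict]
  refine Continuous.subtype_mk ?_ _
  refine Continuous.div (by fun_prop) (by fun_prop) fun z => ?_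
  exact_mod_cast norm_ne_zero_iff.2 z.2

end UnitDisc

namespace Holonomy

theorem IsSection.of_embedding {M G X A : Type*} [TopologicalSpace M] [Group G]
    [TopologicalSpace X] [TopologicalSpace A] {H : Holonomy M G} {j : A → X} (hj : IsEmbedding j)
    {f : X → M} {σ : X → G} {T : Set A} (h : H.IsSection (f ∘ j) T (σ ∘ j)) :
    H.IsSection f (j '' T) σ := by
  intro γ hγ hm hc
  choose δ hδ e using hm
  have e' : j ∘ δ = γ := funext e
  have hδc : Continuous δ := hj.isInducing.continuous_iff.2 (e' ▸ hγ)
  subst e'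
  exact h δ hδc hδ hc

end Holonomy

namespace FramedLink

open Holonomy

variable {ι : Type*} (L : FramedLink ι) (s : ι → ℚ)

/-- The interiors of the solid tori are open. -/
def HasOpenTubes : Prop := ∀ i, IsOpen (L.tube i '' {p | ‖(p.2 : ℂ)‖ < 1})

/-- The complement of the link. -/
def Complement : Set ThreeSphere := {x | ∀ (i : ι) (u : Circle), L.tube i (u, UnitDisc.zero) ≠ x}

theorem tube_eq_iff {i j : ι} {p q : Circle × UnitDisc} :
    L.tube i p = L.tube j q ↔ i = j ∧ p = q := by
  constructor
  · intro h
    have := L.injective_tube (a₁ := (i, p)) (a₂ := (j, q)) h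
    exact ⟨congrArg Prod.fst this, congrArg Prod.snd this⟩
  · rintro ⟨rfl, rfl⟩
    rfl

theorem isEmbedding_tube (i : ι) : IsClosedEmbedding (L.tube i) :=
  (L.continuous_tube i).isClosedEmbedding fun _ _ h => (L.tube_eq_iff.1 h).2

/-- The points on the boundaries of the solid tori belong to the exterior. -/
noncomputable def bdry (i : ι) (u : Circle) (z : UnitDisc) (hz : ‖(z : ℂ)‖ = 1) : L.Exterior :=
  ⟨L.tube i (u, z), by
    rintro j v w hw h
    obtain ⟨rfl, h'⟩ := L.tube_eq_iff.1 h
    obtain rfl : w = z := (Prod.mk.inj h').2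
    exact hw.ne hz⟩

/-- The quotient map onto the surgery. -/
def proj (p : L.Pieces) : L.Surgery s := Quot.mk _ p

theorem isQuotientMap_proj : IsQuotientMap (L.proj s) := isQuotientMap_quot_mk

theorem proj_glue (i : ι) (z w : Circle) :
    L.proj s (Sum.inr ⟨i, UnitDisc.ofCircle z, w⟩) =
      L.proj s (Sum.inl (L.bdry i (gluingMap (s i) z w).1
        (UnitDisc.ofCircle (gluingMap (s i) z w).2) (Circle.norm_coe _))) :=
  Quot.sound (Glue.glue i z w _ rfl)

theorem continuous_inner (i : ι) :
    Continuous fun p : UnitDisc × Circle => L.proj s (Sum.inr ⟨i, p⟩) :=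
  (L.isQuotientMap_proj s).continuous.comp (continuous_inr.comp continuous_sigmaMk)

theorem continuous_gluingMap (r : ℚ) :
    Continuous fun p : Circle × Circle => gluingMap r p.1 p.2 := by
  unfold gluingMap
  fun_prop

open Classical in
/-- The radial retraction of the complement of the link onto its exterior, followed by the inclusion
of the exterior into the surgery. -/
noncomputable def toSurgery (x : ThreeSphere) : L.Surgery s :=
  if h : ∃ p : ι × (Circle × UnitDisc), L.tube p.1 p.2 = x then
    if h0 : (h.choose.2.2 : ℂ) = 0 then L.proj s (Sum.inr ⟨h.choose.1, UnitDisc.zero, 1⟩)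
    else L.proj s (Sum.inl (L.bdry h.choose.1 h.choose.2.1 (UnitDisc.radial h.choose.2.2)
      (UnitDisc.norm_radial h0)))
  else L.proj s (Sum.inl ⟨x, fun i u w _ e => h ⟨(i, (u, w)), e⟩⟩)

theorem toSurgery_tube (i : ι) (u : Circle) (z : UnitDisc) (hz : (z : ℂ) ≠ 0) :
    L.toSurgery s (L.tube i (u, z)) =
      L.proj s (Sum.inl (L.bdry i u (UnitDisc.radial z) (UnitDisc.norm_radial hz))) := by
  have h : ∃ p : ι × (Circle × UnitDisc), L.tube p.1 p.2 = L.tube i (u, z) := ⟨(i, (u, z)), rfl⟩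
  have e : h.choose = (i, (u, z)) := L.injective_tube h.choose_spec
  have h0 : (h.choose.2.2 : ℂ) ≠ 0 := by rw [e]; exact hz
  rw [toSurgery, dif_pos h, dif_neg h0]
  have : ∀ q : ι × (Circle × UnitDisc), ∀ hq : (q.2.2 : ℂ) ≠ 0, q = (i, (u, z)) →
      L.bdry q.1 q.2.1 (UnitDisc.radial q.2.2) (UnitDisc.norm_radial hq) =
        L.bdry i u (UnitDisc.radial z) (UnitDisc.norm_radial hz) := by
    rintro _ _ rfl
    rfl
  exact congrArg (fun y => L.proj s (Sum.inl y)) (this _ h0 e)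

theorem toSurgery_exterior (x : L.Exterior) : L.toSurgery s x.1 = L.proj s (Sum.inl x) := by
  by_cases h : ∃ p : ι × (Circle × UnitDisc), L.tube p.1 p.2 = x.1
  · obtain ⟨⟨i, u, z⟩, e⟩ := h
    have hz : ‖(z : ℂ)‖ = 1 := by
      refine le_antisymm z.norm_le_one (not_lt.1 fun hlt => x.2 i u z hlt e)
    rw [← e, L.toSurgery_tube s i u z (norm_ne_zero_iff.1 (by rw [hz]; exact one_ne_zero))]
    congr 2
    refine Subtype.ext ?_
    rw [← e]
    exact congrArg (fun w => L.tube i (u, w)) (UnitDisc.radial_eq_self hz)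
  · rw [toSurgery, dif_neg h]
    rfl

theorem isClosed_exterior (hO : L.HasOpenTubes) : IsClosed {x : ThreeSphere |
    ∀ (i : ι) (u : Circle) (w : UnitDisc), ‖(w : ℂ)‖ < 1 → L.tube i (u, w) ≠ x} := by
  have : {x : ThreeSphere | ∀ (i : ι) (u : Circle) (w : UnitDisc), ‖(w : ℂ)‖ < 1 →
      L.tube i (u, w) ≠ x} = ⋂ i, (L.tube i '' {p | ‖(p.2 : ℂ)‖ < 1})ᶜ := by
    ext x
    simp only [mem_ofPred_eq, mem_iInter, mem_compl_iff, mem_image, not_exists, not_and,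
      Prod.forall]
  rw [this]
  exact isClosed_iInter fun i => (hO i).isClosed_compl

theorem continuousOn_toSurgery [Finite ι] (hO : L.HasOpenTubes) :
    ContinuousOn (L.toSurgery s) L.Complement := by
  rw [continuousOn_iff_continuous_domRestrict]
  let C : Option ι → Set L.Complement := fun o => o.elim
    {x | ∀ (i : ι) (u : Circle) (w : UnitDisc), ‖(w : ℂ)‖ < 1 → L.tube i (u, w) ≠ x.1}
    fun i => {x | x.1 ∈ range (L.tube i)}
  refine (locallyFinite_of_finite C).continuous ?_ ?_ ?_
  · refine eq_univ_of_forall fun x => mem_iUnion.2 ?_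
    by_cases h : ∃ p : ι × (Circle × UnitDisc), L.tube p.1 p.2 = x.1
    · obtain ⟨⟨i, p⟩, e⟩ := h
      exact ⟨some i, p, e⟩
    · exact ⟨none, fun i u w _ e => h ⟨(i, (u, w)), e⟩⟩
  · rintro (_ | i)
    · exact (L.isClosed_exterior hO).preimage continuous_subtype_val
    · exact (L.isEmbedding_tube i).isClosed_range.preimage continuous_subtype_val
  · rintro (_ | i)
    · have h1 : ContinuousOn (L.toSurgery s) (Subtype.val '' (univ : Set L.Exterior)) := by
        refine IsEmbedding.subtypeVal.continuousOn_image (continuousOn_univ.2 ?_)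
        exact ((L.isQuotientMap_proj s).continuous.comp continuous_inl).congr fun x =>
          (L.toSurgery_exterior s x).symm
      exact h1.comp continuous_subtype_val.continuousOn fun x hx => ⟨⟨x.1, hx⟩, trivial, rfl⟩
    · have h1 : ContinuousOn (L.toSurgery s) (L.tube i '' {p | (p.2 : ℂ) ≠ 0}) := by
        refine (L.isEmbedding_tube i).isEmbedding.continuousOn_image ?_
        rw [continuousOn_iff_continuous_domRestrict]
        have h2 : Continuous fun p : {p : Circle × UnitDisc | (p.2 : ℂ) ≠ 0} =>
            L.bdry i p.1.1 (UnitDisc.radial p.1.2) (UnitDisc.norm_radial p.2) := by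
          refine Continuous.subtype_mk ((L.continuous_tube i).comp (Continuous.prodMk
            (continuous_fst.comp continuous_subtype_val) ?_)) _
          exact UnitDisc.continuousOn_radial.comp_continuous
            (continuous_snd.comp continuous_subtype_val) fun p => p.2
        exact ((L.isQuotientMap_proj s).continuous.comp (continuous_inl.comp h2)).congr fun p =>
          (L.toSurgery_tube s i _ _ p.2).symm
      refine h1.comp continuous_subtype_val.continuousOn ?_
      rintro ⟨x, hx⟩ ⟨⟨u, z⟩, e⟩
      refine ⟨(u, z), fun h0 => hx i u ?_, e⟩
      have : z = UnitDisc.zero := Subtype.ext h0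
      rw [← this]
      exact e

variable {G : Type*} [Group G] {H : Holonomy (L.Surgery s) G}

/-- Parallel transport along the curve of a boundary torus which bounds a disc in the new solid
torus
is trivial. -/
theorem section_periodic (i : ι) {σ : ℝ × ℝ → G}
    (h : H.IsSection (fun c : ℝ × ℝ => L.toSurgery s
      (L.tube i (Circle.exp c.1, UnitDisc.ofCircle (Circle.exp c.2)))) univ σ) :
    σ (2 * Real.pi * (s i).den, 2 * Real.pi * (s i).num) = σ (0, 0) := by
  obtain ⟨δ, hδ, -⟩ := exists_section (H := H) (f := fun z => L.proj s (Sum.inr ⟨i, z, 1⟩))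
    (isSimplyConnected_univ UnitDisc)
    ((L.continuous_inner s i).comp
      (by fun_prop : Continuous fun z : UnitDisc => (z, (1 : Circle)))).continuousOn
    UnitDisc.zero (mem_univ _) 1
  have h1 := hδ.comp (X' := ℝ) (g := fun θ => UnitDisc.ofCircle (Circle.exp θ)) (S' := univ)
    (UnitDisc.continuous_ofCircle.comp Circle.exp.continuous).continuousOn (fun _ _ => mem_univ _)
  have h2 := h.comp (X' := ℝ) (g := fun θ => (θ * (s i).den, θ * (s i).num)) (S' := univ)
    (by fun_prop) (fun _ _ => mem_univ _)
  have e : EqOn ((fun c : ℝ × ℝ => L.toSurgery s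
      (L.tube i (Circle.exp c.1, UnitDisc.ofCircle (Circle.exp c.2)))) ∘
      fun θ : ℝ => (θ * ((s i).den : ℝ), θ * ((s i).num : ℝ)))
      ((fun z => L.proj s (Sum.inr ⟨i, z, 1⟩)) ∘
        fun θ => UnitDisc.ofCircle (Circle.exp θ)) univ := by
    intro θ _
    dsimp only [Function.comp]
    rw [L.proj_glue s i (Circle.exp θ) 1, ← toSurgery_exterior]
    simp only [gluingMap, bdry, one_zpow, mul_one, ← Circle.exp_intCast_mul, Int.cast_natCast]
    rw [mul_comm θ, mul_comm θ]
  have hc : ContinuousOn ((fun z => L.proj s (Sum.inr ⟨i, z, 1⟩)) ∘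
      fun θ : ℝ => UnitDisc.ofCircle (Circle.exp θ)) univ :=
    ((L.continuous_inner s i).comp (Continuous.prodMk
      (UnitDisc.continuous_ofCircle.comp Circle.exp.continuous) continuous_const)).continuousOn
  have key := h1.mul_eq (h2.congr_map e) hc (x := 2 * Real.pi) (y := 0)
    (convex_univ.isPathConnected univ_nonempty) (mem_univ _) (mem_univ _)
  simp only [Function.comp, zero_mul, Circle.exp_two_pi, Circle.exp_zero] at key
  exact mul_left_cancel key

/-- The distance from the core of the new solid tori. -/
noncomputable def coreDist : L.Surgery s → ℝ :=
  Quot.lift (Sum.elim (fun _ => 1) fun p => ‖(p.2.1 : ℂ)‖) (by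
    rintro _ _ ⟨i, z, w, x, hx⟩
    exact Circle.norm_coe z)

theorem continuous_coreDist : Continuous (L.coreDist s) := by
  refine (L.isQuotientMap_proj s).continuous_iff.2 ?_
  have : Continuous fun p : Σ _ : ι, UnitDisc × Circle => ‖(p.2.1 : ℂ)‖ :=
    continuous_sigma fun i => by fun_prop
  exact (continuous_const (y := (1 : ℝ))).sumElim this

/-- The deformation of the surgery which stretches the inner halves of the new solid tori. -/
noncomputable def stretchMap (p : L.Surgery s × unitInterval) : L.Surgery s :=
  Quot.lift (Sum.elim (fun x => L.proj s (Sum.inl x)) fun q => L.proj s (Sum.inr ⟨q.1,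
    UnitDisc.blend q.2.1 (UnitDisc.stretch q.2.1) p.2, q.2.2⟩)) (by
    rintro _ _ ⟨i, z, w, x, hx⟩
    dsimp only [Sum.elim_inr, Sum.elim_inl]
    rw [UnitDisc.stretch_eq_self (Circle.norm_coe z), UnitDisc.blend_self]
    exact Quot.sound (Glue.glue i z w x hx)) p.1

theorem continuous_stretchMap : Continuous (L.stretchMap s) := by
  refine (L.isQuotientMap_proj s).continuous_lift_prod_left ?_
  refine continuous_sum_prod ?_ (continuous_sigma_prod fun i => ?_)
  · exact ((L.isQuotientMap_proj s).continuous.comp continuous_inl).comp continuous_fst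
  · refine (L.continuous_inner s i).comp (Continuous.prodMk (UnitDisc.continuous_blend
      (by fun_prop) (UnitDisc.continuous_stretch.comp (by fun_prop)) (by fun_prop)) (by fun_prop))

open Classical in
/-- The points of the surgery in the interiors of the new solid tori. -/
noncomputable def innerPoint : L.Surgery s → Option (Σ _ : ι, UnitDisc × Circle) :=
  Quot.lift (Sum.elim (fun _ => none) fun r => if ‖(r.2.1 : ℂ)‖ < 1 then some r else none) (by
    rintro _ _ ⟨i, z, w, x, hx⟩
    simp [Circle.norm_coe])

open Classical in
/-- The points of the surgery in the exterior of the link. -/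
noncomputable def exteriorPoint : L.Surgery s → Option L.Exterior :=
  Quot.lift (Sum.elim some fun r => if h : ∃ z, UnitDisc.ofCircle z = r.2.1 then
      some (L.bdry r.1 (gluingMap (s r.1) h.choose r.2.2).1 (UnitDisc.ofCircle
        (gluingMap (s r.1) h.choose r.2.2).2) (Circle.norm_coe _)) else none) (by
    rintro _ _ ⟨i, z, w, x, hx⟩
    have h : ∃ z', UnitDisc.ofCircle z' = UnitDisc.ofCircle z := ⟨z, rfl⟩
    have e : h.choose = z := Circle.ext (congrArg (fun d : UnitDisc => (d : ℂ)) h.choose_spec)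
    simp only [Sum.elim_inr, Sum.elim_inl, dif_pos h]
    refine congrArg some (Subtype.ext ?_)
    rw [hx]
    simp only [bdry]
    rw [e])

theorem isClosedEmbedding_exterior (hO : L.HasOpenTubes) [Finite ι] :
    IsClosedEmbedding fun x : L.Exterior => L.proj s (Sum.inl x) := by
  have : CompactSpace L.Exterior := isCompact_iff_compactSpace.1 (L.isClosed_exterior hO).isCompact
  refine IsClosedEmbedding.of_continuous_injective_isClosedMap
    ((L.isQuotientMap_proj s).continuous.comp continuous_inl) ?_ ?_
  · intro x y h
    exact Option.some_injective _ (congrArg (L.exteriorPoint s) h)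
  · intro C hC
    rw [← (L.isQuotientMap_proj s).isClosed_preimage, isClosed_sum_iff, isClosed_sigma_iff]
    constructor
    · convert hC using 1
      ext x
      constructor
      · rintro ⟨y, hy, e⟩
        rwa [← Option.some_injective _ (congrArg (L.exteriorPoint s) e)]
      · exact fun hx => ⟨x, hx, rfl⟩
    · intro i
      have hg : Continuous fun p : Circle × Circle => L.bdry i (gluingMap (s i) p.1 p.2).1
          (UnitDisc.ofCircle (gluingMap (s i) p.1 p.2).2) (Circle.norm_coe _) :=
        Continuous.subtype_mk ((L.continuous_tube i).comp ((continuous_fst.comp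
          (continuous_gluingMap (s i))).prodMk (UnitDisc.continuous_ofCircle.comp
            (continuous_snd.comp (continuous_gluingMap (s i)))))) _
      have hj : Continuous fun p : Circle × Circle => (UnitDisc.ofCircle p.1, p.2) :=
        (UnitDisc.continuous_ofCircle.comp continuous_fst).prodMk continuous_snd
      convert ((hC.preimage hg).isCompact.image hj).isClosed using 1
      ext ⟨z, w⟩
      constructor
      · rintro ⟨y, hy, e⟩
        have hz : ‖(z : ℂ)‖ = 1 := by
          refine le_antisymm z.norm_le_one (not_lt.1 fun hlt => ?_)
          have := congrArg (L.innerPoint s) e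
          simp [innerPoint, proj, hlt] at this
        obtain ⟨u, rfl⟩ := UnitDisc.exists_ofCircle hz
        refine ⟨(u, w), ?_, rfl⟩
        have e' := e.trans (L.proj_glue s i u w)
        rw [mem_preimage, ← Option.some_injective _ (congrArg (L.exteriorPoint s) e')]
        exact hy
      · rintro ⟨⟨u, w⟩, hy, e⟩
        obtain ⟨rfl, rfl⟩ := Prod.mk.inj e
        exact ⟨_, hy, (L.proj_glue s i u w).symm⟩

theorem isOpenEmbedding_inner : IsOpenEmbedding
    fun r : {r : Σ _ : ι, UnitDisc × Circle // ‖(r.2.1 : ℂ)‖ < 1} => L.proj s (Sum.inr r.1) := by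
  have hi : ∀ r : {r : Σ _ : ι, UnitDisc × Circle // ‖(r.2.1 : ℂ)‖ < 1},
      L.innerPoint s (L.proj s (Sum.inr r.1)) = some r.1 := fun r => if_pos r.2
  have hn : Continuous fun p : Σ _ : ι, UnitDisc × Circle => ‖(p.2.1 : ℂ)‖ :=
    continuous_sigma fun i => by fun_prop
  refine IsOpenEmbedding.of_continuous_injective_isOpenMap ((L.isQuotientMap_proj s).continuous.comp
    (continuous_inr.comp continuous_subtype_val)) ?_ ?_
  · intro r r' h
    have := congrArg (L.innerPoint s) h
    simp only [hi] at this
    exact Subtype.ext (Option.some_injective _ this)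
  · intro V hV
    rw [← (L.isQuotientMap_proj s).isOpen_preimage]
    have ho : IsOpen {r : Σ _ : ι, UnitDisc × Circle | ‖(r.2.1 : ℂ)‖ < 1} :=
      isOpen_lt hn continuous_const
    convert isOpenMap_inr _ (ho.isOpenMap_subtype_val _ hV) using 1
    ext p
    constructor
    · rintro ⟨r, hr, e⟩
      have e' := congrArg (L.innerPoint s) e
      dsimp only at e'
      rw [hi] at e'
      rcases p with x | r'
      · exact absurd e' (by simp [innerPoint, proj])
      · have : r.1 = r' := by
          simp only [innerPoint, proj, Sum.elim_inr] at e'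
          split_ifs at e'
          exact Option.some_injective _ e'
        exact ⟨r', ⟨r, hr, this⟩, rfl⟩
    · rintro ⟨_, ⟨r, hr, rfl⟩, rfl⟩
      exact ⟨r, hr, rfl⟩

theorem section_of_section_complement [Finite ι] (hO : L.HasOpenTubes) {τ : ThreeSphere → G}
    (h : H.IsSection (L.toSurgery s) L.Complement τ) :
    ∃ σ : L.Surgery s → G, H.IsSection id univ σ := by
  have hout : ∀ x : L.Exterior, x.1 ∈ L.Complement := fun x i u =>
    x.2 i u UnitDisc.zero (by simp [UnitDisc.zero])
  have hb : ∀ i, Continuous fun p : Circle × Circle => L.bdry i (gluingMap (s i) p.1 p.2).1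
      (UnitDisc.ofCircle (gluingMap (s i) p.1 p.2).2) (Circle.norm_coe _) := fun i =>
    Continuous.subtype_mk ((L.continuous_tube i).comp ((continuous_fst.comp
      (continuous_gluingMap (s i))).prodMk (UnitDisc.continuous_ofCircle.comp
        (continuous_snd.comp (continuous_gluingMap (s i)))))) _
  have hdc : ∀ (i : ι) (w : Circle), Continuous fun z : UnitDisc => L.proj s (Sum.inr ⟨i, z, w⟩) :=
    fun i w => (L.continuous_inner s i).comp (by fun_prop)
  have hext : H.IsSection (fun x : L.Exterior => L.proj s (Sum.inl x)) univ fun x => τ x.1 :=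
    (h.comp (g := Subtype.val) (S' := univ) continuous_subtype_val.continuousOn
      fun x _ => hout x).congr_map fun x _ => L.toSurgery_exterior s x
  choose δ hδ hδ1 using fun (i : ι) (w : Circle) => exists_section (H := H)
    (isSimplyConnected_univ UnitDisc) (hdc i w).continuousOn (UnitDisc.ofCircle 1) (mem_univ _)
    (τ (L.bdry i (gluingMap (s i) 1 w).1 (UnitDisc.ofCircle (gluingMap (s i) 1 w).2)
      (Circle.norm_coe _)).1)
  have hδb : ∀ i w z, δ i w (UnitDisc.ofCircle z) = τ (L.bdry i (gluingMap (s i) z w).1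
      (UnitDisc.ofCircle (gluingMap (s i) z w).2) (Circle.norm_coe _)).1 := by
    intro i w z
    have h1 := (hδ i w).comp (g := UnitDisc.ofCircle) (S' := univ)
      UnitDisc.continuous_ofCircle.continuousOn fun _ _ => mem_univ _
    have h2 := (hext.comp (X' := Circle) (S' := univ) (g := fun z =>
      L.bdry i (gluingMap (s i) z w).1 (UnitDisc.ofCircle (gluingMap (s i) z w).2)
        (Circle.norm_coe _)) ((hb i).comp (by fun_prop : Continuous fun z : Circle =>
          (z, w))).continuousOn fun _ _ => mem_univ _).congr_map
            fun z _ => (L.proj_glue s i z w).symm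
    exact h1.eqOn h2 ((hdc i w).comp UnitDisc.continuous_ofCircle).continuousOn
      Circle.isPathConnected_univ (mem_univ 1) (hδ1 i w) (mem_univ z)
  let σ : L.Surgery s → G := Quot.lift (Sum.elim (fun x => τ x.1) fun r => δ r.1 r.2.2 r.2.1) (by
    rintro _ _ ⟨i, z, w, x, hx⟩
    dsimp only [Sum.elim_inl, Sum.elim_inr]
    rw [hδb, hx]
    rfl)
  refine ⟨σ, IsSection.of_local continuousOn_id fun x _ => ?_⟩
  by_cases hx : L.coreDist s x < 1
  · refine ⟨{y | L.coreDist s y < 1}, isOpen_lt (L.continuous_coreDist s) continuous_const, hx, ?_⟩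
    refine IsSection.mono (IsSection.of_embedding (L.isOpenEmbedding_inner s).isEmbedding
      (T := univ) ?_) (T := _) ?_
    · have hc1 : Continuous fun p : (Σ _ : ι, UnitDisc × Circle) × unitInterval =>
          L.proj s (Sum.inr ⟨p.1.1, UnitDisc.blend p.1.2.1 (UnitDisc.ofCircle 1) p.2, p.1.2.2⟩) :=
        continuous_sigma_prod fun i => (L.continuous_inner s i).comp
          ((UnitDisc.continuous_blend (by fun_prop) continuous_const (by fun_prop)).prodMk
            (by fun_prop))
      have hc2 : Continuous fun r : Σ _ : ι, UnitDisc × Circle =>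
          L.bdry r.1 (gluingMap (s r.1) 1 r.2.2).1
            (UnitDisc.ofCircle (gluingMap (s r.1) 1 r.2.2).2) (Circle.norm_coe _) :=
        continuous_sigma fun i => (hb i).comp (by fun_prop : Continuous fun p : UnitDisc × Circle =>
          ((1 : Circle), p.2))
      refine IsSection.of_homotopy (R := fun p => L.proj s (Sum.inr ⟨p.1.1.1,
          UnitDisc.blend p.1.1.2.1 (UnitDisc.ofCircle 1) p.2, p.1.1.2.2⟩))
        (f' := fun r => L.proj s (Sum.inr ⟨r.1.1, UnitDisc.ofCircle 1, r.1.2.2⟩))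
        (τ := fun r => τ (L.bdry r.1.1 (gluingMap (s r.1.1) 1 r.1.2.2).1
            (UnitDisc.ofCircle (gluingMap (s r.1.1) 1 r.1.2.2).2) (Circle.norm_coe _)).1)
        (hc1.comp ((continuous_subtype_val.comp continuous_fst).prodMk
          continuous_snd)).continuousOn (fun r _ => ?_) (fun r _ => ?_) ?_ ?_
      · simp only [UnitDisc.blend_zero]
        rfl
      · simp only [UnitDisc.blend_one]
      · exact (hext.comp (S' := univ) (hc2.comp continuous_subtype_val).continuousOn
          fun _ _ => mem_univ _).congr_map fun r _ => (L.proj_glue s r.1.1 1 r.1.2.2).symm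
      · intro r _ hc
        have := hδ r.1.1 r.1.2.2 (fun t => UnitDisc.blend r.1.2.1 (UnitDisc.ofCircle 1) t)
          (UnitDisc.continuous_blend continuous_const continuous_const continuous_id)
          (fun _ => mem_univ _) hc
        rw [UnitDisc.blend_zero, UnitDisc.blend_one, hδ1] at this
        exact this
    · rintro y ⟨hy, -⟩
      obtain ⟨p, rfl⟩ := (L.isQuotientMap_proj s).surjective y
      rcases p with x | r
      · exact (lt_irrefl (1 : ℝ) hy).elim
      · exact ⟨⟨r, hy⟩, mem_univ _, rfl⟩
  · refine ⟨{y | 1 / 2 < L.coreDist s y}, isOpen_lt continuous_const (L.continuous_coreDist s),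
      show 1 / 2 < L.coreDist s x by linarith, ?_⟩
    have h1 : H.IsSection id ((fun x : L.Exterior => L.proj s (Sum.inl x)) '' univ) σ :=
      IsSection.of_embedding (L.isClosedEmbedding_exterior s hO).isEmbedding hext
    have h2 := h1.comp (g := fun y => L.stretchMap s (y, 1)) (S' := {y | 1 / 2 < L.coreDist s y})
      ((L.continuous_stretchMap s).comp (by fun_prop)).continuousOn (by
        intro y hy
        obtain ⟨p, rfl⟩ := (L.isQuotientMap_proj s).surjective y
        rcases p with x | ⟨i, z, w⟩
        · exact ⟨x, mem_univ _, rfl⟩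
        · obtain ⟨u, hu⟩ := UnitDisc.exists_ofCircle (UnitDisc.norm_stretch (le_of_lt hy))
          refine ⟨_, mem_univ _, (L.proj_glue s i u w).symm.trans ?_⟩
          change _ = L.proj s (Sum.inr ⟨i, UnitDisc.blend z (UnitDisc.stretch z) 1, w⟩)
          rw [UnitDisc.blend_one, hu])
    refine IsSection.mono (IsSection.of_homotopy (L.continuous_stretchMap s).continuousOn ?_
      (fun _ _ => rfl) h2 ?_) inter_subset_left
    · intro y _
      obtain ⟨p, rfl⟩ := (L.isQuotientMap_proj s).surjective y
      rcases p with x | ⟨i, z, w⟩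
      · rfl
      · change L.proj s (Sum.inr ⟨i, UnitDisc.blend z (UnitDisc.stretch z) 0, w⟩) = _
        rw [UnitDisc.blend_zero]
        rfl
    · intro y _ hc
      obtain ⟨p, rfl⟩ := (L.isQuotientMap_proj s).surjective y
      rcases p with x | ⟨i, z, w⟩
      · have : H.hol (pathOf hc) = 1 := H.hol_refl (L.proj s (Sum.inl x))
        rw [this, one_mul]
        rfl
      · have := hδ i w (fun t => UnitDisc.blend z (UnitDisc.stretch z) t)
          (UnitDisc.continuous_blend continuous_const continuous_const continuous_id)
          (fun _ => mem_univ _) hc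
        rw [UnitDisc.blend_zero] at this
        exact this

end FramedLink

/-- The points of three-space from which the upward ray avoids `K`. -/
def visibleFromAbove (K : Set (ℂ × ℝ)) : Set (ℂ × ℝ) := {p | ∀ h, p.2 ≤ h → (p.1, h) ∉ K}

/-- The points of three-space from which the downward ray avoids `K`. -/
def visibleFromBelow (K : Set (ℂ × ℝ)) : Set (ℂ × ℝ) := {p | ∀ h, h ≤ p.2 → (p.1, h) ∉ K}

open Pointwise in
theorem IsCompact.isOpen_visibleFromAbove {K : Set (ℂ × ℝ)} (hK : IsCompact K) :
    IsOpen (visibleFromAbove K) := by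
  have h : IsClosed (({0} ×ˢ Iic 0 : Set (ℂ × ℝ)) + K) :=
    (isClosed_singleton.prod isClosed_Iic).add_right_of_isCompact hK
  convert h.isOpen_compl using 1
  ext ⟨z, h⟩
  simp only [visibleFromAbove, mem_ofPred_eq, mem_compl_iff, mem_add, not_exists, not_and]
  constructor
  · rintro hp ⟨x, a⟩ ⟨hx, ha⟩ ⟨w, b⟩ hw e
    simp only [mem_singleton_iff, mem_Iic] at hx ha
    obtain ⟨e1, e2⟩ := Prod.mk.inj e
    subst hx
    rw [zero_add] at e1
    subst e1
    exact hp b (by linarith) hw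
  · intro hp h' hh hK'
    exact hp (0, h - h') ⟨rfl, by simpa using hh⟩ (z, h') hK' (by simp)

/-- The reflection of three-space in the horizontal plane. -/
def verticalFlip : (ℂ × ℝ) ≃ₜ (ℂ × ℝ) where
  toFun p := (p.1, -p.2)
  invFun p := (p.1, -p.2)
  left_inv p := by simp
  right_inv p := by simp

theorem visibleFromBelow_eq (K : Set (ℂ × ℝ)) :
    visibleFromBelow K = verticalFlip '' visibleFromAbove (verticalFlip '' K) := by
  ext ⟨z, h⟩
  constructor
  · intro hp
    refine ⟨(z, -h), ?_, Prod.ext rfl (neg_neg h)⟩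
    rintro h' hh ⟨⟨w, b⟩, hw, e⟩
    obtain ⟨rfl, rfl⟩ := Prod.mk.inj e
    exact hp b (by dsimp only at hh ⊢; linarith) hw
  · rintro ⟨⟨w, b⟩, hp, e⟩ h' hh hw
    obtain ⟨rfl, rfl⟩ := Prod.mk.inj e
    exact hp (-h') (by dsimp only at hh ⊢; linarith) ⟨(w, h'), hw, rfl⟩

theorem IsCompact.isOpen_visibleFromBelow {K : Set (ℂ × ℝ)} (hK : IsCompact K) :
    IsOpen (visibleFromBelow K) := by
  rw [visibleFromBelow_eq]
  exact (Homeomorph.isOpenMap _) _ (hK.image (Homeomorph.continuous _)).isOpen_visibleFromAbove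

theorem isSimplyConnected_of_retraction {X : Type*} [TopologicalSpace X] {S T : Set X}
    (hT : IsSimplyConnected T) (R : X × unitInterval → X) (hR : ContinuousOn R (S ×ˢ univ))
    (hS : ∀ x ∈ S, ∀ s, R (x, s) ∈ S) (h0 : ∀ x ∈ S, R (x, 0) = x) (h1 : ∀ x ∈ S, R (x, 1) ∈ T)
    (hTS : T ⊆ S) (hRT : ∀ x ∈ T, ∀ s, R (x, s) ∈ T) : IsSimplyConnected S := by
  have hc : Continuous fun p : S × unitInterval => R (p.1, p.2) :=
    hR.comp_continuous (by fun_prop) fun p => ⟨p.1.2, mem_univ _⟩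
  have hcT : Continuous fun p : T × unitInterval => R (p.1, p.2) :=
    hR.comp_continuous (by fun_prop) fun p => ⟨hTS p.1.2, mem_univ _⟩
  let r : C(S, T) := ⟨fun x => ⟨R (x, 1), h1 x x.2⟩,
    (hc.comp (by fun_prop : Continuous fun x : S => (x, (1 : unitInterval)))).subtype_mk _⟩
  let i : C(T, S) := ⟨fun x => ⟨x, hTS x.2⟩, by fun_prop⟩
  have e : ContinuousMap.HomotopyEquiv S T := by
    refine ⟨r, i, ⟨ContinuousMap.Homotopy.symm ⟨⟨fun p => ⟨R (p.2, p.1), hS _ p.2.2 _⟩,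
      (hc.comp continuous_swap).subtype_mk _⟩, fun x => ?_, fun x => ?_⟩⟩,
      ⟨ContinuousMap.Homotopy.symm ⟨⟨fun p => ⟨R (p.2, p.1), hRT _ p.2.2 _⟩,
      (hcT.comp continuous_swap).subtype_mk _⟩, fun x => ?_, fun x => ?_⟩⟩⟩
    · exact Subtype.ext (h0 x x.2)
    · rfl
    · exact Subtype.ext (h0 x (hTS x.2))
    · rfl
  have := hT.simplyConnectedSpace
  exact e.simplyConnectedSpace

theorem IsCompact.isSimplyConnected_visibleFromAbove {K : Set (ℂ × ℝ)} (hK : IsCompact K) :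
    IsSimplyConnected (visibleFromAbove K) := by
  obtain ⟨b, hb⟩ := (hK.image continuous_snd).bddAbove
  have hb' : ∀ p : ℂ × ℝ, b < p.2 → p ∉ K := fun p hp hpK =>
    absurd (hb (mem_image_of_mem _ hpK)) (not_le.2 hp)
  have hT : IsSimplyConnected (univ ×ˢ Ici (b + 1) : Set (ℂ × ℝ)) :=
    (convex_univ.prod (convex_Ici (b + 1))).starConvex (x := ((0 : ℂ), b + 1))
      ⟨mem_univ _, mem_Ici.2 le_rfl⟩ |>.isSimplyConnected ⟨mem_univ _, mem_Ici.2 le_rfl⟩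
  have hmax : ∀ (h : ℝ) (s : unitInterval), h ≤ h + s * (max h (b + 1) - h) := fun h s =>
    le_add_of_nonneg_right (mul_nonneg s.2.1 (sub_nonneg.2 (le_max_left _ _)))
  refine isSimplyConnected_of_retraction hT
    (fun q => (q.1.1, q.1.2 + (q.2 : ℝ) * (max q.1.2 (b + 1) - q.1.2)))
    (by fun_prop) ?_ ?_ ?_ ?_ ?_
  · rintro ⟨z, h⟩ hp s h' hh
    exact hp h' ((hmax h s).trans hh)
  · rintro ⟨z, h⟩ _
    simp
  · rintro ⟨z, h⟩ _
    simp
  · rintro ⟨z, h⟩ ⟨-, hh⟩ h' hh' 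
    exact hb' _ (by simp only [mem_Ici] at hh; dsimp only at hh' ⊢; linarith)
  · rintro ⟨z, h⟩ ⟨-, hh⟩ s
    exact ⟨mem_univ _, (show b + 1 ≤ h from hh).trans (hmax h s)⟩

theorem IsCompact.isSimplyConnected_visibleFromBelow {K : Set (ℂ × ℝ)} (hK : IsCompact K) :
    IsSimplyConnected (visibleFromBelow K) := by
  rw [visibleFromBelow_eq]
  exact (Homeomorph.isSimplyConnected_image _).2
    (hK.image (Homeomorph.continuous _)).isSimplyConnected_visibleFromAbove

namespace PlanarGraph

variable {V E : Type*} (G : PlanarGraph V E)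

/-- The link, as a subset of three-space. -/
def link : Set (ℂ × ℝ) :=
  (⋃ v, range fun u : Circle => ((G.center v + G.radius v * (u : ℂ), 0) : ℂ × ℝ)) ∪
    ⋃ e, range fun u : Circle => ((G.band e ((u : ℂ).re, 0), (u : ℂ).im) : ℂ × ℝ)

theorem exists_circle {t h : ℝ} (e : t ^ 2 + h ^ 2 = 1) :
    ∃ u : Circle, (u : ℂ).re = t ∧ (u : ℂ).im = h := by
  have hu : ‖(⟨t, h⟩ : ℂ)‖ = 1 := by
    rw [← sq_eq_sq₀ (norm_nonneg _) zero_le_one, ← Complex.normSq_eq_norm_sq,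
      Complex.normSq_apply]
    dsimp only
    nlinarith
  exact ⟨⟨⟨t, h⟩, by simpa [Submonoid.unitSphere] using hu⟩, rfl, rfl⟩

theorem exists_circle_mul {z c : ℂ} {r : ℝ} (hr : 0 < r) (h : dist z c = r) :
    ∃ u : Circle, z = c + r * (u : ℂ) := by
  have hr' : (r : ℂ) ≠ 0 := by exact_mod_cast hr.ne'
  have hu : ‖(z - c) / r‖ = 1 := by
    rw [norm_div, ← dist_eq_norm, h, Complex.norm_real, Real.norm_eq_abs, abs_of_pos hr,
      div_self hr.ne']
  refine ⟨⟨(z - c) / r, by simpa [Submonoid.unitSphere] using hu⟩, ?_⟩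
  simp [mul_div_cancel₀ _ hr']

theorem mem_link_iff {z : ℂ} {h : ℝ} : (z, h) ∈ G.link ↔
    (h = 0 ∧ ∃ v, dist z (G.center v) = G.radius v) ∨
      ∃ e t, t ^ 2 + h ^ 2 = 1 ∧ z = G.band e (t, 0) := by
  simp only [link, mem_union, mem_iUnion, mem_range, Prod.mk.injEq]
  constructor
  · rintro (⟨v, u, rfl, rfl⟩ | ⟨e, u, rfl, rfl⟩)
    · refine Or.inl ⟨rfl, v, ?_⟩
      rw [dist_self_add_left, norm_scaled _ (G.radius_pos v).le]
    · exact Or.inr ⟨e, _, circle_sq u, rfl⟩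
  · rintro (⟨rfl, v, hv⟩ | ⟨e, t, ht, rfl⟩)
    · obtain ⟨u, hu⟩ := exists_circle_mul (G.radius_pos v) hv
      exact Or.inl ⟨v, u, hu.symm, rfl⟩
    · obtain ⟨u, rfl, rfl⟩ := exists_circle ht
      exact Or.inr ⟨e, u, rfl, rfl⟩

theorem isCompact_link [Finite V] [Finite E] : IsCompact G.link := by
  refine IsCompact.union (isCompact_iUnion fun v => isCompact_range (by fun_prop))
    (isCompact_iUnion fun e => isCompact_range (Continuous.prodMk
      ((G.continuousOn_band e).comp_continuous (by fun_prop) fun u => ?_) (by fun_prop)))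
  obtain ⟨h1, h2⟩ := circle_bounds u
  refine ⟨⟨?_, ?_⟩, ⟨?_, ?_⟩⟩ <;> dsimp only <;> linarith

/-- The closed domain of the bands. -/
abbrev closedRect : Set (ℝ × ℝ) := Icc (-5 / 4 : ℝ) (5 / 4) ×ˢ Icc (-1 / 4 : ℝ) (1 / 4)

/-- The open domain of the bands. -/
abbrev openRect : Set (ℝ × ℝ) := Ioo (-5 / 4 : ℝ) (5 / 4) ×ˢ Ioo (-1 / 4 : ℝ) (1 / 4)

theorem openRect_subset : openRect ⊆ closedRect :=
  prod_mono Ioo_subset_Icc_self Ioo_subset_Icc_self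

theorem isOpen_image_band (e : E) {U : Set (ℝ × ℝ)} (hU : IsOpen U) (hUr : U ⊆ openRect) :
    IsOpen (G.band e '' U) := by
  let φ := Complex.equivRealProdCLM.toHomeomorph
  have h := PlaneDomain.isOpen_image (f := G.band e ∘ φ) (U := φ ⁻¹' U)
    (hU.preimage φ.continuous)
    (((G.continuousOn_band e).mono (hUr.trans openRect_subset)).comp φ.continuous.continuousOn
      fun _ h => h)
    fun z hz w hw hzw => φ.injective (G.band_injective e e _ (openRect_subset (hUr hz)) _
      (openRect_subset (hUr hw)) hzw).2
  rwa [image_comp, φ.image_preimage] at h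

theorem dist_band_src (e : E) {t s : ℝ} (ht : t ∈ Icc (-5 / 4 : ℝ) (-1 / 4))
    (hs : s ∈ Icc (-1 / 4 : ℝ) (1 / 4)) :
    dist (G.band e (t, s)) (G.center (G.src e)) = G.radius (G.src e) * (3 / 2 + t) := by
  rw [G.band_src e t ht s hs, dist_self_add_left, norm_scaled]
  exact mul_nonneg (G.radius_pos _).le (by linarith [ht.1])

theorem dist_band_tgt (e : E) {t s : ℝ} (ht : t ∈ Icc (1 / 4 : ℝ) (5 / 4))
    (hs : s ∈ Icc (-1 / 4 : ℝ) (1 / 4)) :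
    dist (G.band e (t, s)) (G.center (G.tgt e)) = G.radius (G.tgt e) * (3 / 2 - t) := by
  rw [G.band_tgt e t ht s hs, dist_self_add_left, norm_scaled]
  exact mul_nonneg (G.radius_pos _).le (by linarith [ht.2])

theorem eq_of_dist_le {v w : V} {z : ℂ} (hv : dist z (G.center v) ≤ 5 / 4 * G.radius v)
    (hw : dist z (G.center w) ≤ 5 / 4 * G.radius w) : v = w := by
  by_contra hne
  have h1 := G.disc_disjoint v w hne
  have h2 := dist_triangle_left (G.center v) (G.center w) z
  linarith

theorem of_dist_band_le {e : E} {v : V} {t s : ℝ} (h : (t, s) ∈ closedRect)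
    (hd : dist (G.band e (t, s)) (G.center v) ≤ 5 / 4 * G.radius v) :
    (v = G.src e ∧ t ≤ -1 / 4) ∨ (v = G.tgt e ∧ 1 / 4 ≤ t) := by
  obtain ⟨⟨h1, h2⟩, hs⟩ := h
  dsimp only at h1 h2 hs
  rcases le_or_gt t (-1 / 4) with ht | ht
  · refine Or.inl ⟨G.eq_of_dist_le hd ?_, ht⟩
    rw [G.dist_band_src e ⟨h1, ht⟩ hs, mul_comm]
    exact mul_le_mul_of_nonneg_right (by linarith) (G.radius_pos _).le
  rcases le_or_gt (1 / 4) t with ht' | ht'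
  · refine Or.inr ⟨G.eq_of_dist_le hd ?_, ht'⟩
    rw [G.dist_band_tgt e ⟨ht', h2⟩ hs, mul_comm]
    exact mul_le_mul_of_nonneg_right (by linarith) (G.radius_pos _).le
  · exact absurd hd (not_le.2 (G.band_middle e t ⟨ht, ht'⟩ s hs v))

theorem of_dist_band_eq {e : E} {v : V} {t s ρ : ℝ} (h : (t, s) ∈ closedRect) (hρ : ρ ≤ 5 / 4)
    (hd : dist (G.band e (t, s)) (G.center v) = G.radius v * ρ) :
    (v = G.src e ∧ t = ρ - 3 / 2) ∨ (v = G.tgt e ∧ t = 3 / 2 - ρ) := by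
  have hle : dist (G.band e (t, s)) (G.center v) ≤ 5 / 4 * G.radius v := by
    rw [hd, mul_comm]
    exact mul_le_mul_of_nonneg_right hρ (G.radius_pos _).le
  obtain ⟨rfl, ht⟩ | ⟨rfl, ht⟩ := G.of_dist_band_le h hle
  · rw [G.dist_band_src e ⟨h.1.1, ht⟩ h.2] at hd
    have := mul_left_cancel₀ (G.radius_pos _).ne' hd
    exact Or.inl ⟨rfl, by linarith⟩
  · rw [G.dist_band_tgt e ⟨ht, h.1.2⟩ h.2] at hd
    have := mul_left_cancel₀ (G.radius_pos _).ne' hd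
    exact Or.inr ⟨rfl, by linarith⟩

theorem of_band_mem_link {e : E} {t s h : ℝ} (hr : (t, s) ∈ closedRect)
    (hl : (G.band e (t, s), h) ∈ G.link) :
    (h = 0 ∧ (t = -1 / 2 ∨ t = 1 / 2)) ∨ (s = 0 ∧ t ^ 2 + h ^ 2 = 1) := by
  obtain ⟨h0, v, hv⟩ | ⟨e', t', ht, hb⟩ := G.mem_link_iff.1 hl
  · refine Or.inl ⟨h0, ?_⟩
    rw [← mul_one (G.radius v)] at hv
    obtain ⟨-, ht⟩ | ⟨-, ht⟩ := G.of_dist_band_eq hr (by norm_num) hv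
    · left; linarith
    · right; linarith
  · have h1 : t' ^ 2 ≤ 1 := by nlinarith [sq_nonneg h]
    have h2 := abs_le.1 ((sq_le_one_iff_abs_le_one _).1 h1)
    obtain ⟨-, h3⟩ := G.band_injective e e' _ hr (t', 0)
      ⟨⟨by dsimp only; linarith, by dsimp only; linarith⟩, by norm_num, by norm_num⟩ hb
    obtain ⟨rfl, rfl⟩ := Prod.mk.inj h3
    exact Or.inr ⟨rfl, ht⟩

/-- The points of the plane such that the vertical line through them avoids the link. -/
def generic : Set ℂ := {z | ∀ h, (z, h) ∉ G.link}

theorem mem_generic_iff {z : ℂ} : z ∈ G.generic ↔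
    (∀ v, dist z (G.center v) ≠ G.radius v) ∧ ∀ e, ∀ t ∈ Icc (-1 : ℝ) 1, z ≠ G.band e (t, 0) := by
  constructor
  · intro hz
    refine ⟨fun v hv => hz 0 (G.mem_link_iff.2 (Or.inl ⟨rfl, v, hv⟩)), fun e t ht hb => ?_⟩
    refine hz (√(1 - t ^ 2)) (G.mem_link_iff.2 (Or.inr ⟨e, t, ?_, hb⟩))
    rw [Real.sq_sqrt (by nlinarith [ht.1, ht.2])]
    ring
  · rintro ⟨h1, h2⟩ h hl
    obtain ⟨-, v, hv⟩ | ⟨e, t, ht, hb⟩ := G.mem_link_iff.1 hl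
    · exact h1 v hv
    · exact h2 e t (abs_le.1 ((sq_le_one_iff_abs_le_one _).1 (by nlinarith [sq_nonneg h]))) hb

theorem isOpen_generic [Finite V] [Finite E] : IsOpen G.generic := by
  have h := (G.isCompact_link.image continuous_fst).isClosed.isOpen_compl
  convert h using 1
  ext z
  simp [generic]

theorem band_mem_generic {e : E} {t s : ℝ} (hr : (t, s) ∈ closedRect) (h1 : t ≠ -1 / 2)
    (h2 : t ≠ 1 / 2) (h3 : s ≠ 0 ∨ 1 < |t|) : G.band e (t, s) ∈ G.generic := by
  intro h hl
  obtain ⟨-, ht⟩ | ⟨hs, ht⟩ := G.of_band_mem_link hr hl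
  · exact ht.elim h1 h2
  · refine h3.elim (fun h => h hs) fun h4 => ?_
    rw [← one_lt_sq_iff_one_lt_abs] at h4
    nlinarith [sq_nonneg h, ht]

/-- A neighbourhood of the strip over an edge, in its band coordinates. -/
def bandMap (e : E) (q : (ℝ × ℝ) × ℝ) : ℂ × ℝ := (G.band e q.1, q.2)

theorem continuousOn_bandMap (e : E) : ContinuousOn (G.bandMap e) (closedRect ×ˢ univ) :=
  ((G.continuousOn_band e).comp continuousOn_fst fun _ h => h.1).prodMk continuousOn_snd

theorem bandMap_inj {e e' : E} {q q' : (ℝ × ℝ) × ℝ} (hq : q.1 ∈ closedRect)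
    (hq' : q'.1 ∈ closedRect) (h : G.bandMap e q = G.bandMap e' q') : e = e' ∧ q = q' := by
  obtain ⟨h1, h2⟩ := Prod.mk.inj h
  obtain ⟨rfl, h3⟩ := G.band_injective e e' _ hq _ hq' h1
  exact ⟨rfl, Prod.ext h3 h2⟩

theorem isOpen_image_bandMap (e : E) {U : Set ((ℝ × ℝ) × ℝ)} (hU : IsOpen U)
    (hUr : ∀ q ∈ U, q.1 ∈ openRect) : IsOpen (G.bandMap e '' U) := by
  rw [isOpen_iff_mem_nhds]
  rintro _ ⟨⟨p, h⟩, hp, rfl⟩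
  obtain ⟨A, B, hA, hB, hpA, hhB, hAB⟩ := isOpen_prod_iff.1 hU p h hp
  have hA' : IsOpen (G.band e '' A) := G.isOpen_image_band e hA
    fun a ha => hUr (a, h) (hAB ⟨ha, hhB⟩)
  refine Filter.mem_of_superset ((hA'.prod hB).mem_nhds ⟨mem_image_of_mem _ hpA, hhB⟩) ?_
  rintro ⟨_, b⟩ ⟨⟨a, ha, rfl⟩, hb⟩
  exact ⟨(a, b), hAB ⟨ha, hb⟩, rfl⟩

theorem hasOpenTubes : G.chainmailLink.HasOpenTubes := by
  rintro (v | e)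
  · have hr := G.radius_pos v
    have h : IsOpen {p : ℂ × ℝ | (dist p.1 (G.center v) / G.radius v - 1) ^ 2 * 64 +
        64 * p.2 ^ 2 < 1} := isOpen_lt (by fun_prop) continuous_const
    convert OnePoint.isOpenEmbedding_coe.isOpenMap _ h using 1
    ext x
    constructor
    · rintro ⟨⟨u, w⟩, hw, rfl⟩
      refine ⟨_, ?_, rfl⟩
      have := G.vertex_dist v (u, w)
      dsimp only at this
      simp only [mem_ofPred_eq] at hw ⊢
      rw [this, mul_div_cancel_left₀ _ hr.ne']
      have h2 : (w : ℂ).re ^ 2 + (w : ℂ).im ^ 2 < 1 := by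
        have := Complex.normSq_eq_norm_sq (w : ℂ)
        rw [Complex.normSq_apply] at this
        nlinarith [norm_nonneg (w : ℂ)]
      nlinarith
    · rintro ⟨⟨z, h⟩, hp, rfl⟩
      simp only [mem_ofPred_eq] at hp
      set ρ := dist z (G.center v) / G.radius v with hρ
      have hρ0 : 0 < ρ := by nlinarith [sq_nonneg h]
      have hw : ‖(⟨(ρ - 1) * 8, -h * 8⟩ : ℂ)‖ < 1 := by
        rw [← sq_lt_one_iff₀ (norm_nonneg _), ← Complex.normSq_eq_norm_sq, Complex.normSq_apply]
        dsimp only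
        nlinarith
      obtain ⟨u, hu⟩ := exists_circle_mul (z := z) (c := G.center v) (mul_pos hr hρ0)
        (by rw [hρ, mul_div_cancel₀ _ hr.ne'])
      refine ⟨(u, ⟨_, mem_closedBall_zero_iff.2 hw.le⟩), hw, ?_⟩
      change ((_ : ℂ × ℝ) : ThreeSphere) = _
      refine congrArg _ (Prod.ext ?_ ?_)
      · dsimp only
        rw [hu]
        push_cast
        ring
      · dsimp only
        ring
  · have h : IsOpen ({q : (ℝ × ℝ) × ℝ | (√(q.1.1 ^ 2 + q.2 ^ 2) - 1) ^ 2 * 64 +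
        64 * q.1.2 ^ 2 < 1}) := isOpen_lt (by fun_prop) continuous_const
    have hsub : ∀ q ∈ {q : (ℝ × ℝ) × ℝ | (√(q.1.1 ^ 2 + q.2 ^ 2) - 1) ^ 2 * 64 +
        64 * q.1.2 ^ 2 < 1}, q.1 ∈ openRect := by
      rintro ⟨⟨t, s⟩, h⟩ hq
      simp only [mem_ofPred_eq] at hq
      have h1 : √(t ^ 2 + h ^ 2) < 9 / 8 := by nlinarith [sq_nonneg s]
      have h2 : |t| ≤ √(t ^ 2 + h ^ 2) := Real.abs_le_sqrt (by nlinarith [sq_nonneg h])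
      have h3 := abs_lt.1 (h2.trans_lt h1)
      have h4 : s ^ 2 < (1 / 8) ^ 2 := by nlinarith [sq_nonneg (√(t ^ 2 + h ^ 2) - 1)]
      have h5 := abs_lt.1 (abs_lt_of_sq_lt_sq h4 (by norm_num))
      refine ⟨⟨?_, ?_⟩, ?_, ?_⟩ <;> dsimp only <;> linarith
    convert OnePoint.isOpenEmbedding_coe.isOpenMap _ (G.isOpen_image_bandMap e h hsub) using 1
    ext x
    constructor
    · rintro ⟨⟨u, w⟩, hw, rfl⟩
      refine ⟨_, ⟨((_, _), _), ?_, rfl⟩, rfl⟩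
      simp only [mem_ofPred_eq] at hw ⊢
      have hu := circle_sq u
      have hk : 0 ≤ 1 + (w : ℂ).re / 8 := by linarith [(disc_bounds w).1]
      have h2 : (w : ℂ).re ^ 2 + (w : ℂ).im ^ 2 < 1 := by
        have := Complex.normSq_eq_norm_sq (w : ℂ)
        rw [Complex.normSq_apply] at this
        nlinarith [norm_nonneg (w : ℂ)]
      rw [mul_pow, mul_pow, ← mul_add, hu, mul_one, Real.sqrt_sq hk]
      nlinarith
    · rintro ⟨_, ⟨⟨⟨t, s⟩, h⟩, hq, rfl⟩, rfl⟩
      simp only [mem_ofPred_eq] at hq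
      set ρ := √(t ^ 2 + h ^ 2) with hρ
      have hρ0 : 0 < ρ := by nlinarith [sq_nonneg s]
      have hρ2 : ρ ^ 2 = t ^ 2 + h ^ 2 := Real.sq_sqrt (by positivity)
      have hw : ‖(⟨(ρ - 1) * 8, s * 8⟩ : ℂ)‖ < 1 := by
        rw [← sq_lt_one_iff₀ (norm_nonneg _), ← Complex.normSq_eq_norm_sq, Complex.normSq_apply]
        dsimp only
        nlinarith
      obtain ⟨u, hu1, hu2⟩ := exists_circle (t := t / ρ) (h := h / ρ) (by
        rw [div_pow, div_pow, ← add_div, ← hρ2, div_self (by positivity)])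
      refine ⟨(u, ⟨_, mem_closedBall_zero_iff.2 hw.le⟩), hw, ?_⟩
      change ((_ : ℂ × ℝ) : ThreeSphere) = _
      refine congrArg _ (Prod.ext ?_ ?_)
      · dsimp only [bandMap]
        congr 1
        refine Prod.ext ?_ ?_ <;> dsimp only
        · rw [hu1]
          field_simp
          ring
        · ring
      · dsimp only [bandMap]
        rw [hu2]
        field_simp
        ring

theorem coe_mem_complement {p : ℂ × ℝ} (hp : p ∉ G.link) :
    (p : ThreeSphere) ∈ G.chainmailLink.Complement := by
  rintro (v | e) u h
  · refine hp (Or.inl (mem_iUnion.2 ⟨v, u, ?_⟩))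
    rw [← OnePoint.coe_injective h]
    simp [UnitDisc.zero]
  · refine hp (Or.inr (mem_iUnion.2 ⟨e, u, ?_⟩))
    rw [← OnePoint.coe_injective h]
    simp [UnitDisc.zero]

end PlanarGraph

namespace PlanarGraph

open Holonomy

variable {V E : Type*} (G : PlanarGraph V E)

theorem mem_above_of_generic {z : ℂ} (hz : z ∈ G.generic) (h : ℝ) :
    (z, h) ∈ visibleFromAbove G.link := fun h' _ => hz h'

theorem mem_below_of_generic {z : ℂ} (hz : z ∈ G.generic) (h : ℝ) :
    (z, h) ∈ visibleFromBelow G.link := fun h' _ => hz h'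

theorem bandMap_mem_above {e : E} {t s h : ℝ} (hr : (t, s) ∈ closedRect)
    (h1 : 0 < h ∨ t ≠ -1 / 2 ∧ t ≠ 1 / 2) (h2 : s ≠ 0 ∨ 1 < |t| ∨ 0 ≤ h ∧ 1 < t ^ 2 + h ^ 2) :
    G.bandMap e ((t, s), h) ∈ visibleFromAbove G.link := by
  intro h' hh hl
  dsimp only [bandMap] at hh
  obtain ⟨h0, ht⟩ | ⟨hs, ht⟩ := G.of_band_mem_link hr hl
  · rcases h1 with h1 | ⟨h1, h1'⟩
    · linarith
    · exact ht.elim h1 h1'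
  · rcases h2 with h2 | h2 | ⟨h2, h3⟩
    · exact h2 hs
    · rw [← one_lt_sq_iff_one_lt_abs] at h2
      nlinarith [sq_nonneg h']
    · nlinarith

theorem bandMap_mem_below {e : E} {t s h : ℝ} (hr : (t, s) ∈ closedRect)
    (h1 : h < 0 ∨ t ≠ -1 / 2 ∧ t ≠ 1 / 2) (h2 : s ≠ 0 ∨ 1 < |t| ∨ h ≤ 0 ∧ 1 < t ^ 2 + h ^ 2) :
    G.bandMap e ((t, s), h) ∈ visibleFromBelow G.link := by
  intro h' hh hl
  dsimp only [bandMap] at hh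
  obtain ⟨h0, ht⟩ | ⟨hs, ht⟩ := G.of_band_mem_link hr hl
  · rcases h1 with h1 | ⟨h1, h1'⟩
    · linarith
    · exact ht.elim h1 h1'
  · rcases h2 with h2 | h2 | ⟨h2, h3⟩
    · exact h2 hs
    · rw [← one_lt_sq_iff_one_lt_abs] at h2
      nlinarith [sq_nonneg h']
    · nlinarith

theorem center_mem_generic (v : V) : G.center v ∈ G.generic := by
  have hr := G.radius_pos v
  refine G.mem_generic_iff.2 ⟨fun w hw => ?_, fun e t ht hb => ?_⟩
  · have hr' := G.radius_pos w
    obtain rfl : v = w := G.eq_of_dist_le (z := G.center v) (by rw [dist_self]; positivity)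
      (by rw [hw]; linarith)
    rw [dist_self] at hw
    exact hr.ne hw
  · have h0 : dist (G.band e (t, 0)) (G.center v) = G.radius v * 0 := by
      rw [← hb, dist_self, mul_zero]
    obtain ⟨-, h⟩ | ⟨-, h⟩ := G.of_dist_band_eq
      ⟨⟨by dsimp only; linarith [ht.1], by dsimp only; linarith [ht.2]⟩, by norm_num, by norm_num⟩
      (by norm_num) h0
    · linarith [ht.1]
    · linarith [ht.2]

/-- The point of the plane with polar coordinates `radius v * ρ` and `a` around the vertex `v`. -/
noncomputable def polar (v : V) (ρ a : ℝ) : ℂ :=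
  G.center v + (G.radius v * ρ : ℝ) * (Circle.exp a : ℂ)

theorem dist_polar (v : V) {ρ : ℝ} (hρ : 0 ≤ ρ) (a : ℝ) :
    dist (G.polar v ρ a) (G.center v) = G.radius v * ρ := by
  rw [polar, dist_self_add_left, norm_scaled _ (mul_nonneg (G.radius_pos v).le hρ)]

theorem exists_polar (v : V) {z : ℂ} {ρ : ℝ} (hρ : 0 < ρ)
    (h : dist z (G.center v) = G.radius v * ρ) : ∃ a, z = G.polar v ρ a := by
  obtain ⟨u, hu⟩ := exists_circle_mul (mul_pos (G.radius_pos v) hρ) h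
  obtain ⟨a, rfl⟩ := Circle.exp_surjective u
  exact ⟨a, hu⟩

theorem polar_inj {v : V} {ρ ρ' a a' : ℝ} (hρ : 0 < ρ) (hρ' : 0 < ρ')
    (h : G.polar v ρ a = G.polar v ρ' a') : ρ = ρ' ∧ Circle.exp a = Circle.exp a' := by
  have hr := G.radius_pos v
  obtain ⟨h1, h2⟩ := scaled_circle_inj (mul_pos hr hρ) (mul_pos hr hρ') (add_left_cancel h)
  exact ⟨mul_left_cancel₀ hr.ne' h1, h2⟩

theorem band_eq_polar_src (e : E) {t s : ℝ} (h : (t, s) ∈ closedRect) (ht : t ≤ -1 / 4) :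
    G.band e (t, s) = G.polar (G.src e) (3 / 2 + t) (G.srcAngle e + G.srcWidth e * s) :=
  G.band_src e t ⟨h.1.1, ht⟩ s h.2

theorem band_eq_polar_tgt (e : E) {t s : ℝ} (h : (t, s) ∈ closedRect) (ht : 1 / 4 ≤ t) :
    G.band e (t, s) = G.polar (G.tgt e) (3 / 2 - t) (G.tgtAngle e - G.tgtWidth e * s) :=
  G.band_tgt e t ⟨ht, h.1.2⟩ s h.2

theorem polar_congr {v : V} {ρ a a' : ℝ} (h : Circle.exp a = Circle.exp a') :
    G.polar v ρ a = G.polar v ρ a' := by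
  rw [polar, polar, h]

theorem mem_rect_zero {t : ℝ} (h1 : -5 / 4 ≤ t) (h2 : t ≤ 5 / 4) : (t, (0 : ℝ)) ∈ closedRect :=
  ⟨⟨h1, h2⟩, by norm_num, by norm_num⟩

/-- A radial direction which is blocked at one radius is the direction of an edge. -/
theorem of_polar_not_generic {v : V} {ρ a : ℝ} (hρ : 0 < ρ) (hρ' : ρ ≤ 5 / 4)
    (h : G.polar v ρ a ∉ G.generic) : ρ = 1 ∨
      (1 / 2 ≤ ρ ∧ ∃ e, (v = G.src e ∧ Circle.exp a = Circle.exp (G.srcAngle e)) ∨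
        (v = G.tgt e ∧ Circle.exp a = Circle.exp (G.tgtAngle e))) := by
  have hd := G.dist_polar v hρ.le a
  have hr := G.radius_pos v
  rw [mem_generic_iff, not_and_or] at h
  push Not at h
  obtain ⟨w, hw⟩ | ⟨e, t, ht, hb⟩ := h
  · left
    have hr' := G.radius_pos w
    obtain rfl : v = w := G.eq_of_dist_le (z := G.polar v ρ a) (by rw [hd]; nlinarith)
      (by rw [hw]; linarith)
    rw [hd] at hw
    exact mul_left_cancel₀ hr.ne' (by linarith)
  · right
    have hm := mem_rect_zero (t := t) (by linarith [ht.1]) (by linarith [ht.2])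
    rw [hb] at hd
    obtain ⟨rfl, h⟩ | ⟨rfl, h⟩ := G.of_dist_band_eq hm hρ' hd
    · refine ⟨by linarith [ht.1], e, Or.inl ⟨rfl, ?_⟩⟩
      rw [G.band_eq_polar_src e hm (by linarith), mul_zero, add_zero] at hb
      exact (G.polar_inj hρ (by linarith) hb).2
    · refine ⟨by linarith [ht.2], e, Or.inr ⟨rfl, ?_⟩⟩
      rw [G.band_eq_polar_tgt e hm (by linarith), mul_zero, sub_zero] at hb
      exact (G.polar_inj hρ (by linarith) hb).2

theorem polar_src_not_generic {e : E} {ρ a : ℝ} (hρ : 1 / 2 ≤ ρ) (hρ' : ρ ≤ 5 / 4)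
    (h : Circle.exp a = Circle.exp (G.srcAngle e)) : G.polar (G.src e) ρ a ∉ G.generic := by
  rw [G.polar_congr h, mem_generic_iff, not_and_or]
  right
  push Not
  refine ⟨e, ρ - 3 / 2, ⟨by linarith, by linarith⟩, ?_⟩
  rw [G.band_eq_polar_src e (mem_rect_zero (by linarith) (by linarith)) (by linarith)]
  congr 1 <;> ring

theorem polar_tgt_not_generic {e : E} {ρ a : ℝ} (hρ : 1 / 2 ≤ ρ) (hρ' : ρ ≤ 5 / 4)
    (h : Circle.exp a = Circle.exp (G.tgtAngle e)) : G.polar (G.tgt e) ρ a ∉ G.generic := by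
  rw [G.polar_congr h, mem_generic_iff, not_and_or]
  right
  push Not
  refine ⟨e, 3 / 2 - ρ, ⟨by linarith, by linarith⟩, ?_⟩
  rw [G.band_eq_polar_tgt e (mem_rect_zero (by linarith) (by linarith)) (by linarith)]
  congr 1 <;> ring

/-- Genericity spreads along radial segments: inward to the centre, and along the whole segment from
radius `1 / 2` to radius `5 / 4` except for radius `1`. -/
theorem polar_mem_generic {v : V} {ρ ρ' a : ℝ} (hρ : 0 < ρ) (hρ' : ρ ≤ 5 / 4) (h1 : ρ ≠ 1)
    (h : G.polar v ρ' a ∈ G.generic) (h2 : 1 / 2 ≤ ρ → 1 / 2 ≤ ρ') (h3 : ρ' ≤ 5 / 4) :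
    G.polar v ρ a ∈ G.generic := by
  by_contra hn
  obtain hh | ⟨hh, e, ⟨rfl, he⟩ | ⟨rfl, he⟩⟩ := G.of_polar_not_generic hρ hρ' hn
  · exact h1 hh
  · exact G.polar_src_not_generic (h2 hh) h3 he h
  · exact G.polar_tgt_not_generic (h2 hh) h3 he h

theorem polar_mem_link {v : V} {ρ a h : ℝ} (hρ : 7 / 8 ≤ ρ) (hρ' : ρ ≤ 9 / 8)
    (hg : G.polar v (9 / 8) a ∈ G.generic) (hl : (G.polar v ρ a, h) ∈ G.link) :
    ρ = 1 ∧ h = 0 := by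
  by_cases h1 : ρ = 1
  · subst h1
    refine ⟨rfl, ?_⟩
    obtain ⟨h0, -⟩ | ⟨e, t, ht, hb⟩ := G.mem_link_iff.1 hl
    · exact h0
    · have hd := G.dist_polar v zero_le_one a
      have ht' := abs_le.1 ((sq_le_one_iff_abs_le_one t).1 (by nlinarith [sq_nonneg h]))
      have hm := mem_rect_zero (t := t) (by linarith [ht'.1]) (by linarith [ht'.2])
      rw [hb] at hd
      obtain ⟨rfl, h⟩ | ⟨rfl, h⟩ := G.of_dist_band_eq hm (by norm_num) hd
      · rw [G.band_eq_polar_src e hm (by linarith), mul_zero, add_zero] at hb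
        exact absurd hg (G.polar_src_not_generic (by norm_num) (by norm_num)
          (G.polar_inj one_pos (by linarith) hb).2)
      · rw [G.band_eq_polar_tgt e hm (by linarith), mul_zero, sub_zero] at hb
        exact absurd hg (G.polar_tgt_not_generic (by norm_num) (by norm_num)
          (G.polar_inj one_pos (by linarith) hb).2)
  · exact absurd hl (G.polar_mem_generic (by linarith) (by linarith) h1 hg
      (fun _ => by norm_num) (by norm_num) h)

/-- A region of the strip over an edge, in the coordinates along the edge and of the height, over
which the complement of the link is star-shaped. -/
structure IsCell (S : Set (ℝ × ℝ)) : Prop where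
  convex : Convex ℝ S
  isOpen : IsOpen S
  bound : ∀ p ∈ S, |p.1| < 1
  left : ((-1 / 2 : ℝ), (0 : ℝ)) ∉ S
  right : ((1 / 2 : ℝ), (0 : ℝ)) ∉ S
  meets : ∃ p ∈ S, p.1 ^ 2 + p.2 ^ 2 < 1

/-- The part of the complement of an edge loop lying over a cell. -/
def slab (S : Set (ℝ × ℝ)) : Set ((ℝ × ℝ) × ℝ) :=
  {q | (q.1.1, q.2) ∈ S ∧ q.1.2 ∈ Ioo (-1 / 4 : ℝ) (1 / 4) ∧
    (q.1.2 ≠ 0 ∨ q.1.1 ^ 2 + q.2 ^ 2 < 1)}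

theorem slab_mono {S T : Set (ℝ × ℝ)} (h : S ⊆ T) : slab S ⊆ slab T := fun _ hq => ⟨h hq.1, hq.2⟩

namespace IsCell

variable {S : Set (ℝ × ℝ)}

theorem mem_openRect (hS : IsCell S) {q : (ℝ × ℝ) × ℝ} (hq : q ∈ slab S) : q.1 ∈ openRect := by
  have h := abs_lt.1 (hS.bound _ hq.1)
  dsimp only at h
  exact ⟨⟨by linarith, by linarith⟩, hq.2.1⟩

theorem mem_closedRect (hS : IsCell S) {q : (ℝ × ℝ) × ℝ} (hq : q ∈ slab S) : q.1 ∈ closedRect :=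
  openRect_subset (hS.mem_openRect hq)

theorem isOpen_slab (hS : IsCell S) : IsOpen (slab S) := by
  refine (hS.isOpen.preimage (by fun_prop : Continuous fun q : (ℝ × ℝ) × ℝ => (q.1.1, q.2))).inter
    ((isOpen_Ioo.preimage (by fun_prop : Continuous fun q : (ℝ × ℝ) × ℝ => q.1.2)).inter
      (IsOpen.union (s₁ := {q : (ℝ × ℝ) × ℝ | q.1.2 ≠ 0})
        (s₂ := {q : (ℝ × ℝ) × ℝ | q.1.1 ^ 2 + q.2 ^ 2 < 1})
        (isOpen_ne_fun (by fun_prop) continuous_const)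
        (isOpen_lt (by fun_prop) continuous_const)))

theorem isSimplyConnected_slab (hS : IsCell S) : IsSimplyConnected (slab S) := by
  obtain ⟨⟨t, h⟩, hp, hlt⟩ := hS.meets
  have hm : ((t, (0 : ℝ)), h) ∈ slab S := ⟨hp, ⟨by norm_num, by norm_num⟩, Or.inr hlt⟩
  refine StarConvex.isSimplyConnected (x := ((t, (0 : ℝ)), h)) ?_ hm
  rintro ⟨⟨t', s'⟩, h'⟩ ⟨h1, h2, h3⟩ a b ha hb hab
  dsimp only at h1 h2 h3 hlt
  refine ⟨hS.convex hp h1 ha hb hab, ?_, ?_⟩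
  · have := (convex_Ioo (-1 / 4 : ℝ) (1 / 4)) (x := 0) ⟨by norm_num, by norm_num⟩ h2 ha hb hab
    exact this
  · simp only [Prod.fst_add, Prod.smul_fst, Prod.snd_add, Prod.smul_snd, smul_eq_mul, mul_zero,
      zero_add]
    by_cases hz : b * s' = 0
    · right
      rcases mul_eq_zero.1 hz with rfl | rfl
      · obtain rfl : a = 1 := by linarith
        simpa using hlt
      · have h3' := h3.resolve_left (by simp)
        have hb' : b = 1 - a := by linarith
        subst hb'
        have h5 : a * (1 - a) * ((t - t') ^ 2 + (h - h') ^ 2) ≥ 0 := by positivity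
        rcases ha.eq_or_lt with rfl | ha'
        · simpa using h3'
        · nlinarith [mul_le_mul_of_nonneg_left h3'.le hb, mul_lt_mul_of_pos_left hlt ha']
    · exact Or.inl hz

theorem bandMap_not_mem_link (hS : IsCell S) (G : PlanarGraph V E) (e : E)
    {q : (ℝ × ℝ) × ℝ} (hq : q ∈ slab S) :
    G.bandMap e q ∉ G.link := by
  intro hl
  obtain ⟨h0, ht⟩ | ⟨hs, ht⟩ := G.of_band_mem_link (hS.mem_closedRect hq) hl
  · have hq1 := hq.1
    rw [h0] at hq1
    rcases ht with ht | ht <;> rw [ht] at hq1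
    · exact hS.left hq1
    · exact hS.right hq1
  · exact (hq.2.2.resolve_left (not_not_intro hs)).ne ht

theorem isPathConnected_half (hS : IsCell S) (ε : ℝ) (hε : ε = 1 ∨ ε = -1) :
    IsPathConnected {q : (ℝ × ℝ) × ℝ | (q.1.1, q.2) ∈ S ∧ q.1.2 ∈ Ioo (-1 / 4 : ℝ) (1 / 4) ∧
      0 < ε * q.1.2} := by
  refine Convex.isPathConnected ?_ ?_
  · rintro ⟨⟨t, s⟩, h⟩ ⟨h1, h2, h3⟩ ⟨⟨t', s'⟩, h'⟩ ⟨h1', h2', h3'⟩ a b ha hb hab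
    refine ⟨hS.convex h1 h1' ha hb hab, convex_Ioo _ _ h2 h2' ha hb hab, ?_⟩
    have := convex_Ioi (0 : ℝ) h3 h3' ha hb hab
    simp only [smul_eq_mul, mem_Ioi, Prod.fst_add, Prod.smul_fst, Prod.snd_add,
      Prod.smul_snd] at this ⊢
    linarith
  · obtain ⟨⟨t, h⟩, hp, -⟩ := hS.meets
    refine ⟨((t, ε / 8), h), hp, ?_, ?_⟩ <;> rcases hε with rfl | rfl <;> norm_num

end IsCell

/-- The cell over the middle part of an edge. -/
def midCell : Set (ℝ × ℝ) := {p | |p.1| < 1 / 2}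

theorem isCell_midCell : IsCell midCell where
  convex := by
    have : midCell = Prod.fst ⁻¹' (Metric.ball (0 : ℝ) (1 / 2)) := by
      ext p
      simp [midCell]
    rw [this]
    exact (convex_ball (0 : ℝ) (1 / 2)).linear_preimage (LinearMap.fst ℝ ℝ ℝ)
  isOpen := isOpen_lt (by fun_prop) continuous_const
  bound p hp := lt_trans hp (by norm_num)
  left h := by norm_num [midCell] at h
  right h := by norm_num [midCell] at h
  meets := ⟨(0, 0), by norm_num [midCell], by norm_num⟩

end PlanarGraph

namespace PlanarGraph

open Holonomy

variable {V E : Type*} (G : PlanarGraph V E) (s : V ⊕ E → ℚ)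

/-- The map from three-space to the surgery. -/
noncomputable def spaceMap (p : ℂ × ℝ) : G.chainmailLink.Surgery s :=
  G.chainmailLink.toSurgery s p

/-- The boundary torus of a solid torus, in angular coordinates. -/
noncomputable def torusMap (i : V ⊕ E) (c : ℝ × ℝ) : G.chainmailLink.Surgery s :=
  G.chainmailLink.toSurgery s (G.chainmailLink.tube i
    (Circle.exp c.1, UnitDisc.ofCircle (Circle.exp c.2)))

theorem torusMap_vertex (v : V) (c : ℝ × ℝ) : G.torusMap s (Sum.inl v) c =
    G.spaceMap s (G.polar v (1 + Real.cos c.2 / 8) c.1, -Real.sin c.2 / 8) := by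
  simp only [torusMap, spaceMap, chainmailLink, tube, vertexTube, UnitDisc.coe_ofCircle,
    Circle.coe_exp, Complex.exp_ofReal_mul_I_re, Complex.exp_ofReal_mul_I_im, polar]

theorem torusMap_edge (e : E) (c : ℝ × ℝ) : G.torusMap s (Sum.inr e) c =
    G.spaceMap s (G.bandMap e (((1 + Real.cos c.2 / 8) * Real.cos c.1, Real.sin c.2 / 8),
      (1 + Real.cos c.2 / 8) * Real.sin c.1)) := by
  simp only [torusMap, spaceMap, chainmailLink, tube, edgeTube, UnitDisc.coe_ofCircle,
    Circle.coe_exp, Complex.exp_ofReal_mul_I_re, Complex.exp_ofReal_mul_I_im, bandMap]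

theorem torusMap_periodic (i : V ⊕ E) (c : ℝ × ℝ) :
    G.torusMap s i (c.1 + 2 * Real.pi, c.2) = G.torusMap s i c ∧
      G.torusMap s i (c.1, c.2 + 2 * Real.pi) = G.torusMap s i c := by
  constructor <;> simp only [torusMap, Circle.exp_add_two_pi]

theorem above_subset : visibleFromAbove G.link ⊆ G.linkᶜ := fun p hp => hp p.2 le_rfl

theorem below_subset : visibleFromBelow G.link ⊆ G.linkᶜ := fun p hp => hp p.2 le_rfl

theorem band_mem_generic_of_mid {e : E} {q : (ℝ × ℝ) × ℝ} (hq : q ∈ slab midCell) (h : q.1.2 ≠ 0) :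
    G.band e q.1 ∈ G.generic := by
  have h1 : |q.1.1| < 1 / 2 := hq.1
  obtain ⟨h2, h3⟩ := abs_lt.1 h1
  exact G.band_mem_generic (isCell_midCell.mem_closedRect hq) (by linarith) (by linarith) (Or.inl h)

section

variable [Finite V] [Finite E]

theorem continuousOn_spaceMap : ContinuousOn (G.spaceMap s) G.linkᶜ :=
  (G.chainmailLink.continuousOn_toSurgery s G.hasOpenTubes).comp
    OnePoint.continuous_coe.continuousOn fun _ hp => G.coe_mem_complement hp

theorem continuous_torusMap (i : V ⊕ E) : Continuous (G.torusMap s i) := by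
  refine (G.chainmailLink.continuousOn_toSurgery s G.hasOpenTubes).comp_continuous
    ((G.chainmailLink.continuous_tube i).comp ((Circle.exp.continuous.comp continuous_fst).prodMk
      (UnitDisc.continuous_ofCircle.comp (Circle.exp.continuous.comp continuous_snd)))) ?_
  intro c j u h
  obtain ⟨-, h'⟩ := G.chainmailLink.tube_eq_iff.1 h
  have h2 := congrArg (fun w : UnitDisc => ‖(w : ℂ)‖) (Prod.mk.inj h').2
  simp [UnitDisc.zero] at h2

variable {Γ : Type*} [Group Γ] (H : Holonomy (G.chainmailLink.Surgery s) Γ)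

theorem exists_up : ∃ σ, H.IsSection (G.spaceMap s) (visibleFromAbove G.link) σ := by
  have hS := G.isCompact_link.isSimplyConnected_visibleFromAbove
  obtain ⟨x, hx, -⟩ := hS.isPathConnected
  obtain ⟨σ, hσ, -⟩ := exists_section (H := H) hS
    ((G.continuousOn_spaceMap s).mono G.above_subset) x hx 1
  exact ⟨σ, hσ⟩

theorem exists_down : ∃ σ, H.IsSection (G.spaceMap s) (visibleFromBelow G.link) σ := by
  have hS := G.isCompact_link.isSimplyConnected_visibleFromBelow
  obtain ⟨x, hx, -⟩ := hS.isPathConnected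
  obtain ⟨σ, hσ, -⟩ := exists_section (H := H) hS
    ((G.continuousOn_spaceMap s).mono G.below_subset) x hx 1
  exact ⟨σ, hσ⟩

theorem continuousOn_cell {S : Set (ℝ × ℝ)} (hS : IsCell S) (e : E) :
    ContinuousOn (G.spaceMap s ∘ G.bandMap e) (slab S) :=
  (G.continuousOn_spaceMap s).comp ((G.continuousOn_bandMap e).mono fun _ hq =>
    ⟨hS.mem_closedRect hq, mem_univ _⟩) fun _ hq => hS.bandMap_not_mem_link G e hq

theorem exists_mid (e : E) : ∃ σ, H.IsSection (G.spaceMap s ∘ G.bandMap e) (slab midCell) σ := by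
  have hS := isCell_midCell.isSimplyConnected_slab
  obtain ⟨x, hx, -⟩ := hS.isPathConnected
  obtain ⟨σ, hσ, -⟩ := exists_section (H := H) hS (G.continuousOn_cell s isCell_midCell e) x hx 1
  exact ⟨σ, hσ⟩

/-- The reference section over the points visible from above. -/
noncomputable def up : ℂ × ℝ → Γ := (G.exists_up s H).choose

/-- The reference section over the points visible from below. -/
noncomputable def down : ℂ × ℝ → Γ := (G.exists_down s H).choose

/-- The reference section over the middle part of an edge. -/
noncomputable def mid (e : E) : (ℝ × ℝ) × ℝ → Γ := (G.exists_mid s H e).choose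

theorem isSection_up : H.IsSection (G.spaceMap s) (visibleFromAbove G.link) (G.up s H) :=
  (G.exists_up s H).choose_spec

theorem isSection_down : H.IsSection (G.spaceMap s) (visibleFromBelow G.link) (G.down s H) :=
  (G.exists_down s H).choose_spec

theorem isSection_mid (e : E) :
    H.IsSection (G.spaceMap s ∘ G.bandMap e) (slab midCell) (G.mid s H e) :=
  (G.exists_mid s H e).choose_spec

/-- The element comparing the reference sections from above and from below along the vertical line
through a point of the plane. -/
noncomputable def transition (z : ℂ) : Γ := (G.down s H (z, 0))⁻¹ * G.up s H (z, 0)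

theorem transition_eq {C : Set ℂ} (hC : C ⊆ G.generic) (hp : IsPathConnected C) {z w : ℂ}
    (hz : z ∈ C) (hw : w ∈ C) : G.transition s H z = G.transition s H w := by
  have hp' : IsPathConnected (C ×ˢ ({0} : Set ℝ)) := by
    have : C ×ˢ ({0} : Set ℝ) = (fun z => (z, (0 : ℝ))) '' C := by
      ext ⟨z, h⟩
      constructor
      · rintro ⟨hz, rfl⟩
        exact ⟨z, hz, rfl⟩
      · rintro ⟨w, hw, e⟩
        obtain ⟨rfl, rfl⟩ := Prod.mk.inj e
        exact ⟨hw, rfl⟩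
    rw [this]
    exact hp.image (by fun_prop)
  exact ((G.isSection_down s H).mono fun p hp => G.mem_below_of_generic (hC hp.1) _).mul_eq
    ((G.isSection_up s H).mono fun p hp => G.mem_above_of_generic (hC hp.1) _)
    ((G.continuousOn_spaceMap s).mono fun p hp => hC hp.1 p.2) hp' (x := (z, 0)) (y := (w, 0))
    ⟨hz, rfl⟩ ⟨hw, rfl⟩

theorem up_eq {z : ℂ} (hz : z ∈ G.generic) (h : ℝ) :
    G.up s H (z, h) = G.down s H (z, h) * G.transition s H z := by
  have hp : IsPathConnected (({z} : Set ℂ) ×ˢ (univ : Set ℝ)) :=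
    ((convex_singleton z).prod convex_univ).isPathConnected ⟨(z, 0), rfl, mem_univ _⟩
  have hsub : ∀ p ∈ ({z} : Set ℂ) ×ˢ (univ : Set ℝ), p.1 ∈ G.generic := by
    rintro ⟨w, h⟩ ⟨rfl, -⟩
    exact hz
  have := ((G.isSection_down s H).mono fun p hp => G.mem_below_of_generic (hsub p hp) _).mul_eq
    ((G.isSection_up s H).mono fun p hp => G.mem_above_of_generic (hsub p hp) _)
    ((G.continuousOn_spaceMap s).mono fun p hp => hsub p hp p.2) hp (x := (z, h)) (y := (z, 0))
    ⟨rfl, mem_univ _⟩ ⟨rfl, mem_univ _⟩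
  rw [transition, ← this, mul_inv_cancel_left]

/-- The transition element at the centre of a vertex. -/
noncomputable def vertexValue (v : V) : Γ := G.transition s H (G.center v)

theorem transition_polar {v : V} {ρ a : ℝ} (hρ : 0 < ρ) (hρ' : ρ < 1)
    (hg : G.polar v ρ a ∈ G.generic) : G.transition s H (G.polar v ρ a) = G.vertexValue s H v := by
  refine G.transition_eq s H (C := (fun x => G.polar v x a) '' Icc 0 ρ) ?_
    (((convex_Icc 0 ρ).isPathConnected ⟨0, by simp [hρ.le]⟩).image (by unfold polar; fun_prop))
    ⟨ρ, by simp [hρ.le], rfl⟩ ⟨0, by simp [hρ.le], by simp [polar]⟩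
  rintro _ ⟨x, hx, rfl⟩
  rcases hx.1.eq_or_lt with rfl | hx0
  · simpa [polar] using G.center_mem_generic v
  · exact G.polar_mem_generic hx0 (by linarith [hx.2]) (by linarith [hx.2]) hg
      (fun h => h.trans hx.2) (by linarith)

theorem transition_of_dist_lt {v : V} {z : ℂ} (hz : z ∈ G.generic)
    (hd : dist z (G.center v) < G.radius v) : G.transition s H z = G.vertexValue s H v := by
  have hr := G.radius_pos v
  by_cases h0 : z = G.center v
  · rw [h0, vertexValue]
  have hd0 : 0 < dist z (G.center v) := dist_pos.2 h0
  obtain ⟨a, ha⟩ := G.exists_polar v (z := z) (ρ := dist z (G.center v) / G.radius v)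
    (by positivity) (by rw [mul_div_cancel₀ _ hr.ne'])
  rw [ha] at hz ⊢
  exact G.transition_polar s H (by positivity) ((div_lt_one hr).2 hd) hz

/-- The coefficient comparing the section from above with the section over the middle part of an
edge, on the left side (`ε = 1`) or on the right side (`ε = -1`) of the edge. -/
noncomputable def upCoeff (e : E) (ε : ℝ) : Γ :=
  (G.mid s H e ((0, ε / 8), 0))⁻¹ * G.up s H (G.bandMap e ((0, ε / 8), 0))

/-- The coefficient comparing the section from below with the section over the middle part of an
edge, on the left side (`ε = 1`) or on the right side (`ε = -1`) of the edge. -/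
noncomputable def downCoeff (e : E) (ε : ℝ) : Γ :=
  (G.mid s H e ((0, ε / 8), 0))⁻¹ * G.down s H (G.bandMap e ((0, ε / 8), 0))

theorem up_eq_mid {e : E} {ε : ℝ} (hε : ε = 1 ∨ ε = -1) {q : (ℝ × ℝ) × ℝ} (hq : q ∈ slab midCell)
    (h : 0 < ε * q.1.2) :
    G.up s H (G.bandMap e q) = G.mid s H e q * G.upCoeff s H e ε := by
  have hne : ∀ x : ℝ, 0 < ε * x → x ≠ 0 := by
    rintro _ hx rfl
    simp at hx
  have hsub : {q : (ℝ × ℝ) × ℝ | (q.1.1, q.2) ∈ midCell ∧ q.1.2 ∈ Ioo (-1 / 4 : ℝ) (1 / 4) ∧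
      0 < ε * q.1.2} ⊆ slab midCell := fun q hq => ⟨hq.1, hq.2.1, Or.inl (hne _ hq.2.2)⟩
  have := ((G.isSection_mid s H e).mono hsub).mul_eq ((G.isSection_up s H).comp
    ((G.continuousOn_bandMap e).mono fun q hq =>
      ⟨isCell_midCell.mem_closedRect (hsub hq), mem_univ _⟩) fun q hq =>
        G.mem_above_of_generic (G.band_mem_generic_of_mid (hsub hq) (hne _ hq.2.2)) _)
    ((G.continuousOn_cell s isCell_midCell e).mono hsub) (isCell_midCell.isPathConnected_half ε hε)
    (x := q) (y := ((0, ε / 8), 0)) ⟨hq.1, hq.2.1, h⟩ (by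
      refine ⟨by norm_num [midCell], ?_, ?_⟩ <;> rcases hε with rfl | rfl <;> norm_num)
  rw [upCoeff]
  simp only [Function.comp] at this
  rw [← this, mul_inv_cancel_left]

theorem down_eq_mid {e : E} {ε : ℝ} (hε : ε = 1 ∨ ε = -1) {q : (ℝ × ℝ) × ℝ}
    (hq : q ∈ slab midCell) (h : 0 < ε * q.1.2) :
    G.down s H (G.bandMap e q) = G.mid s H e q * G.downCoeff s H e ε := by
  have hne : ∀ x : ℝ, 0 < ε * x → x ≠ 0 := by
    rintro _ hx rfl
    simp at hx
  have hsub : {q : (ℝ × ℝ) × ℝ | (q.1.1, q.2) ∈ midCell ∧ q.1.2 ∈ Ioo (-1 / 4 : ℝ) (1 / 4) ∧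
      0 < ε * q.1.2} ⊆ slab midCell := fun q hq => ⟨hq.1, hq.2.1, Or.inl (hne _ hq.2.2)⟩
  have := ((G.isSection_mid s H e).mono hsub).mul_eq ((G.isSection_down s H).comp
    ((G.continuousOn_bandMap e).mono fun q hq =>
      ⟨isCell_midCell.mem_closedRect (hsub hq), mem_univ _⟩) fun q hq =>
        G.mem_below_of_generic (G.band_mem_generic_of_mid (hsub hq) (hne _ hq.2.2)) _)
    ((G.continuousOn_cell s isCell_midCell e).mono hsub) (isCell_midCell.isPathConnected_half ε hε)
    (x := q) (y := ((0, ε / 8), 0)) ⟨hq.1, hq.2.1, h⟩ (by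
      refine ⟨by norm_num [midCell], ?_, ?_⟩ <;> rcases hε with rfl | rfl <;> norm_num)
  rw [downCoeff]
  simp only [Function.comp] at this
  rw [← this, mul_inv_cancel_left]

/-- The transition element beside an edge. -/
theorem transition_band {e : E} {ε : ℝ} (hε : ε = 1 ∨ ε = -1) {t x : ℝ} (ht : |t| < 1 / 2)
    (hx : x ∈ Ioo (-1 / 4 : ℝ) (1 / 4)) (h : 0 < ε * x) :
    G.transition s H (G.band e (t, x)) = (G.downCoeff s H e ε)⁻¹ * G.upCoeff s H e ε := by
  have hq : (((t, x), 0) : (ℝ × ℝ) × ℝ) ∈ slab midCell := ⟨ht, hx, Or.inl (by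
    rintro rfl
    simp at h)⟩
  have h1 := G.up_eq_mid s H hε hq h (e := e)
  have h2 := G.down_eq_mid s H hε hq h (e := e)
  simp only [bandMap] at h1 h2
  rw [transition, h1, h2]
  group

/-- The monodromy around an edge. -/
noncomputable def edgeMonodromy (e : E) : Γ := (G.upCoeff s H e (-1))⁻¹ * G.upCoeff s H e 1

variable {s H}

theorem exists_torusSection (i : V ⊕ E) : ∃ g, H.IsSection (G.torusMap s i) univ g := by
  obtain ⟨g, hg, -⟩ := exists_section (H := H) (f := G.torusMap s i)
    (convex_univ.starConvex (mem_univ ((0 : ℝ), (0 : ℝ))) |>.isSimplyConnected (mem_univ _))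
    (G.continuous_torusMap s i).continuousOn (0, 0) (mem_univ _) 1
  exact ⟨g, hg⟩

variable {G} {i : V ⊕ E} {g : ℝ × ℝ → Γ}

/-- Comparison of a section over a boundary torus with another section, along a curve. -/
theorem compare_along (hg : H.IsSection (G.torusMap s i) univ g) {X : Type*} [TopologicalSpace X]
    {F : X → G.chainmailLink.Surgery s} {S : Set X} {σ : X → Γ} (hσ : H.IsSection F S σ)
    {I : Set ℝ} (hI : Convex ℝ I) {c : ℝ → ℝ × ℝ} (hc : Continuous c) {k : ℝ → X}
    (hk : ContinuousOn k I) (hkS : MapsTo k I S) (he : ∀ x ∈ I, F (k x) = G.torusMap s i (c x))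
    {x y : ℝ} (hx : x ∈ I) (hy : y ∈ I) : (σ (k x))⁻¹ * g (c x) = (σ (k y))⁻¹ * g (c y) := by
  have h1 := (hσ.comp hk hkS).congr_map (f' := G.torusMap s i ∘ c) he
  have h2 := hg.comp (S' := I) hc.continuousOn fun _ _ => mem_univ _
  exact h1.mul_eq h2 ((G.continuous_torusMap s i).comp hc).continuousOn
    (hI.isPathConnected ⟨x, hx⟩) hx hy

theorem longitude_mul (hg : H.IsSection (G.torusMap s i) univ g) (a b : ℝ) :
    g (a + 2 * Real.pi, b) = g (a, b) * ((g (0, 0))⁻¹ * g (2 * Real.pi, 0)) := by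
  have h := (hg.comp (g := fun c : ℝ × ℝ => (c.1 + 2 * Real.pi, c.2)) (S' := univ)
    (by fun_prop) fun _ _ => mem_univ _).congr_map (f' := G.torusMap s i)
      fun c _ => (G.torusMap_periodic s i c).1
  have := hg.mul_eq h (G.continuous_torusMap s i).continuousOn
    (convex_univ.isPathConnected univ_nonempty) (mem_univ (a, b)) (mem_univ (0, 0))
  simp only [Function.comp, zero_add] at this
  rw [← this, mul_inv_cancel_left]

theorem meridian_mul (hg : H.IsSection (G.torusMap s i) univ g) (a b : ℝ) :
    g (a, b + 2 * Real.pi) = g (a, b) * ((g (0, 0))⁻¹ * g (0, 2 * Real.pi)) := by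
  have h := (hg.comp (g := fun c : ℝ × ℝ => (c.1, c.2 + 2 * Real.pi)) (S' := univ)
    (by fun_prop) fun _ _ => mem_univ _).congr_map (f' := G.torusMap s i)
      fun c _ => (G.torusMap_periodic s i c).2
  have := hg.mul_eq h (G.continuous_torusMap s i).continuousOn
    (convex_univ.isPathConnected univ_nonempty) (mem_univ (a, b)) (mem_univ (0, 0))
  simp only [Function.comp, zero_add] at this
  rw [← this, mul_inv_cancel_left]

theorem longitude_zpow (hg : H.IsSection (G.torusMap s i) univ g) (a b : ℝ) (n : ℤ) :
    g (a + 2 * Real.pi * n, b) = g (a, b) * ((g (0, 0))⁻¹ * g (2 * Real.pi, 0)) ^ n := by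
  induction n using Int.induction_on with
  | zero => simp
  | succ n ih =>
    have := longitude_mul hg (a + 2 * Real.pi * (n : ℤ)) b
    rw [ih] at this
    rw [zpow_add_one, ← mul_assoc, ← this]
    push_cast
    ring_nf
  | pred n ih =>
    have := longitude_mul hg (a + 2 * Real.pi * ((-n - 1 : ℤ) : ℝ)) b
    rw [zpow_sub_one, ← mul_assoc, ← ih, eq_mul_inv_iff_mul_eq, ← this]
    push_cast
    ring_nf

theorem meridian_zpow (hg : H.IsSection (G.torusMap s i) univ g) (a b : ℝ) (n : ℤ) :
    g (a, b + 2 * Real.pi * n) = g (a, b) * ((g (0, 0))⁻¹ * g (0, 2 * Real.pi)) ^ n := by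
  induction n using Int.induction_on with
  | zero => simp
  | succ n ih =>
    have := meridian_mul hg a (b + 2 * Real.pi * (n : ℤ))
    rw [ih] at this
    rw [zpow_add_one, ← mul_assoc, ← this]
    push_cast
    ring_nf
  | pred n ih =>
    have := meridian_mul hg a (b + 2 * Real.pi * ((-n - 1 : ℤ) : ℝ))
    rw [zpow_sub_one, ← mul_assoc, ← ih, eq_mul_inv_iff_mul_eq, ← this]
    push_cast
    ring_nf

/-- The relation imposed by the surgery. -/
theorem surgery_relation (hg : H.IsSection (G.torusMap s i) univ g) :
    ((g (0, 0))⁻¹ * g (2 * Real.pi, 0)) ^ (s i).den *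
      ((g (0, 0))⁻¹ * g (0, 2 * Real.pi)) ^ (s i).num = 1 := by
  have h := G.chainmailLink.section_periodic s i hg
  have h1 := meridian_zpow hg (2 * Real.pi * (s i).den) 0 (s i).num
  have h2 := longitude_zpow hg 0 0 (s i).den
  rw [zero_add] at h1 h2
  rw [Int.cast_natCast, zpow_natCast] at h2
  rw [h1, h2, mul_assoc] at h
  exact mul_eq_left.1 h

end

end PlanarGraph

namespace PlanarGraph

open Holonomy Real

variable {V E : Type*} {G : PlanarGraph V E} {s : V ⊕ E → ℚ}

theorem bandMap_circle_mem_above (e : E) {a : ℝ} (ha : 0 ≤ sin a) :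
    G.bandMap e ((9 / 8 * cos a, 0), 9 / 8 * sin a) ∈ visibleFromAbove G.link := by
  have h := sin_sq_add_cos_sq a
  refine G.bandMap_mem_above ⟨⟨?_, ?_⟩, by norm_num, by norm_num⟩ ?_
    (Or.inr (Or.inr ⟨by linarith, by nlinarith⟩))
  · dsimp only; linarith [neg_one_le_cos a]
  · dsimp only; linarith [cos_le_one a]
  · rcases ha.eq_or_lt with h0 | h0
    · right
      rw [← h0] at h
      constructor <;> intro h1 <;> nlinarith
    · exact Or.inl (by linarith)

theorem bandMap_circle_mem_below (e : E) {a : ℝ} (ha : sin a ≤ 0) :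
    G.bandMap e ((9 / 8 * cos a, 0), 9 / 8 * sin a) ∈ visibleFromBelow G.link := by
  have h := sin_sq_add_cos_sq a
  refine G.bandMap_mem_below ⟨⟨?_, ?_⟩, by norm_num, by norm_num⟩ ?_
    (Or.inr (Or.inr ⟨by linarith, by nlinarith⟩))
  · dsimp only; linarith [neg_one_le_cos a]
  · dsimp only; linarith [cos_le_one a]
  · rcases ha.eq_or_lt with h0 | h0
    · right
      rw [h0] at h
      constructor <;> intro h1 <;> nlinarith
    · exact Or.inl (by linarith)

theorem spaceMap_polar (v : V) (a : ℝ) :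
    G.spaceMap s (G.polar v (9 / 8) a, 0) = G.torusMap s (Sum.inl v) (a, 0) := by
  rw [torusMap_vertex]
  simp only [cos_zero, sin_zero]
  norm_num

variable [Finite V] [Finite E] {Γ : Type*} [Group Γ]
  {H : Holonomy (G.chainmailLink.Surgery s) Γ} {g : ℝ × ℝ → Γ}

/-- The monodromy of a section from above or from below around an edge is conjugate to the
meridian. -/
theorem meridian_edge {e : E} (hg : H.IsSection (G.torusMap s (Sum.inr e)) univ g)
    {W : Set (ℂ × ℝ)} {σ : ℂ × ℝ → Γ} {C : ℝ → Γ} {δ a : ℝ}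
    (hσ : H.IsSection (G.spaceMap s) W σ) (ha : cos a = 0) (hδ : sin a = δ)
    (hδ' : δ = 1 ∨ δ = -1)
    (hW : ∀ x h, ((0 : ℝ), x) ∈ closedRect → x ≠ 0 ∨ 1 < δ * h → G.bandMap e ((0, x), h) ∈ W)
    (hC : ∀ ε : ℝ, ε = 1 ∨ ε = -1 → ∀ q ∈ slab midCell, 0 < ε * q.1.2 →
      σ (G.bandMap e q) = G.mid s H e q * C ε) :
    ∃ κ, κ = (σ (G.bandMap e ((0, 0), 9 / 8 * δ)))⁻¹ * g (a, 0) ∧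
      (C (-1))⁻¹ * C 1 = κ * ((g (0, 0))⁻¹ * g (0, 2 * π)) * κ⁻¹ := by
  have hδ2 : δ * δ = 1 := by rcases hδ' with rfl | rfl <;> norm_num
  let k : ℝ → (ℝ × ℝ) × ℝ := fun b => ((0, sin b / 8), (1 + cos b / 8) * δ)
  have hk : Continuous k := by fun_prop
  have hkr : ∀ b, (k b).1 ∈ closedRect := fun b =>
    ⟨⟨by norm_num [k], by norm_num [k]⟩, by dsimp only [k]; linarith [neg_one_le_sin b],
      by dsimp only [k]; linarith [sin_le_one b]⟩
  have hkb : ∀ I, ContinuousOn (G.bandMap e ∘ k) I := fun I =>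
    (G.continuousOn_bandMap e).comp hk.continuousOn fun b _ => ⟨hkr b, mem_univ _⟩
  have he : ∀ b, G.spaceMap s (G.bandMap e (k b)) = G.torusMap s (Sum.inr e) (a, b) := by
    intro b
    rw [torusMap_edge]
    simp only [k, ha, hδ, mul_zero]
  have hkW : ∀ b, sin b ≠ 0 ∨ 0 < cos b → G.bandMap e (k b) ∈ W := by
    intro b hb
    refine hW _ _ (hkr b) (hb.imp (fun h => div_ne_zero h (by norm_num)) fun h => ?_)
    nlinarith
  have hkm : ∀ b ∈ Ioo 0 (2 * π), k b ∈ slab midCell := by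
    intro b hb
    refine ⟨by norm_num [k, midCell], ⟨by dsimp only [k]; linarith [neg_one_le_sin b],
      by dsimp only [k]; linarith [sin_le_one b]⟩, ?_⟩
    by_cases h : sin b = 0
    · right
      dsimp only [k]
      have h1 : cos b = -1 := by
        rcases sin_eq_zero_iff_cos_eq.1 h with h1 | h1
        · obtain ⟨n, hn⟩ := (cos_eq_one_iff b).1 h1
          have hp := pi_pos
          rw [← hn] at hb
          have h2 : (0 : ℝ) < n := by nlinarith [hb.1]
          have h3 : (n : ℝ) < 1 := by nlinarith [hb.2]
          have h4 : 0 < n := by exact_mod_cast h2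
          have h5 : n < 1 := by exact_mod_cast h3
          omega
        · exact h1
      rw [h1]
      nlinarith
    · exact Or.inl (div_ne_zero h (by norm_num))
  have hp := pi_pos
  have c1 := compare_along hg hσ (convex_Ico 0 π) (c := fun b => (a, b)) (by fun_prop) (hkb _)
    (fun b hb => hkW b (by
      rcases hb.1.eq_or_lt with rfl | h
      · right; simp
      · exact Or.inl (sin_pos_of_pos_of_lt_pi h hb.2).ne')) (fun b _ => he b)
    (x := 0) (y := π / 2) ⟨le_rfl, hp⟩ ⟨by linarith, by linarith⟩
  have c2 := compare_along hg (G.isSection_mid s H e) (convex_Ioo 0 (2 * π))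
    (c := fun b => (a, b)) (by fun_prop) hk.continuousOn hkm (fun b _ => he b)
    (x := π / 2) (y := π + π / 2) ⟨by linarith, by linarith⟩ ⟨by linarith, by linarith⟩
  have c3 := compare_along hg hσ (convex_Ioc π (2 * π)) (c := fun b => (a, b)) (by fun_prop)
    (hkb _) (fun b hb => hkW b (by
      rcases hb.2.eq_or_lt with rfl | h
      · right; simp
      · left
        have := sin_pos_of_pos_of_lt_pi (x := b - π) (by linarith [hb.1]) (by linarith)
        rw [sin_sub_pi] at this
        linarith)) (fun b _ => he b)
    (x := π + π / 2) (y := 2 * π) ⟨by linarith, by linarith⟩ ⟨by linarith, le_rfl⟩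
  have s1 : sin (π + π / 2) = -1 := by rw [add_comm, sin_add_pi, sin_pi_div_two]
  have v1 := hC 1 (Or.inl rfl) (k (π / 2)) (hkm _ ⟨by linarith, by linarith⟩) (by norm_num [k])
  have v2 := hC (-1) (Or.inr rfl) (k (π + π / 2)) (hkm _ ⟨by linarith, by linarith⟩)
    (by norm_num [k, s1])
  have hm := meridian_mul hg a 0
  have k0 : k 0 = ((0, 0), 9 / 8 * δ) := by
    simp only [k, sin_zero, cos_zero]
    norm_num
  have k2 : k (2 * π) = k 0 := by simp [k]
  rw [zero_add] at hm
  simp only [Function.comp] at c1 c3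
  rw [k2, v2, hm] at c3
  rw [v1] at c1
  rw [k0] at c1 c3
  refine ⟨_, rfl, ?_⟩
  generalize (g (0, 0))⁻¹ * g (0, 2 * π) = μ at *
  generalize σ (G.bandMap e ((0, 0), 9 / 8 * δ)) = u at *
  have e1 : (C 1) * (u⁻¹ * g (a, 0)) = (C (-1)) * (u⁻¹ * g (a, 0) * μ) := by
    rw [mul_assoc u⁻¹, ← c3, c1, ← mul_assoc, ← mul_assoc, mul_inv_rev, mul_inv_rev,
      mul_inv_cancel_left, mul_inv_cancel_left]
    exact c2
  rw [eq_mul_inv_iff_mul_eq, mul_assoc, e1, inv_mul_cancel_left]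

theorem longitude_edge {e : E} (hg : H.IsSection (G.torusMap s (Sum.inr e)) univ g) :
    ∃ κ, κ = (G.up s H (G.bandMap e ((0, 0), 9 / 8)))⁻¹ * g (π / 2, 0) ∧
      (G.vertexValue s H (G.tgt e))⁻¹ * G.vertexValue s H (G.src e) =
        κ * ((g (0, 0))⁻¹ * g (2 * π, 0)) * κ⁻¹ := by
  let k : ℝ → (ℝ × ℝ) × ℝ := fun a => ((9 / 8 * cos a, 0), 9 / 8 * sin a)
  have hk : Continuous k := by fun_prop
  have hkr : ∀ b, (k b).1 ∈ closedRect := fun b =>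
    mem_rect_zero (by linarith [neg_one_le_cos b]) (by linarith [cos_le_one b])
  have hkb : ∀ I, ContinuousOn (G.bandMap e ∘ k) I := fun I =>
    (G.continuousOn_bandMap e).comp hk.continuousOn fun b _ => ⟨hkr b, mem_univ _⟩
  have he : ∀ a, G.spaceMap s (G.bandMap e (k a)) = G.torusMap s (Sum.inr e) (a, 0) := by
    intro b
    rw [torusMap_edge]
    simp only [k, cos_zero, sin_zero]
    norm_num
  have hp := pi_pos
  have c1 := compare_along hg (G.isSection_up s H) (convex_Icc (π / 2) π) (c := fun a => (a, 0))
    (by fun_prop) (hkb _) (fun a ha => bandMap_circle_mem_above e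
      (sin_nonneg_of_nonneg_of_le_pi (by linarith [ha.1]) ha.2)) (fun b _ => he b)
    (x := π / 2) (y := π) ⟨le_rfl, by linarith⟩ ⟨by linarith, le_rfl⟩
  have c2 := compare_along hg (G.isSection_down s H) (convex_Icc π (2 * π)) (c := fun a => (a, 0))
    (by fun_prop) (hkb _) (fun a ha => bandMap_circle_mem_below e (by
      have := sin_nonneg_of_nonneg_of_le_pi (x := a - π) (by linarith [ha.1]) (by linarith [ha.2])
      rw [sin_sub_pi] at this
      linarith)) (fun b _ => he b)
    (x := π) (y := 2 * π) ⟨le_rfl, by linarith⟩ ⟨by linarith, le_rfl⟩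
  have c3 := compare_along hg (G.isSection_up s H) (convex_Icc (2 * π) (π / 2 + 2 * π))
    (c := fun a => (a, 0)) (by fun_prop) (hkb _) (fun a ha => bandMap_circle_mem_above e (by
      have := sin_nonneg_of_nonneg_of_le_pi (x := a - 2 * π) (by linarith [ha.1])
        (by linarith [ha.2])
      rwa [sin_sub_two_pi] at this)) (fun b _ => he b)
    (x := 2 * π) (y := π / 2 + 2 * π) ⟨le_rfl, by linarith⟩ ⟨by linarith, le_rfl⟩
  have kπ : G.bandMap e (k π) = (G.band e (-9 / 8, 0), 0) := by
    simp only [k, bandMap, cos_pi, sin_pi]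
    norm_num
  have k2π : G.bandMap e (k (2 * π)) = (G.band e (9 / 8, 0), 0) := by
    simp only [k, bandMap, cos_two_pi, sin_two_pi]
    norm_num
  have kh : G.bandMap e (k (π / 2)) = G.bandMap e ((0, 0), 9 / 8) := by
    simp only [k, cos_pi_div_two, sin_pi_div_two]
    norm_num
  have kh' : k (π / 2 + 2 * π) = k (π / 2) := by simp [k]
  have r1 : ((-9 / 8 : ℝ), (0 : ℝ)) ∈ closedRect := mem_rect_zero (by norm_num) (by norm_num)
  have r2 : ((9 / 8 : ℝ), (0 : ℝ)) ∈ closedRect := mem_rect_zero (by norm_num) (by norm_num)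
  have hr1 := G.radius_pos (G.src e)
  have hr2 := G.radius_pos (G.tgt e)
  have g1 : G.band e (-9 / 8, 0) ∈ G.generic := G.band_mem_generic r1 (by norm_num) (by norm_num)
    (Or.inr (by rw [abs_of_neg] <;> norm_num))
  have g2 : G.band e (9 / 8, 0) ∈ G.generic := G.band_mem_generic r2 (by norm_num) (by norm_num)
    (Or.inr (by rw [abs_of_pos] <;> norm_num))
  have t1 : G.transition s H (G.band e (-9 / 8, 0)) = G.vertexValue s H (G.src e) :=
    G.transition_of_dist_lt s H g1 (by
      rw [G.dist_band_src e ⟨by norm_num, by norm_num⟩ r1.2]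
      nlinarith)
  have t2 : G.transition s H (G.band e (9 / 8, 0)) = G.vertexValue s H (G.tgt e) :=
    G.transition_of_dist_lt s H g2 (by
      rw [G.dist_band_tgt e ⟨by norm_num, by norm_num⟩ r2.2]
      nlinarith)
  have hl := longitude_mul hg (π / 2) 0
  have u1 := G.up_eq s H g1 0
  have u2 := G.up_eq s H g2 0
  rw [t1] at u1
  rw [t2] at u2
  simp only [Function.comp] at c1 c2 c3
  rw [kπ, u1, kh] at c1
  rw [kπ, k2π] at c2
  rw [kh', kh, k2π, u2, hl] at c3
  refine ⟨_, rfl, ?_⟩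
  generalize (g (0, 0))⁻¹ * g (2 * π, 0) = l at *
  generalize G.up s H (G.bandMap e ((0, 0), 9 / 8)) = u at *
  have e1 : G.vertexValue s H (G.src e) * (u⁻¹ * g (π / 2, 0)) =
      G.vertexValue s H (G.tgt e) * (u⁻¹ * g (π / 2, 0) * l) := by
    rw [mul_assoc u⁻¹, ← c3, c1, ← mul_assoc, ← mul_assoc, mul_inv_rev, mul_inv_rev,
      mul_inv_cancel_left, mul_inv_cancel_left]
    exact c2
  rw [eq_mul_inv_iff_mul_eq, mul_assoc, e1, inv_mul_cancel_left]

theorem edge_up_monodromy {e : E} (hg : H.IsSection (G.torusMap s (Sum.inr e)) univ g) :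
    ∃ κ, κ = (G.up s H (G.bandMap e ((0, 0), 9 / 8)))⁻¹ * g (π / 2, 0) ∧
      G.edgeMonodromy s H e = κ * ((g (0, 0))⁻¹ * g (0, 2 * π)) * κ⁻¹ := by
  have h := meridian_edge hg (C := G.upCoeff s H e) (δ := 1) (G.isSection_up s H) cos_pi_div_two
    sin_pi_div_two (Or.inl rfl) (fun x h hr hx => G.bandMap_mem_above hr
      (Or.inr ⟨by norm_num, by norm_num⟩) (hx.imp id fun h => Or.inr ⟨by linarith, by nlinarith⟩))
    fun ε hε q hq hs => G.up_eq_mid s H hε hq hs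
  rw [mul_one] at h
  exact h

/-- The relation between the monodromy around an edge and the transition elements at its ends. -/
theorem edge_relation (e : E) :
    ((G.vertexValue s H (G.tgt e))⁻¹ * G.vertexValue s H (G.src e)) ^ (s (Sum.inr e)).den *
      (G.edgeMonodromy s H e) ^ (s (Sum.inr e)).num = 1 := by
  obtain ⟨g, hg⟩ := G.exists_torusSection (H := H) (Sum.inr e)
  obtain ⟨κ, hκ, h1⟩ := edge_up_monodromy hg
  obtain ⟨κ', hκ', h2⟩ := longitude_edge hg
  rw [hκ'.trans hκ.symm] at h2
  have hr := surgery_relation hg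
  rw [h1, h2, conj_pow, conj_zpow]
  generalize ((g (0, 0))⁻¹ * g (2 * π, 0)) ^ (s (Sum.inr e)).den = x at *
  calc _ = κ * (x * ((g (0, 0))⁻¹ * g (0, 2 * π)) ^ (s (Sum.inr e)).num) * κ⁻¹ := by
        simp only [mul_assoc, inv_mul_cancel_left]
    _ = 1 := by rw [hr, mul_one, mul_inv_cancel]

theorem downCoeff_eq {e : E} (h : G.edgeMonodromy s H e = 1) :
    G.downCoeff s H e 1 = G.downCoeff s H e (-1) := by
  obtain ⟨g, hg⟩ := G.exists_torusSection (H := H) (Sum.inr e)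
  obtain ⟨κ, -, h1⟩ := edge_up_monodromy hg
  have hμ : (g (0, 0))⁻¹ * g (0, 2 * π) = 1 := by
    rw [h, eq_mul_inv_iff_mul_eq, one_mul, left_eq_mul] at h1
    exact h1
  obtain ⟨κ', -, h2⟩ := meridian_edge hg (C := G.downCoeff s H e) (δ := -1) (a := -(π / 2))
    (G.isSection_down s H) (by rw [cos_neg, cos_pi_div_two]) (by rw [sin_neg, sin_pi_div_two])
    (Or.inr rfl) (fun x h hr hx => G.bandMap_mem_below hr
      (Or.inr ⟨by norm_num, by norm_num⟩) (hx.imp id fun h => Or.inr ⟨by linarith, by nlinarith⟩))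
    fun ε hε q hq hs => G.down_eq_mid s H hε hq hs
  rw [hμ, mul_one, mul_inv_cancel] at h2
  exact (eq_of_inv_mul_eq_one h2).symm

/-- A turn around the meridian of a vertex loop. -/
theorem vertex_turn {v : V} (hg : H.IsSection (G.torusMap s (Sum.inl v)) univ g) {a : ℝ}
    (ha : G.polar v (9 / 8) a ∈ G.generic) :
    g (a, 2 * π) = G.up s H (G.polar v (9 / 8) a, 0) * ((G.vertexValue s H v)⁻¹ *
      (G.transition s H (G.polar v (9 / 8) a) *
        ((G.up s H (G.polar v (9 / 8) a, 0))⁻¹ * g (a, 0)))) := by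
  let k : ℝ → ℂ × ℝ := fun b => (G.polar v (1 + cos b / 8) a, -sin b / 8)
  have hk : Continuous k := by
    unfold k polar
    fun_prop
  have he : ∀ b, G.spaceMap s (k b) = G.torusMap s (Sum.inl v) (a, b) := fun b =>
    (G.torusMap_vertex s v (a, b)).symm
  have hcos : ∀ b h, (G.polar v (1 + cos b / 8) a, h) ∈ G.link → sin b ^ 2 = 1 ∧ h = 0 := by
    intro b h hl
    obtain ⟨h1, h2⟩ := G.polar_mem_link (by linarith [neg_one_le_cos b])
      (by linarith [cos_le_one b]) ha hl
    have h3 : cos b = 0 := by linarith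
    have := sin_sq_add_cos_sq b
    rw [h3] at this
    exact ⟨by linarith, h2⟩
  have hp := pi_pos
  have c1 := compare_along hg (G.isSection_down s H) (convex_Icc 0 π) (c := fun b => (a, b))
    (by fun_prop) hk.continuousOn (fun b hb h hh hl => by
      obtain ⟨h1, rfl⟩ := hcos b h hl
      have := sin_nonneg_of_nonneg_of_le_pi hb.1 hb.2
      dsimp only [k] at hh
      nlinarith) (fun b _ => he b)
    (x := 0) (y := π) ⟨le_rfl, hp.le⟩ ⟨hp.le, le_rfl⟩
  have c2 := compare_along hg (G.isSection_up s H) (convex_Icc π (2 * π)) (c := fun b => (a, b))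
    (by fun_prop) hk.continuousOn (fun b hb h hh hl => by
      obtain ⟨h1, rfl⟩ := hcos b h hl
      have := sin_nonneg_of_nonneg_of_le_pi (x := b - π) (by linarith [hb.1]) (by linarith [hb.2])
      rw [sin_sub_pi] at this
      dsimp only [k] at hh
      nlinarith) (fun b _ => he b)
    (x := π) (y := 2 * π) ⟨le_rfl, by linarith⟩ ⟨by linarith, le_rfl⟩
  have k0 : k 0 = (G.polar v (9 / 8) a, 0) := by
    simp only [k, cos_zero, sin_zero]
    norm_num
  have k2 : k (2 * π) = (G.polar v (9 / 8) a, 0) := by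
    simp only [k, cos_two_pi, sin_two_pi]
    norm_num
  have k1 : k π = (G.polar v (7 / 8) a, 0) := by
    simp only [k, cos_pi, sin_pi]
    norm_num
  have hg' : G.polar v (7 / 8) a ∈ G.generic := G.polar_mem_generic (by norm_num) (by norm_num)
    (by norm_num) ha (fun _ => by norm_num) (by norm_num)
  have u1 := G.up_eq s H hg' 0
  have u0 := G.up_eq s H ha 0
  rw [G.transition_polar s H (by norm_num) (by norm_num) hg'] at u1
  rw [k0, k1] at c1
  rw [k1, k2, u1, mul_inv_rev, mul_assoc, ← c1] at c2
  have u0' : (G.up s H (G.polar v (9 / 8) a, 0))⁻¹ = (G.transition s H (G.polar v (9 / 8) a))⁻¹ *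
      (G.down s H (G.polar v (9 / 8) a, 0))⁻¹ := by rw [u0, mul_inv_rev]
  rw [u0', mul_assoc, mul_inv_cancel_left, c2, mul_inv_cancel_left]

variable (G s H) in
/-- The coefficient of a section over the boundary torus of a vertex with respect to the section
from above, along the outer longitude. -/
noncomputable def height (v : V) (g : ℝ × ℝ → Γ) (a : ℝ) : Γ :=
  (G.up s H (G.polar v (9 / 8) a, 0))⁻¹ * g (a, 0)

theorem height_eq {v : V} (hg : H.IsSection (G.torusMap s (Sum.inl v)) univ g) {I : Set ℝ}
    (hI : Convex ℝ I) (hIg : ∀ a ∈ I, G.polar v (9 / 8) a ∈ G.generic) {a b : ℝ} (ha : a ∈ I)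
    (hb : b ∈ I) : G.height s H v g a = G.height s H v g b :=
  compare_along hg (G.isSection_up s H) hI (c := fun a => (a, 0)) (by fun_prop)
    (k := fun a => (G.polar v (9 / 8) a, 0)) (by unfold polar; fun_prop)
    (fun a ha => G.mem_above_of_generic (hIg a ha) 0) (fun a _ => spaceMap_polar v a) ha hb

variable (G s H) in
/-- The transition element on the left side of an edge. -/
noncomputable def sideValue (e : E) : Γ := (G.downCoeff s H e 1)⁻¹ * G.upCoeff s H e 1

theorem crossing {v : V} {e : E} (hg : H.IsSection (G.torusMap s (Sum.inl v)) univ g)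
    {a t w η : ℝ} (ht : |t| < 1 / 2) (hw : 0 < w) (hη : η = 1 ∨ η = -1)
    (hb : ∀ y, (t, η * (y / w)) ∈ closedRect →
      G.band e (t, η * (y / w)) = G.polar v (9 / 8) (a + y)) :
    ∃ c, ∀ y ∈ Ioo (-w / 4) (w / 4), ∀ ε : ℝ, ε = 1 ∨ ε = -1 → 0 < ε * (η * y) →
      G.polar v (9 / 8) (a + y) ∈ G.generic ∧
      G.transition s H (G.polar v (9 / 8) (a + y)) =
        (G.downCoeff s H e ε)⁻¹ * G.upCoeff s H e ε ∧
      G.height s H v g (a + y) = (G.upCoeff s H e ε)⁻¹ * c := by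
  let k : ℝ → (ℝ × ℝ) × ℝ := fun y => ((t, η * (y / w)), 0)
  have hx : ∀ y ∈ Ioo (-w / 4) (w / 4), η * (y / w) ∈ Ioo (-1 / 4 : ℝ) (1 / 4) := by
    intro y hy
    have h1 : -1 / 4 < y / w := by rw [lt_div_iff₀ hw]; linarith [hy.1]
    have h2 : y / w < 1 / 4 := by rw [div_lt_iff₀ hw]; linarith [hy.2]
    rcases hη with rfl | rfl <;> constructor <;> linarith
  have hkm : ∀ y ∈ Ioo (-w / 4) (w / 4), k y ∈ slab midCell := fun y hy =>
    ⟨ht, hx y hy, Or.inr (by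
      have := (sq_lt_sq₀ (abs_nonneg t) (by norm_num)).2 ht
      rw [sq_abs] at this
      dsimp only [k]
      linarith)⟩
  have hb' : ∀ y ∈ Ioo (-w / 4) (w / 4), G.bandMap e (k y) = (G.polar v (9 / 8) (a + y), 0) :=
    fun y hy => Prod.ext (hb y (isCell_midCell.mem_closedRect (hkm y hy))) rfl
  have h0 : (0 : ℝ) ∈ Ioo (-w / 4) (w / 4) := ⟨by linarith, by linarith⟩
  refine ⟨(G.mid s H e (k 0))⁻¹ * g (a + 0, 0), fun y hy ε hε hpos => ?_⟩
  have hpos' : 0 < ε * (η * (y / w)) := by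
    have := div_pos hpos hw
    rwa [mul_div_assoc, mul_div_assoc] at this
  have hne : (k y).1.2 ≠ 0 := by
    intro h
    simp only [k] at h
    rw [h, mul_zero] at hpos'
    exact hpos'.ne rfl
  have c := compare_along hg (G.isSection_mid s H e) (convex_Ioo (-w / 4) (w / 4))
    (c := fun y => (a + y, 0)) (by fun_prop) (k := k) (by fun_prop) hkm (fun y hy => by
      rw [Function.comp, hb' y hy, spaceMap_polar]) hy h0
  have hgen := G.band_mem_generic_of_mid (hkm y hy) hne (e := e)
  have hu := G.up_eq_mid s H hε (hkm y hy) hpos' (e := e)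
  have htr := G.transition_band s H hε ht (hx y hy) hpos' (e := e)
  have hbb : G.band e (t, η * (y / w)) = G.polar v (9 / 8) (a + y) := congrArg Prod.fst (hb' y hy)
  rw [hb' y hy] at hu
  rw [← c, height, hu, mul_inv_rev, mul_assoc, ← hbb]
  exact ⟨hgen, htr, rfl⟩

theorem crossing_src {e : E} (hg : H.IsSection (G.torusMap s (Sum.inl (G.src e))) univ g) {a : ℝ}
    (ha : Circle.exp a = Circle.exp (G.srcAngle e)) : ∃ p, ∃ ε > 0, ∀ x ∈ Ioo 0 ε,
      (G.polar (G.src e) (9 / 8) (a + x) ∈ G.generic ∧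
        G.transition s H (G.polar (G.src e) (9 / 8) (a + x)) = G.sideValue s H e ∧
        G.height s H (G.src e) g (a + x) = p) ∧
      (G.polar (G.src e) (9 / 8) (a - x) ∈ G.generic ∧
        G.height s H (G.src e) g (a - x) = G.edgeMonodromy s H e * p) := by
  have hw := G.srcWidth_pos e
  obtain ⟨c, hc⟩ := crossing hg (e := e) (a := a) (t := -3 / 8) (w := G.srcWidth e) (η := 1)
    (by norm_num [abs_lt]) hw (Or.inl rfl) (fun y hy => by
      rw [G.band_eq_polar_src e hy (by norm_num), one_mul, mul_div_cancel₀ _ hw.ne']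
      norm_num
      exact G.polar_congr (by rw [Circle.exp_add, Circle.exp_add, ha]))
  refine ⟨(G.upCoeff s H e 1)⁻¹ * c, G.srcWidth e / 4, by positivity, fun x hx => ⟨?_, ?_⟩⟩
  · exact hc x ⟨by linarith [hx.1], hx.2⟩ 1 (Or.inl rfl) (by linarith [hx.1])
  · obtain ⟨h1, -, h2⟩ := hc (-x) ⟨by linarith [hx.2], by linarith [hx.1]⟩ (-1) (Or.inr rfl)
      (by linarith [hx.1])
    rw [← sub_eq_add_neg] at h1 h2
    refine ⟨h1, ?_⟩
    rw [h2, edgeMonodromy, mul_assoc, mul_inv_cancel_left]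

theorem crossing_tgt {e : E} (hg : H.IsSection (G.torusMap s (Sum.inl (G.tgt e))) univ g) {a : ℝ}
    (ha : Circle.exp a = Circle.exp (G.tgtAngle e)) : ∃ p, ∃ ε > 0, ∀ x ∈ Ioo 0 ε,
      (G.polar (G.tgt e) (9 / 8) (a - x) ∈ G.generic ∧
        G.transition s H (G.polar (G.tgt e) (9 / 8) (a - x)) = G.sideValue s H e ∧
        G.height s H (G.tgt e) g (a - x) = p) ∧
      (G.polar (G.tgt e) (9 / 8) (a + x) ∈ G.generic ∧
        G.height s H (G.tgt e) g (a + x) = G.edgeMonodromy s H e * p) := by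
  have hw := G.tgtWidth_pos e
  obtain ⟨c, hc⟩ := crossing hg (e := e) (a := a) (t := 3 / 8) (w := G.tgtWidth e) (η := -1)
    (by norm_num [abs_lt]) hw (Or.inr rfl) (fun y hy => by
      rw [G.band_eq_polar_tgt e hy (by norm_num), neg_one_mul, mul_neg, sub_neg_eq_add,
        mul_div_cancel₀ _ hw.ne']
      norm_num
      exact G.polar_congr (by rw [Circle.exp_add, Circle.exp_add, ha]))
  refine ⟨(G.upCoeff s H e 1)⁻¹ * c, G.tgtWidth e / 4, by positivity, fun x hx => ⟨?_, ?_⟩⟩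
  · have := hc (-x) ⟨by linarith [hx.2], by linarith [hx.1]⟩ 1 (Or.inl rfl) (by linarith [hx.1])
    rwa [← sub_eq_add_neg] at this
  · obtain ⟨h1, -, h2⟩ := hc x ⟨by linarith [hx.1], by linarith [hx.2]⟩ (-1) (Or.inr rfl)
      (by linarith [hx.1])
    refine ⟨h1, ?_⟩
    rw [h2, edgeMonodromy, mul_assoc, mul_inv_cancel_left]

end PlanarGraph

/-- Left invariance of an order on a group. -/
def LeftInvariant (Γ : Type*) [Group Γ] [LinearOrder Γ] : Prop :=
  ∀ f g h : Γ, g ≤ h → f * g ≤ f * h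

namespace LeftInvariant

variable {Γ : Type*} [Group Γ] [LinearOrder Γ]

theorem le_iff (hΓ : LeftInvariant Γ) {f g h : Γ} : f * g ≤ f * h ↔ g ≤ h := by
  refine ⟨fun H => ?_, hΓ f g h⟩
  have := hΓ f⁻¹ _ _ H
  rwa [inv_mul_cancel_left, inv_mul_cancel_left] at this

theorem lt_iff (hΓ : LeftInvariant Γ) {f g h : Γ} : f * g < f * h ↔ g < h := by
  rw [← not_le, ← not_le, hΓ.le_iff]

theorem inv_mul_lt_iff (hΓ : LeftInvariant Γ) {f g h : Γ} : f⁻¹ * g < h ↔ g < f * h := by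
  rw [← hΓ.lt_iff (f := f), mul_inv_cancel_left]

theorem lt_inv_mul_iff (hΓ : LeftInvariant Γ) {f g h : Γ} : g < f⁻¹ * h ↔ f * g < h := by
  rw [← hΓ.lt_iff (f := f), mul_inv_cancel_left]

theorem mul_lt_self_iff (hΓ : LeftInvariant Γ) {f g : Γ} : f * g < f ↔ g < 1 := by
  rw [← hΓ.lt_iff (f := f) (g := g), mul_one]

theorem le_mul_self_iff (hΓ : LeftInvariant Γ) {f g : Γ} : f ≤ f * g ↔ 1 ≤ g := by
  rw [← hΓ.le_iff (f := f) (g := 1), mul_one]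

theorem lt_mul_self_iff (hΓ : LeftInvariant Γ) {f g : Γ} : f < f * g ↔ 1 < g := by
  rw [← hΓ.lt_iff (f := f) (g := 1), mul_one]

theorem le_pow_mul (hΓ : LeftInvariant Γ) {x p : Γ} (h : p ≤ x * p) (n : ℕ) : p ≤ x ^ n * p := by
  induction n with
  | zero => simp
  | succ n ih =>
    rw [pow_succ', mul_assoc]
    exact h.trans (hΓ _ _ _ ih)

theorem pow_mul_le (hΓ : LeftInvariant Γ) {x p : Γ} (h : x * p ≤ p) (n : ℕ) : x ^ n * p ≤ p := by
  induction n with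
  | zero => simp
  | succ n ih =>
    rw [pow_succ', mul_assoc]
    exact (hΓ _ _ _ ih).trans h

theorem lt_pow_mul (hΓ : LeftInvariant Γ) {x p : Γ} (h : p < x * p) {n : ℕ} (hn : n ≠ 0) :
    p < x ^ n * p := by
  obtain ⟨n, rfl⟩ := Nat.exists_eq_succ_of_ne_zero hn
  rw [Nat.succ_eq_add_one, pow_succ', mul_assoc]
  exact h.trans_le (hΓ _ _ _ (hΓ.le_pow_mul h.le n))

theorem pow_mul_lt (hΓ : LeftInvariant Γ) {x p : Γ} (h : x * p < p) {n : ℕ} (hn : n ≠ 0) :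
    x ^ n * p < p := by
  obtain ⟨n, rfl⟩ := Nat.exists_eq_succ_of_ne_zero hn
  rw [Nat.succ_eq_add_one, pow_succ', mul_assoc]
  exact (hΓ _ _ _ (hΓ.pow_mul_le h.le n)).trans_lt h

theorem lt_pow_mul_iff (hΓ : LeftInvariant Γ) {x p : Γ} {n : ℕ} (hn : n ≠ 0) :
    p < x ^ n * p ↔ p < x * p :=
  ⟨fun h => not_le.1 fun h' => h.not_ge (hΓ.pow_mul_le h' n), fun h => hΓ.lt_pow_mul h hn⟩

theorem pow_mul_lt_iff (hΓ : LeftInvariant Γ) {x p : Γ} {n : ℕ} (hn : n ≠ 0) :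
    x ^ n * p < p ↔ x * p < p :=
  ⟨fun h => not_le.1 fun h' => h.not_ge (hΓ.le_pow_mul h' n), fun h => hΓ.pow_mul_lt h hn⟩

theorem eq_one_of_pow_eq_one (hΓ : LeftInvariant Γ) {x : Γ} {n : ℕ} (hn : n ≠ 0) (h : x ^ n = 1) :
    x = 1 := by
  have h1 := hΓ.lt_pow_mul_iff (x := x) (p := 1) hn
  have h2 := hΓ.pow_mul_lt_iff (x := x) (p := 1) hn
  rw [h] at h1 h2
  simp only [mul_one, lt_irrefl, false_iff, not_lt] at h1 h2
  exact le_antisymm h1 h2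

end LeftInvariant

namespace PlanarGraph

open Holonomy Real

variable {V E : Type*} {G : PlanarGraph V E} {s : V ⊕ E → ℚ}

theorem polar_periodic (v : V) (ρ a : ℝ) : G.polar v ρ (a + 2 * π) = G.polar v ρ a :=
  G.polar_congr (Circle.exp_add_two_pi a)

theorem exists_polar_mem_generic [Finite E] (G : PlanarGraph V E) (v : V) :
    ∃ a, G.polar v (9 / 8) a ∈ G.generic := by
  by_contra! h
  have hfin : (range (fun e => Circle.exp (G.srcAngle e)) ∪
    range fun e => Circle.exp (G.tgtAngle e)).Finite := (finite_range _).union (finite_range _)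
  have hinf : (Circle.exp '' Ioo 0 1).Infinite := (Ioo_infinite one_pos).image
    ((Circle.exp_injOn_Ico (a := 0) (b := 1) (by linarith [pi_gt_three])).mono Ioo_subset_Ico_self)
  refine hinf (hfin.subset ?_)
  rintro _ ⟨a, -, rfl⟩
  obtain h | ⟨-, e, ⟨-, he⟩ | ⟨-, he⟩⟩ :=
    G.of_polar_not_generic (by norm_num) (by norm_num) (h a)
  · norm_num at h
  · exact Or.inl ⟨e, he.symm⟩
  · exact Or.inr ⟨e, he.symm⟩

variable [Finite V] [Finite E]
  {Γ : Type*} [Group Γ] {H : Holonomy (G.chainmailLink.Surgery s) Γ} {g : ℝ × ℝ → Γ}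

theorem height_turn {v : V} (hg : H.IsSection (G.torusMap s (Sum.inl v)) univ g) {a : ℝ}
    (ha : G.polar v (9 / 8) a ∈ G.generic) :
    G.height s H v g a * ((g (0, 0))⁻¹ * g (0, 2 * π)) = (G.vertexValue s H v)⁻¹ *
      (G.transition s H (G.polar v (9 / 8) a) * G.height s H v g a) := by
  have h := vertex_turn hg ha
  have hm := meridian_mul hg a 0
  rw [zero_add] at hm
  rw [hm] at h
  rw [height, mul_assoc, h, inv_mul_cancel_left]

theorem height_periodic {v : V} (hg : H.IsSection (G.torusMap s (Sum.inl v)) univ g) (a : ℝ) :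
    G.height s H v g (a + 2 * π) = G.height s H v g a * ((g (0, 0))⁻¹ * g (2 * π, 0)) := by
  rw [height, polar_periodic, longitude_mul hg, ← mul_assoc]
  rfl

theorem height_mul (v : V) (g : ℝ × ℝ → Γ) (a : ℝ) (c : Γ) :
    G.height s H v (fun x => g x * c) a = G.height s H v g a * c :=
  (mul_assoc _ _ _).symm

variable [LinearOrder Γ]

theorem meridian_lt_iff (hΓ : LeftInvariant Γ) {v : V}
    (hg : H.IsSection (G.torusMap s (Sum.inl v)) univ g) {a : ℝ}
    (ha : G.polar v (9 / 8) a ∈ G.generic) : (g (0, 0))⁻¹ * g (0, 2 * π) < 1 ↔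
      G.transition s H (G.polar v (9 / 8) a) * G.height s H v g a <
        G.vertexValue s H v * G.height s H v g a := by
  rw [← hΓ.mul_lt_self_iff (f := G.height s H v g a), height_turn hg ha, hΓ.inv_mul_lt_iff]

/-- If the height of a section rises above `p`, it does so where the longitude crosses an edge. -/
theorem exists_jump {v : V} (hg : H.IsSection (G.torusMap s (Sum.inl v)) univ g) {a₁ a₂ : ℝ}
    {p : Γ} (h12 : a₁ ≤ a₂) (h1 : G.polar v (9 / 8) a₁ ∈ G.generic)
    (h2 : G.polar v (9 / 8) a₂ ∈ G.generic) (hp1 : G.height s H v g a₁ ≤ p)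
    (hp2 : p < G.height s H v g a₂) :
    ∃ a, G.polar v (9 / 8) a ∉ G.generic ∧
      (∀ δ > 0, ∃ x ∈ Ioo 0 δ, G.polar v (9 / 8) (a - x) ∈ G.generic ∧
        G.height s H v g (a - x) ≤ p) ∧
      ∃ δ > 0, ∀ x ∈ Ioo 0 δ, G.polar v (9 / 8) (a + x) ∈ G.generic →
        p < G.height s H v g (a + x) := by
  let S : Set ℝ := {a | a ∈ Icc a₁ a₂ ∧ G.polar v (9 / 8) a ∈ G.generic ∧ G.height s H v g a ≤ p}
  have hS1 : a₁ ∈ S := ⟨⟨le_rfl, h12⟩, h1, hp1⟩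
  have hbdd : BddAbove S := ⟨a₂, fun a ha => ha.1.2⟩
  set m := sSup S with hm
  have hm1 : a₁ ≤ m := le_csSup hbdd hS1
  have hm2 : m ≤ a₂ := csSup_le ⟨a₁, hS1⟩ fun a ha => ha.1.2
  have happ : ∀ δ > 0, ∃ a ∈ S, m - δ < a ∧ a ≤ m := by
    intro δ hδ
    obtain ⟨a, ha, hlt⟩ := exists_lt_of_lt_csSup ⟨a₁, hS1⟩ (show m - δ < sSup S by linarith)
    exact ⟨a, ha, hlt, le_csSup hbdd ha⟩
  have hgen : G.polar v (9 / 8) m ∉ G.generic := by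
    intro hgm
    have hc : Continuous fun a => G.polar v (9 / 8) a := by unfold polar; fun_prop
    obtain ⟨ε, hε, hball⟩ := Metric.isOpen_iff.1 (G.isOpen_generic.preimage hc) m hgm
    have hI : ∀ a ∈ Ioo (m - ε) (m + ε), G.polar v (9 / 8) a ∈ G.generic := fun a ha =>
      hball (by rw [Real.ball_eq_Ioo]; exact ha)
    have hconst : ∀ a ∈ Ioo (m - ε) (m + ε), G.height s H v g a ≤ p := by
      intro a ha
      obtain ⟨b, hb, hb1, hb2⟩ := happ ε hε
      rw [height_eq hg (convex_Ioo _ _) hI ha ⟨hb1, by linarith⟩]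
      exact hb.2.2
    rcases hm2.eq_or_lt with h | h
    · have := hconst m ⟨by linarith, by linarith⟩
      rw [h] at this
      exact this.not_gt hp2
    · have hx1 : m < min (m + ε / 2) a₂ := lt_min (by linarith) h
      have hx2 : min (m + ε / 2) a₂ ∈ Ioo (m - ε) (m + ε) :=
        ⟨by linarith, (min_le_left _ _).trans_lt (by linarith)⟩
      have : min (m + ε / 2) a₂ ∈ S := ⟨⟨by linarith, min_le_right _ _⟩, hI _ hx2, hconst _ hx2⟩
      exact (le_csSup hbdd this).not_gt hx1
  have hlt : m < a₂ := lt_of_le_of_ne hm2 fun h => hgen (h ▸ h2)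
  refine ⟨m, hgen, fun δ hδ => ?_, a₂ - m, by linarith, fun x hx hgx => ?_⟩
  · obtain ⟨b, hb, hb1, hb2⟩ := happ δ hδ
    have hne : b ≠ m := fun h => hgen (h ▸ hb.2.1)
    have hlt' := lt_of_le_of_ne hb2 hne
    refine ⟨m - b, ⟨by linarith, by linarith⟩, ?_⟩
    rw [sub_sub_cancel]
    exact hb.2
  · by_contra hle
    have : m + x ∈ S := ⟨⟨by linarith [hx.1], by linarith [hx.2]⟩, hgx, not_lt.1 hle⟩
    have := le_csSup hbdd this
    linarith [hx.1]

theorem exists_jump_edge (hΓ : LeftInvariant Γ) {v : V}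
    (hg : H.IsSection (G.torusMap s (Sum.inl v)) univ g) {a₁ a₂ : ℝ}
    {p : Γ} (h12 : a₁ ≤ a₂) (h1 : G.polar v (9 / 8) a₁ ∈ G.generic)
    (h2 : G.polar v (9 / 8) a₂ ∈ G.generic) (hp1 : G.height s H v g a₁ ≤ p)
    (hp2 : p < G.height s H v g a₂) : ∃ e q,
      ((g (0, 0))⁻¹ * g (0, 2 * π) < 1 → G.sideValue s H e * q < G.vertexValue s H v * q) ∧
      ((v = G.src e ∧ G.edgeMonodromy s H e * q ≤ p ∧ p < q) ∨
        (v = G.tgt e ∧ q ≤ p ∧ p < G.edgeMonodromy s H e * q)) := by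
  obtain ⟨a, ha, hl, δ, hδ, hr⟩ := exists_jump hg h12 h1 h2 hp1 hp2
  obtain h | ⟨-, e, ⟨rfl, he⟩ | ⟨rfl, he⟩⟩ := G.of_polar_not_generic (by norm_num) (by norm_num) ha
  · norm_num at h
  · obtain ⟨q, ε, hε, hc⟩ := crossing_src hg he
    obtain ⟨x, hx, hx1, hx2⟩ := hl ε hε
    have hy : min δ ε / 2 ∈ Ioo 0 (min δ ε) :=
      ⟨by have := lt_min hδ hε; linarith, by have := lt_min hδ hε; linarith⟩
    obtain ⟨⟨c1, c2, c3⟩, -⟩ := hc _ ⟨hy.1, hy.2.trans_le (min_le_right _ _)⟩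
    have hy2 := hr _ ⟨hy.1, hy.2.trans_le (min_le_left _ _)⟩ c1
    rw [(hc x hx).2.2] at hx2
    refine ⟨e, q, fun hlt => ?_, Or.inl ⟨rfl, hx2, c3 ▸ hy2⟩⟩
    have := (meridian_lt_iff hΓ hg c1).1 hlt
    rwa [c2, c3] at this
  · obtain ⟨q, ε, hε, hc⟩ := crossing_tgt hg he
    obtain ⟨x, hx, hx1, hx2⟩ := hl ε hε
    have hy : min δ ε / 2 ∈ Ioo 0 (min δ ε) :=
      ⟨by have := lt_min hδ hε; linarith, by have := lt_min hδ hε; linarith⟩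
    obtain ⟨-, c1, c3⟩ := hc _ ⟨hy.1, hy.2.trans_le (min_le_right _ _)⟩
    have hy2 := hr _ ⟨hy.1, hy.2.trans_le (min_le_left _ _)⟩ c1
    obtain ⟨d1, d2, d3⟩ := (hc x hx).1
    rw [d3] at hx2
    refine ⟨e, q, fun hlt => ?_, Or.inr ⟨rfl, hx2, c3 ▸ hy2⟩⟩
    have := (meridian_lt_iff hΓ hg d1).1 hlt
    rwa [d2, d3] at this

/-- Sections over the torus of the source of an edge, with given height on the left of the edge. -/
theorem exists_section_src (hΓ : LeftInvariant Γ) (e : E) (q : Γ) :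
    ∃ g, H.IsSection (G.torusMap s (Sum.inl (G.src e))) univ g ∧
      ((g (0, 0))⁻¹ * g (0, 2 * π) < 1 ↔
        G.sideValue s H e * q < G.vertexValue s H (G.src e) * q) ∧
      ∃ a₁ a₂, a₁ ≤ a₂ ∧ G.polar (G.src e) (9 / 8) a₁ ∈ G.generic ∧
        G.polar (G.src e) (9 / 8) a₂ ∈ G.generic ∧ G.height s H (G.src e) g a₁ = q ∧
        G.height s H (G.src e) g a₂ =
          G.edgeMonodromy s H e * q * ((g (0, 0))⁻¹ * g (2 * π, 0)) := by
  obtain ⟨g₀, hg₀⟩ := G.exists_torusSection (H := H) (Sum.inl (G.src e))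
  obtain ⟨p, ε, hε, hc⟩ := crossing_src hg₀ (a := G.srcAngle e) rfl
  have hg := hg₀.mul_right (p⁻¹ * q)
  have hp := pi_pos
  have hy0 : 0 < min ε π := lt_min hε hp
  have hy : min ε π / 2 ∈ Ioo 0 ε := ⟨by linarith, by have := min_le_left ε π; linarith⟩
  obtain ⟨⟨c1, c2, c3⟩, c4, c5⟩ := hc _ hy
  have e1 : G.height s H (G.src e) (fun x => g₀ x * (p⁻¹ * q)) (G.srcAngle e + min ε π / 2) =
      q := by
    rw [height_mul, c3, mul_inv_cancel_left]
  refine ⟨_, hg, ?_, _, G.srcAngle e - min ε π / 2 + 2 * π, ?_, c1, ?_, e1, ?_⟩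
  · rw [meridian_lt_iff hΓ hg c1, c2, e1]
  · have := min_le_right ε π
    linarith
  · rwa [polar_periodic]
  · rw [height_periodic hg, height_mul, c5, mul_assoc _ p, mul_inv_cancel_left]

/-- Sections over the torus of the target of an edge, with given height on the left of the edge. -/
theorem exists_section_tgt (hΓ : LeftInvariant Γ) (e : E) (q : Γ) :
    ∃ g, H.IsSection (G.torusMap s (Sum.inl (G.tgt e))) univ g ∧
      ((g (0, 0))⁻¹ * g (0, 2 * π) < 1 ↔
        G.sideValue s H e * q < G.vertexValue s H (G.tgt e) * q) ∧
      ∃ a₁ a₂, a₁ ≤ a₂ ∧ G.polar (G.tgt e) (9 / 8) a₁ ∈ G.generic ∧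
        G.polar (G.tgt e) (9 / 8) a₂ ∈ G.generic ∧
        G.height s H (G.tgt e) g a₁ = G.edgeMonodromy s H e * q ∧
        G.height s H (G.tgt e) g a₂ = q * ((g (0, 0))⁻¹ * g (2 * π, 0)) := by
  obtain ⟨g₀, hg₀⟩ := G.exists_torusSection (H := H) (Sum.inl (G.tgt e))
  obtain ⟨p, ε, hε, hc⟩ := crossing_tgt hg₀ (a := G.tgtAngle e) rfl
  have hg := hg₀.mul_right (p⁻¹ * q)
  have hp := pi_pos
  have hy0 : 0 < min ε π := lt_min hε hp
  have hy : min ε π / 2 ∈ Ioo 0 ε := ⟨by linarith, by have := min_le_left ε π; linarith⟩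
  obtain ⟨⟨c1, c2, c3⟩, c4, c5⟩ := hc _ hy
  have e1 : G.height s H (G.tgt e) (fun x => g₀ x * (p⁻¹ * q)) (G.tgtAngle e - min ε π / 2) =
      q := by
    rw [height_mul, c3, mul_inv_cancel_left]
  refine ⟨_, hg, ?_, G.tgtAngle e + min ε π / 2, G.tgtAngle e - min ε π / 2 + 2 * π, ?_, c4, ?_,
    ?_, ?_⟩
  · rw [meridian_lt_iff hΓ hg c1, c2, e1]
  · have := min_le_right ε π
    linarith
  · rwa [polar_periodic]
  · rw [height_mul, c5, mul_assoc _ p, mul_inv_cancel_left]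
  · rw [height_periodic hg, e1]

theorem edge_order (hΓ : LeftInvariant Γ) {e : E} (he : s (Sum.inr e) < 0) (p : Γ) :
    (p < G.edgeMonodromy s H e * p ↔
      G.vertexValue s H (G.tgt e) * p < G.vertexValue s H (G.src e) * p) ∧
    (G.edgeMonodromy s H e * p < p ↔
      G.vertexValue s H (G.src e) * p < G.vertexValue s H (G.tgt e) * p) := by
  have h := G.edge_relation (H := H) e
  have hn := Rat.num_neg.2 he
  obtain ⟨n, hn'⟩ : ∃ n : ℕ, (s (Sum.inr e)).num = -(n : ℤ) :=
    ⟨(s (Sum.inr e)).num.natAbs, by omega⟩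
  have hn0 : n ≠ 0 := by
    rintro rfl
    rw [hn'] at hn
    simp at hn
  rw [hn', zpow_neg, mul_inv_eq_one, zpow_natCast] at h
  have hd := (s (Sum.inr e)).den_ne_zero
  rw [← hΓ.lt_pow_mul_iff hn0, ← hΓ.pow_mul_lt_iff hn0, ← h, hΓ.lt_pow_mul_iff hd,
    hΓ.pow_mul_lt_iff hd, mul_assoc, hΓ.lt_inv_mul_iff, hΓ.inv_mul_lt_iff]
  exact ⟨Iff.rfl, Iff.rfl⟩

theorem one_le_longitude (hΓ : LeftInvariant Γ) {v : V} (hv : 0 ≤ s (Sum.inl v))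
    (hg : H.IsSection (G.torusMap s (Sum.inl v)) univ g)
    (hlt : (g (0, 0))⁻¹ * g (0, 2 * π) < 1) : 1 ≤ (g (0, 0))⁻¹ * g (2 * π, 0) := by
  have h := surgery_relation hg
  obtain ⟨n, hn⟩ := Int.eq_ofNat_of_zero_le (Rat.num_nonneg.2 hv)
  rw [hn, zpow_natCast] at h
  by_contra hl
  have h1 := hΓ.pow_mul_lt (p := 1) (by simpa using hl) (s (Sum.inl v)).den_ne_zero
  have h2 := hΓ.pow_mul_le (p := 1) (by simpa using hlt.le) n
  rw [mul_one] at h1 h2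
  refine h1.not_ge ?_
  have := hΓ (((g (0, 0))⁻¹ * g (2 * π, 0)) ^ (s (Sum.inl v)).den) _ _ h2
  rwa [h, mul_one] at this

theorem one_lt_longitude (hΓ : LeftInvariant Γ) {v : V} (hv : 0 < s (Sum.inl v))
    (hg : H.IsSection (G.torusMap s (Sum.inl v)) univ g)
    (hlt : (g (0, 0))⁻¹ * g (0, 2 * π) < 1) : 1 < (g (0, 0))⁻¹ * g (2 * π, 0) := by
  refine lt_of_le_of_ne (one_le_longitude hΓ hv.le hg hlt) fun h1 => ?_
  have h := surgery_relation hg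
  have hp := Rat.num_pos.2 hv
  obtain ⟨n, hn⟩ := Int.eq_ofNat_of_zero_le hp.le
  rw [hn, zpow_natCast, ← h1, one_pow, one_mul] at h
  exact hlt.ne (hΓ.eq_one_of_pow_eq_one (by
    rintro rfl
    rw [hn] at hp
    simp at hp) h)

/-- A section over the torus of `v` which decreases along the meridian rises above `p` along the
longitude. -/
def Rises (G : PlanarGraph V E) (s : V ⊕ E → ℚ) (H : Holonomy (G.chainmailLink.Surgery s) Γ) (p : Γ)
    (v : V) : Prop :=
  ∃ g, H.IsSection (G.torusMap s (Sum.inl v)) univ g ∧ (g (0, 0))⁻¹ * g (0, 2 * π) < 1 ∧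
    ∃ a₁ a₂, a₁ ≤ a₂ ∧ G.polar v (9 / 8) a₁ ∈ G.generic ∧ G.polar v (9 / 8) a₂ ∈ G.generic ∧
      G.height s H v g a₁ ≤ p ∧ p < G.height s H v g a₂

theorem Rises.climb (hΓ : LeftInvariant Γ) (hv : ∀ v, 0 ≤ s (Sum.inl v))
    (he : ∀ e, s (Sum.inr e) < 0) {p : Γ} {v : V} (h : Rises G s H p v) :
    ∃ w, G.vertexValue s H v * p < G.vertexValue s H w * p ∧ Rises G s H p w := by
  obtain ⟨g, hg, hlt, a₁, a₂, h12, h1, h2, hp1, hp2⟩ := h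
  obtain ⟨e, q, hq, ⟨rfl, hq1, hq2⟩ | ⟨rfl, hq1, hq2⟩⟩ := exists_jump_edge hΓ hg h12 h1 h2 hp1 hp2
  · refine ⟨G.tgt e, ((edge_order hΓ (he e) p).2).1 ((hΓ.lt_iff.2 hq2).trans_le hq1), ?_⟩
    obtain ⟨g', hg', hm, b₁, b₂, hb, g1, g2, e1, e2⟩ := exists_section_tgt (H := H) hΓ e q
    have hm' := hm.2 ((hq hlt).trans (((edge_order hΓ (he e) q).2).1 (hq1.trans_lt hq2)))
    refine ⟨g', hg', hm', b₁, b₂, hb, g1, g2, e1.le.trans hq1, ?_⟩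
    rw [e2]
    exact hq2.trans_le (hΓ.le_mul_self_iff.2 (one_le_longitude hΓ (hv _) hg' hm'))
  · refine ⟨G.src e, ((edge_order hΓ (he e) p).1).1 (hq2.trans_le (hΓ _ _ _ hq1)), ?_⟩
    obtain ⟨g', hg', hm, b₁, b₂, hb, g1, g2, e1, e2⟩ := exists_section_src (H := H) hΓ e q
    have hm' := hm.2 ((hq hlt).trans (((edge_order hΓ (he e) q).1).1 (hq1.trans_lt hq2)))
    refine ⟨g', hg', hm', b₁, b₂, hb, g1, g2, e1.le.trans hq1, ?_⟩
    rw [e2]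
    exact hq2.trans_le (hΓ.le_mul_self_iff.2 (one_le_longitude hΓ (hv _) hg' hm'))

theorem not_rises (hΓ : LeftInvariant Γ) (hv : ∀ v, 0 ≤ s (Sum.inl v))
    (he : ∀ e, s (Sum.inr e) < 0) (p : Γ) (v : V) : ¬ Rises G s H p v := by
  intro h
  obtain ⟨m, hm, hmax⟩ := (toFinite {v | Rises G s H p v}).exists_maximalFor
    (fun v => G.vertexValue s H v * p) _ ⟨v, h⟩
  obtain ⟨w, hw, hr⟩ := hm.climb hΓ hv he
  exact hw.not_ge (hmax hr hw.le)

theorem one_le_meridian (hΓ : LeftInvariant Γ) (hv : ∀ v, 0 ≤ s (Sum.inl v))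
    (he : ∀ e, s (Sum.inr e) < 0) {v : V} (hpos : 0 < s (Sum.inl v))
    (hg : H.IsSection (G.torusMap s (Sum.inl v)) univ g) : 1 ≤ (g (0, 0))⁻¹ * g (0, 2 * π) := by
  by_contra! hlt
  obtain ⟨a, ha⟩ := G.exists_polar_mem_generic v
  refine not_rises (H := H) hΓ hv he (G.height s H v g a) v ⟨g, hg, hlt, a, a + 2 * π,
    by linarith [pi_pos], ha, by rwa [polar_periodic], le_rfl, ?_⟩
  rw [height_periodic hg]
  exact hΓ.lt_mul_self_iff.2 (one_lt_longitude hΓ hpos hg hlt)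

theorem meridian_eq_one (hΓ : LeftInvariant Γ) (hv : ∀ v, 0 ≤ s (Sum.inl v))
    (he : ∀ e, s (Sum.inr e) < 0) {v : V} (hpos : 0 < s (Sum.inl v))
    (hg : H.IsSection (G.torusMap s (Sum.inl v)) univ g) : (g (0, 0))⁻¹ * g (0, 2 * π) = 1 := by
  refine le_antisymm ?_ (one_le_meridian hΓ hv he hpos hg)
  let dual : LinearOrder Γ := inferInstanceAs (LinearOrder Γᵒᵈ)
  have hΓ' : @LeftInvariant Γ _ dual := fun f g h hgh => hΓ f h g hgh
  exact @one_le_meridian V E G s _ _ Γ _ H g dual hΓ' hv he v hpos hg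

theorem longitude_eq_one (hΓ : LeftInvariant Γ) (hv : ∀ v, 0 ≤ s (Sum.inl v))
    (he : ∀ e, s (Sum.inr e) < 0) {v : V}
    (hg : H.IsSection (G.torusMap s (Sum.inl v)) univ g) : (g (0, 0))⁻¹ * g (2 * π, 0) = 1 := by
  have h := surgery_relation hg
  rcases (hv v).eq_or_lt with h0 | hpos
  · rw [← h0] at h
    simpa using h
  · rw [meridian_eq_one hΓ hv he hpos hg, one_zpow, mul_one] at h
    exact hΓ.eq_one_of_pow_eq_one (s (Sum.inl v)).den_ne_zero h

theorem eq_of_local_max (hΓ : LeftInvariant Γ) (hv : ∀ v, 0 ≤ s (Sum.inl v))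
    (he : ∀ e, s (Sum.inr e) < 0) (p : Γ) {v : V}
    (h1 : ∀ e, G.src e = v → G.vertexValue s H (G.tgt e) * p ≤ G.vertexValue s H v * p)
    (h2 : ∀ e, G.tgt e = v → G.vertexValue s H (G.src e) * p ≤ G.vertexValue s H v * p) (e : E) :
    (G.src e = v → G.vertexValue s H (G.tgt e) * p = G.vertexValue s H v * p) ∧
      (G.tgt e = v → G.vertexValue s H (G.src e) * p = G.vertexValue s H v * p) := by
  have key : ∀ g, H.IsSection (G.torusMap s (Sum.inl v)) univ g → ∀ a₁ a₂, a₁ ≤ a₂ →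
      G.polar v (9 / 8) a₁ ∈ G.generic → G.polar v (9 / 8) a₂ ∈ G.generic →
      G.height s H v g a₁ ≤ p → ¬ p < G.height s H v g a₂ := by
    intro g hg a₁ a₂ h12 g1 g2 hp1 hp2
    obtain ⟨e, q, -, ⟨hve, hq1, hq2⟩ | ⟨hve, hq1, hq2⟩⟩ := exists_jump_edge hΓ hg h12 g1 g2 hp1 hp2
    · have := ((edge_order (H := H) hΓ (he e) p).2).1 ((hΓ.lt_iff.2 hq2).trans_le hq1)
      rw [← hve] at this
      exact this.not_ge (h1 e hve.symm)
    · have := ((edge_order (H := H) hΓ (he e) p).1).1 (hq2.trans_le (hΓ _ _ _ hq1))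
      rw [← hve] at this
      exact this.not_ge (h2 e hve.symm)
  constructor
  · rintro rfl
    refine le_antisymm (h1 e rfl) (not_lt.1 fun hlt => ?_)
    obtain ⟨g, hg, -, b₁, b₂, hb, g1, g2, e1, e2⟩ := exists_section_src (H := H) hΓ e p
    refine key g hg b₁ b₂ hb g1 g2 e1.le ?_
    rw [e2, longitude_eq_one hΓ hv he hg, mul_one]
    exact ((edge_order hΓ (he e) p).1).2 hlt
  · rintro rfl
    refine le_antisymm (h2 e rfl) (not_lt.1 fun hlt => ?_)
    obtain ⟨g, hg, -, b₁, b₂, hb, g1, g2, e1, e2⟩ :=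
      exists_section_tgt (H := H) hΓ e ((G.edgeMonodromy s H e)⁻¹ * p)
    rw [mul_inv_cancel_left] at e1
    refine key g hg b₁ b₂ hb g1 g2 e1.le ?_
    rw [e2, longitude_eq_one hΓ hv he hg, mul_one, hΓ.lt_inv_mul_iff]
    exact ((edge_order hΓ (he e) p).2).2 hlt

/-- The transition elements at the ends of an edge agree. -/
theorem vertexValue_eq (hΓ : LeftInvariant Γ) (hv : ∀ v, 0 ≤ s (Sum.inl v))
    (he : ∀ e, s (Sum.inr e) < 0) {v w : V} (h : G.Joined v w) :
    G.vertexValue s H v = G.vertexValue s H w := by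
  obtain ⟨m, hm, hmax⟩ := (toFinite {w | G.Joined v w}).exists_maximalFor
    (fun w => G.vertexValue s H w * 1) _ ⟨v, Relation.EqvGen.refl v⟩
  have hmax' : ∀ x, G.Joined m x →
      G.vertexValue s H x * 1 ≤ G.vertexValue s H m * 1 := by
    intro x hx
    by_contra! hlt
    exact hlt.not_ge (hmax (Relation.EqvGen.trans _ _ _ hm hx) hlt.le)
  have hedge : ∀ e, G.Joined (G.src e) (G.tgt e) := fun e => Relation.EqvGen.rel _ _ ⟨e, rfl, rfl⟩
  have key : ∀ x y, G.Joined x y → G.Joined m x →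
      (G.vertexValue s H x * 1 = G.vertexValue s H m * 1 ↔
        G.vertexValue s H y * 1 = G.vertexValue s H m * 1) := by
    intro x y hxy
    induction hxy with
    | rel x y hxy =>
      obtain ⟨e, rfl, rfl⟩ := hxy
      intro hx
      have hloc : ∀ z, G.Joined m z → G.vertexValue s H z * 1 = G.vertexValue s H m * 1 →
          (G.src e = z → G.vertexValue s H (G.tgt e) * 1 = G.vertexValue s H z * 1) ∧
          (G.tgt e = z → G.vertexValue s H (G.src e) * 1 = G.vertexValue s H z * 1) := by
        intro z hz hze
        refine eq_of_local_max hΓ hv he 1 ?_ ?_ e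
        · rintro e' rfl
          rw [hze]
          exact hmax' _ (Relation.EqvGen.trans _ _ _ hz (hedge e'))
        · rintro e' rfl
          rw [hze]
          exact hmax' _ (Relation.EqvGen.trans _ _ _ hz (Relation.EqvGen.symm _ _ (hedge e')))
      exact ⟨fun h => ((hloc _ hx h).1 rfl).trans h, fun h =>
        ((hloc _ (Relation.EqvGen.trans _ _ _ hx (hedge e)) h).2 rfl).trans h⟩
    | refl x => exact fun _ => Iff.rfl
    | symm x y hxy ih =>
      exact fun hy => (ih (Relation.EqvGen.trans _ _ _ hy (Relation.EqvGen.symm _ _ hxy))).symm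
    | trans x y z hxy hyz ih1 ih2 =>
      exact fun hx => (ih1 hx).trans (ih2 (Relation.EqvGen.trans _ _ _ hx hxy))
  have e1 := (key m v (Relation.EqvGen.symm _ _ hm) (Relation.EqvGen.refl m)).1 rfl
  have e2 := (key m w (Relation.EqvGen.trans _ _ _ (Relation.EqvGen.symm _ _ hm) h)
    (Relation.EqvGen.refl m)).1 rfl
  simpa using e1.trans e2.symm

theorem edgeMonodromy_eq_one (hΓ : LeftInvariant Γ) (hv : ∀ v, 0 ≤ s (Sum.inl v))
    (he : ∀ e, s (Sum.inr e) < 0) (e : E) : G.edgeMonodromy s H e = 1 := by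
  have h := vertexValue_eq (H := H) hΓ hv he (Relation.EqvGen.rel _ _ ⟨e, rfl, rfl⟩ :
    G.Joined (G.src e) (G.tgt e))
  have ho := edge_order (H := H) hΓ (he e) 1
  rw [h] at ho
  simp only [mul_one, lt_irrefl, iff_false, not_lt] at ho
  exact le_antisymm ho.1 ho.2

/-- At a vertex of positive slope, the transition element takes the same value outside the disc. -/
theorem transition_eq_vertexValue (hΓ : LeftInvariant Γ) (hv : ∀ v, 0 ≤ s (Sum.inl v))
    (he : ∀ e, s (Sum.inr e) < 0) {v : V} (hpos : 0 < s (Sum.inl v)) {a : ℝ}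
    (ha : G.polar v (9 / 8) a ∈ G.generic) :
    G.transition s H (G.polar v (9 / 8) a) = G.vertexValue s H v := by
  obtain ⟨g, hg⟩ := G.exists_torusSection (H := H) (Sum.inl v)
  have h := height_turn hg ha
  rw [meridian_eq_one hΓ hv he hpos hg, mul_one, ← mul_assoc, right_eq_mul,
    inv_mul_eq_one] at h
  exact h.symm

end PlanarGraph

/-- The outside of a ball is path connected. -/
theorem isPathConnected_norm_gt {F : Type*} [NormedAddCommGroup F] [NormedSpace ℝ F]
    (h : 1 < Module.rank ℝ F) {R : ℝ} (hR : 0 ≤ R) : IsPathConnected {x : F | R < ‖x‖} := by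
  have hne : ∀ x ∈ ({0}ᶜ : Set F), ‖x‖ ≠ 0 := fun x hx => norm_ne_zero_iff.2 hx
  have hc : ContinuousOn (fun x : F => ((R + ‖x‖) / ‖x‖) • x) {0}ᶜ :=
    ((continuousOn_const.add continuousOn_id.norm).div continuousOn_id.norm hne).smul
      continuousOn_id
  convert (isPathConnected_compl_singleton_of_one_lt_rank h (0 : F)).image' hc using 1
  ext y
  constructor
  · intro hy
    have hy : R < ‖y‖ := hy
    have hpos : 0 < ‖y‖ := hR.trans_lt hy
    have hc : 0 < (‖y‖ - R) / ‖y‖ := div_pos (by linarith) hpos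
    have hn : ‖((‖y‖ - R) / ‖y‖) • y‖ = ‖y‖ - R := by
      rw [norm_smul, Real.norm_eq_abs, abs_of_pos hc, div_mul_cancel₀ _ hpos.ne']
    refine ⟨((‖y‖ - R) / ‖y‖) • y, ?_, ?_⟩
    · exact smul_ne_zero hc.ne' (norm_pos_iff.1 hpos)
    · dsimp only
      rw [hn, smul_smul]
      have : (R + (‖y‖ - R)) / (‖y‖ - R) * ((‖y‖ - R) / ‖y‖) = 1 := by
        have : ‖y‖ - R ≠ 0 := by linarith
        field_simp
        ring
      rw [this, one_smul]
  · rintro ⟨x, hx, rfl⟩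
    have hpos : 0 < ‖x‖ := norm_pos_iff.2 hx
    change R < ‖((R + ‖x‖) / ‖x‖) • x‖
    rw [norm_smul, Real.norm_eq_abs, abs_of_pos (div_pos (by linarith) hpos),
      div_mul_cancel₀ _ hpos.ne']
    linarith

namespace PlanarGraph

open Holonomy

variable {V E : Type*} (G : PlanarGraph V E)

/-- The complement of the closed discs of the vertices. -/
def outer : Set ℂ := {z | ∀ v, G.radius v < dist z (G.center v)}

/-- A map of the plane which blows up the centres of the discs of the vertices to these discs. -/
noncomputable def blowUp [Fintype V] (z : ℂ) : ℂ :=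
  z + ∑ v, (max 0 (G.radius v - 4 / 5 * dist z (G.center v)) / dist z (G.center v)) •
    (z - G.center v)

theorem blowUp_of_far [Fintype V] {z : ℂ} (h : ∀ v, 5 / 4 * G.radius v ≤ dist z (G.center v)) :
    G.blowUp z = z := by
  rw [blowUp, Finset.sum_eq_zero, add_zero]
  intro v _
  rw [max_eq_left (by linarith [h v]), zero_div, zero_smul]

theorem blowUp_of_near [Fintype V] {z : ℂ} {v : V} (h : dist z (G.center v) < 5 / 4 * G.radius v)
    (hz : z ≠ G.center v) : G.blowUp z = G.center v +
      ((G.radius v + dist z (G.center v) / 5) / dist z (G.center v)) • (z - G.center v) := by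
  have hd : 0 < dist z (G.center v) := dist_pos.2 hz
  rw [blowUp, Finset.sum_eq_single v]
  · rw [max_eq_right (by linarith)]
    have : (G.radius v + dist z (G.center v) / 5) / dist z (G.center v) = 1 +
        (G.radius v - 4 / 5 * dist z (G.center v)) / dist z (G.center v) := by
      field_simp
      ring
    rw [this, add_smul, one_smul]
    ring
  · intro w _ hw
    have : 5 / 4 * G.radius w ≤ dist z (G.center w) := by
      by_contra! hlt
      exact hw (G.eq_of_dist_le hlt.le h.le)
    rw [max_eq_left (by linarith), zero_div, zero_smul]
  · simp

theorem isPathConnected_outer [Finite V] : IsPathConnected G.outer := by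
  obtain ⟨_⟩ := nonempty_fintype V
  have hcont : ContinuousOn G.blowUp (range G.center)ᶜ := by
    refine continuousOn_id.add (continuousOn_finsetSum _ fun v _ => ?_)
    have h1 : ContinuousOn (fun z => max 0 (G.radius v - 4 / 5 * dist z (G.center v)) /
        dist z (G.center v)) (range G.center)ᶜ := ContinuousOn.div (by fun_prop) (by fun_prop)
      fun z hz => dist_ne_zero.2 fun h => hz ⟨v, h.symm⟩
    exact h1.smul (by fun_prop : ContinuousOn (fun z => z - G.center v) _)
  convert ((countable_range G.center).isPathConnected_compl_of_one_lt_rank (by simp)).image' hcont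
    using 1
  ext y
  constructor
  · intro hy
    by_cases h : ∃ v, dist y (G.center v) < 5 / 4 * G.radius v
    · obtain ⟨v, hv⟩ := h
      have hr := G.radius_pos v
      have hlt := hy v
      set d := dist y (G.center v) with hd
      have hd0 : 0 < d := hr.trans hlt
      have hk : 0 < 5 * (d - G.radius v) / d := div_pos (by linarith) hd0
      have hdz : dist (G.center v + (5 * (d - G.radius v) / d) • (y - G.center v)) (G.center v) =
          5 * (d - G.radius v) := by
        rw [dist_self_add_left, norm_smul, ← dist_eq_norm, ← hd, Real.norm_eq_abs, abs_of_pos hk,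
          div_mul_cancel₀ _ hd0.ne']
      have hne : G.center v + (5 * (d - G.radius v) / d) • (y - G.center v) ≠ G.center v := by
        rw [← dist_pos, hdz]
        linarith
      refine ⟨G.center v + (5 * (d - G.radius v) / d) • (y - G.center v), ?_, ?_⟩
      · rintro ⟨w, hw⟩
        have hrw := G.radius_pos w
        have : w = v := G.eq_of_dist_le (z := G.center w) (by rw [dist_self]; positivity)
          (by rw [hw, hdz]; linarith)
        exact hne (by rw [← hw, this])
      · rw [G.blowUp_of_near (v := v) (z := G.center v + (5 * (d - G.radius v) / d) •
          (y - G.center v)) (by rw [hdz]; linarith) hne, hdz, add_sub_cancel_left, smul_smul]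
        have : (G.radius v + 5 * (d - G.radius v) / 5) / (5 * (d - G.radius v)) *
            (5 * (d - G.radius v) / d) = 1 := by
          have : d - G.radius v ≠ 0 := by linarith
          field_simp
          ring
        rw [this, one_smul, add_sub_cancel]
    · push Not at h
      refine ⟨y, ?_, G.blowUp_of_far h⟩
      rintro ⟨v, hv⟩
      have := hy v
      rw [← hv, dist_self] at this
      exact this.not_gt (G.radius_pos v)
  · rintro ⟨z, hz, rfl⟩ w
    by_cases h : ∃ v, dist z (G.center v) < 5 / 4 * G.radius v
    · obtain ⟨v, hv⟩ := h
      have hne : z ≠ G.center v := fun h => hz ⟨v, h.symm⟩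
      have hr := G.radius_pos v
      have hd : 0 < dist z (G.center v) := dist_pos.2 hne
      have hk : 0 < (G.radius v + dist z (G.center v) / 5) / dist z (G.center v) := by positivity
      have e : dist (G.blowUp z) (G.center v) = G.radius v + dist z (G.center v) / 5 := by
        rw [G.blowUp_of_near hv hne, dist_self_add_left, norm_smul, ← dist_eq_norm,
          Real.norm_eq_abs, abs_of_pos hk, div_mul_cancel₀ _ hd.ne']
      by_cases hwv : w = v
      · rw [hwv, e]
        linarith
      · by_contra! hle
        have hrw := G.radius_pos w
        exact hwv (G.eq_of_dist_le (z := G.blowUp z) (by linarith) (by rw [e]; linarith))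
    · push Not at h
      have := G.radius_pos w
      rw [G.blowUp_of_far h]
      linarith [h w]

variable {G} [Finite V] [Finite E] {s : V ⊕ E → ℚ} {Γ : Type*} [Group Γ]
  {H : Holonomy (G.chainmailLink.Surgery s) Γ}

theorem transition_band_eq_sideValue (hx : ∀ e, G.edgeMonodromy s H e = 1) {e : E} {t x : ℝ}
    (ht : |t| < 1 / 2) (hx1 : x ∈ Ioo (-1 / 4 : ℝ) (1 / 4)) (h : x ≠ 0) :
    G.transition s H (G.band e (t, x)) = G.sideValue s H e := by
  rcases h.lt_or_gt with h | h
  · rw [G.transition_band s H (Or.inr rfl) ht hx1 (by linarith), sideValue, downCoeff_eq (hx e),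
      inv_mul_eq_one.1 (hx e)]
  · rw [G.transition_band s H (Or.inl rfl) ht hx1 (by linarith), sideValue]

/-- Without monodromy around the edges, the transition element is constant outside the discs. -/
theorem transition_eq_of_outer (hx : ∀ e, G.edgeMonodromy s H e = 1) {z w : ℂ}
    (hz : z ∈ G.generic) (hz' : z ∈ G.outer) (hw : w ∈ G.generic) (hw' : w ∈ G.outer) :
    G.transition s H z = G.transition s H w := by
  classical
  let T : ℂ → Γ := fun z => if z ∈ G.generic then G.transition s H z else
    if h : ∃ e t, |t| < 1 / 2 ∧ z = G.band e (t, 0) then G.sideValue s H h.choose else 1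
  have hT : ∀ e t x, |t| < 1 / 2 → x ∈ Ioo (-1 / 4 : ℝ) (1 / 4) →
      T (G.band e (t, x)) = G.sideValue s H e := by
    intro e t x ht hx'
    obtain ⟨ht1, ht2⟩ := abs_lt.1 ht
    have hr : (t, x) ∈ closedRect := ⟨⟨by dsimp only; linarith, by dsimp only; linarith⟩,
      ⟨hx'.1.le, hx'.2.le⟩⟩
    by_cases h0 : x = 0
    · subst h0
      have hng : G.band e (t, 0) ∉ G.generic := by
        rw [mem_generic_iff, not_and_or]
        right
        push Not
        exact ⟨e, t, ⟨by linarith, by linarith⟩, rfl⟩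
      have hex : ∃ e' t', |t'| < 1 / 2 ∧ G.band e (t, 0) = G.band e' (t', 0) := ⟨e, t, ht, rfl⟩
      simp only [T, if_neg hng, dif_pos hex]
      obtain ⟨t', ht', hb⟩ := hex.choose_spec
      obtain ⟨h1, h2⟩ := abs_lt.1 ht'
      rw [← (G.band_injective _ _ _ hr (t', 0)
        (mem_rect_zero (by linarith) (by linarith)) hb).1]
    · have hg : G.band e (t, x) ∈ G.generic :=
        G.band_mem_generic hr (by linarith) (by linarith) (Or.inl h0)
      simp only [T, if_pos hg]
      exact transition_band_eq_sideValue hx ht hx' h0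
  have hloc : IsLocallyConstant fun z : G.outer => T z := by
    rw [IsLocallyConstant.iff_eventually_eq]
    rintro ⟨y, hy⟩
    refine continuous_subtype_val.continuousAt.eventually (p := fun x => T x = T y) ?_
    by_cases hg : y ∈ G.generic
    · obtain ⟨ε, hε, hb⟩ := Metric.isOpen_iff.1 G.isOpen_generic y hg
      filter_upwards [Metric.ball_mem_nhds y hε] with x hx
      simp only [T, if_pos hg, if_pos (hb hx)]
      exact G.transition_eq s H hb ((convex_ball y ε).isPathConnected ⟨y, Metric.mem_ball_self hε⟩)
        hx (Metric.mem_ball_self hε)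
    · have hy' := hg
      rw [mem_generic_iff, not_and_or] at hy'
      push Not at hy'
      obtain ⟨v, hv⟩ | ⟨e, t, ht, rfl⟩ := hy'
      · exact absurd hv (hy v).ne'
      have hr := mem_rect_zero (t := t) (by linarith [ht.1]) (by linarith [ht.2])
      have ht' : |t| < 1 / 2 := by
        by_contra! hle
        rcases le_abs.1 hle with h | h
        · have h1 := G.dist_band_tgt e ⟨by linarith, hr.1.2⟩ hr.2
          have h2 := hy (G.tgt e)
          have := G.radius_pos (G.tgt e)
          nlinarith
        · have h1 := G.dist_band_src e ⟨hr.1.1, by linarith⟩ hr.2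
          have h2 := hy (G.src e)
          have := G.radius_pos (G.src e)
          nlinarith
      have hopen : IsOpen (G.band e '' (Ioo (-1 / 2) (1 / 2) ×ˢ Ioo (-1 / 4) (1 / 4))) :=
        G.isOpen_image_band e (isOpen_Ioo.prod isOpen_Ioo)
          (prod_mono (Ioo_subset_Ioo (by norm_num) (by norm_num)) le_rfl)
      have ht2 := abs_lt.1 ht'
      filter_upwards [hopen.mem_nhds ⟨(t, 0),
        ⟨⟨by linarith, by linarith⟩, by norm_num, by norm_num⟩, rfl⟩] with x hx'
      obtain ⟨⟨t', x'⟩, ⟨h1, h2⟩, rfl⟩ := hx'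
      rw [hT e t 0 ht' ⟨by norm_num, by norm_num⟩,
        hT e t' x' (abs_lt.2 ⟨by linarith [h1.1], by linarith [h1.2]⟩) h2]
  have : PreconnectedSpace G.outer :=
    isPreconnected_iff_preconnectedSpace.1 G.isPathConnected_outer.isConnected.isPreconnected
  have := hloc.apply_eq_of_preconnectedSpace ⟨z, hz'⟩ ⟨w, hw'⟩
  simpa only [T, if_pos hz, if_pos hw] using this

variable [LinearOrder Γ]

theorem exists_transition_eq (hΓ : LeftInvariant Γ) (hv : ∀ v, 0 ≤ s (Sum.inl v))
    (he : ∀ e, s (Sum.inr e) < 0) (hpos : ∀ v, ∃ w, G.Joined v w ∧ 0 < s (Sum.inl w)) :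
    ∃ q, ∀ z ∈ G.generic, G.transition s H z = q := by
  have hx : ∀ e, G.edgeMonodromy s H e = 1 := edgeMonodromy_eq_one hΓ hv he
  have key : ∀ z ∈ G.generic, ∃ y ∈ G.generic, y ∈ G.outer ∧
      G.transition s H z = G.transition s H y := by
    intro z hz
    by_cases ho : z ∈ G.outer
    · exact ⟨z, hz, ho, rfl⟩
    · simp only [outer, mem_ofPred_eq, not_forall, not_lt] at ho
      obtain ⟨v, hvz⟩ := ho
      have hlt := lt_of_le_of_ne hvz ((G.mem_generic_iff.1 hz).1 v)
      obtain ⟨w, hvw, hw⟩ := hpos v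
      obtain ⟨a, ha⟩ := G.exists_polar_mem_generic w
      refine ⟨_, ha, fun u => ?_, ?_⟩
      · have hrw := G.radius_pos w
        have hru := G.radius_pos u
        have hd := G.dist_polar w (ρ := 9 / 8) (by norm_num) a
        by_cases huw : u = w
        · rw [huw, hd]
          linarith
        · by_contra! hle
          exact huw (G.eq_of_dist_le (z := G.polar w (9 / 8) a) (by linarith)
            (by rw [hd]; linarith))
      · rw [G.transition_of_dist_lt s H hz hlt, vertexValue_eq hΓ hv he hvw,
          transition_eq_vertexValue hΓ hv he hw ha]
  by_cases hex : ∃ z, z ∈ G.generic ∧ z ∈ G.outer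
  · obtain ⟨z₀, h1, h2⟩ := hex
    refine ⟨G.transition s H z₀, fun z hz => ?_⟩
    obtain ⟨y, hy, hy', e⟩ := key z hz
    rw [e, transition_eq_of_outer hx hy hy' h1 h2]
  · refine ⟨1, fun z hz => ?_⟩
    obtain ⟨y, hy, hy', -⟩ := key z hz
    exact absurd ⟨y, hy, hy'⟩ hex

end PlanarGraph

theorem Set.InjOn.continuousOn_invFunOn {X Y : Type*} [TopologicalSpace X] [TopologicalSpace Y]
    [Nonempty X] {f : X → Y} {U : Set X} (hf : InjOn f U) (hU : IsOpen U)
    (ho : ∀ W ⊆ U, IsOpen W → IsOpen (f '' W)) :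
    ContinuousOn (Function.invFunOn f U) (f '' U) := by
  rw [continuousOn_iff']
  refine fun W hW => ⟨f '' (W ∩ U), ho _ inter_subset_right (hW.inter hU), ?_⟩
  ext y
  constructor
  · rintro ⟨h1, x, hx, rfl⟩
    rw [mem_preimage, hf.leftInvOn_invFunOn hx] at h1
    exact ⟨⟨x, ⟨h1, hx⟩, rfl⟩, x, hx, rfl⟩
  · rintro ⟨⟨x, ⟨h1, hx⟩, rfl⟩, -⟩
    refine ⟨?_, x, hx, rfl⟩
    rwa [mem_preimage, hf.leftInvOn_invFunOn hx]

namespace PlanarGraph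

open Holonomy

theorem IsCell.inter {S T : Set (ℝ × ℝ)} (hS : IsCell S) (hT : IsCell T)
    (h : ∃ p ∈ S ∩ T, p.1 ^ 2 + p.2 ^ 2 < 1) : IsCell (S ∩ T) where
  convex := hS.convex.inter hT.convex
  isOpen := hS.isOpen.inter hT.isOpen
  bound p hp := hS.bound p hp.1
  left hp := hS.left hp.1
  right hp := hS.right hp.1
  meets := h

theorem isCell_prod {A B : Set ℝ} (hA : Convex ℝ A) (hA' : IsOpen A) (hB : Convex ℝ B)
    (hB' : IsOpen B) (h : ∀ t ∈ A, |t| < 1) (h0 : (0 : ℝ) ∈ B → -1 / 2 ∉ A ∧ 1 / 2 ∉ A)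
    (hm : ∃ p ∈ A ×ˢ B, p.1 ^ 2 + p.2 ^ 2 < 1) : IsCell (A ×ˢ B) where
  convex := hA.prod hB
  isOpen := hA'.prod hB'
  bound _ hp := h _ hp.1
  left hp := (h0 hp.2).1 hp.1
  right hp := (h0 hp.2).2 hp.1
  meets := hm

theorem isCell_upper : IsCell (Ioo (-1 : ℝ) 1 ×ˢ Ioi (0 : ℝ)) :=
  isCell_prod (convex_Ioo _ _) isOpen_Ioo (convex_Ioi _) isOpen_Ioi (fun _ ht => abs_lt.2 ht)
    (fun h => absurd h (by simp)) ⟨(0, 1 / 2), by norm_num, by norm_num⟩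

theorem isCell_lower : IsCell (Ioo (-1 : ℝ) 1 ×ˢ Iio (0 : ℝ)) :=
  isCell_prod (convex_Ioo _ _) isOpen_Ioo (convex_Iio _) isOpen_Iio (fun _ ht => abs_lt.2 ht)
    (fun h => absurd h (by simp)) ⟨(0, -1 / 2), by norm_num, by norm_num⟩

theorem isCell_source : IsCell (Ioo (-1 : ℝ) (-1 / 2) ×ˢ univ) :=
  isCell_prod (convex_Ioo _ _) isOpen_Ioo convex_univ isOpen_univ
    (fun _ ht => abs_lt.2 ⟨ht.1, by linarith [ht.2]⟩) (fun _ => by norm_num)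
    ⟨(-3 / 4, 0), by norm_num, by norm_num⟩

theorem isCell_target : IsCell (Ioo (1 / 2 : ℝ) 1 ×ˢ univ) :=
  isCell_prod (convex_Ioo _ _) isOpen_Ioo convex_univ isOpen_univ
    (fun _ ht => abs_lt.2 ⟨by linarith [ht.1], ht.2⟩) (fun _ => by norm_num)
    ⟨(3 / 4, 0), by norm_num, by norm_num⟩

variable {V E : Type*} {G : PlanarGraph V E}

theorem IsCell.bandMap_mem_union {S : Set (ℝ × ℝ)} (hS : IsCell S) (e : E) {q : (ℝ × ℝ) × ℝ}
    (hq : q ∈ slab S) (h : q.1.2 ≠ 0) :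
    G.bandMap e q ∈ visibleFromAbove G.link ∪ visibleFromBelow G.link := by
  have hr := hS.mem_closedRect hq
  rcases lt_trichotomy q.2 0 with h0 | h0 | h0
  · exact Or.inr (G.bandMap_mem_below hr (Or.inl h0) (Or.inl h))
  · refine Or.inl (G.bandMap_mem_above hr (Or.inr ?_) (Or.inl h))
    have hq1 := hq.1
    rw [h0] at hq1
    constructor <;> intro ht <;> rw [ht] at hq1
    · exact hS.left hq1
    · exact hS.right hq1
  · exact Or.inl (G.bandMap_mem_above hr (Or.inl h0) (Or.inl h))

theorem bandMap_not_mem_union {e : E} {t h : ℝ} (hlt : t ^ 2 + h ^ 2 < 1) :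
    G.bandMap e ((t, 0), h) ∉ visibleFromAbove G.link ∪ visibleFromBelow G.link := by
  have hs := Real.sq_sqrt (show 0 ≤ 1 - t ^ 2 by nlinarith [sq_nonneg h])
  have hh : |h| ≤ √(1 - t ^ 2) := Real.abs_le_sqrt (by linarith)
  have hl : ∀ y, y ^ 2 = 1 - t ^ 2 → (G.band e (t, 0), y) ∈ G.link := fun y hy =>
    G.mem_link_iff.2 (Or.inr ⟨e, t, by linarith, rfl⟩)
  rintro (hp | hp)
  · exact hp _ ((le_abs_self h).trans hh) (hl _ hs)
  · exact hp (-√(1 - t ^ 2)) (by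
      dsimp only [bandMap]
      linarith [neg_abs_le h]) (hl _ (by rw [neg_sq, hs]))

variable {s : V ⊕ E → ℚ} [Finite V] [Finite E] {Γ : Type*} [Group Γ]
  {H : Holonomy (G.chainmailLink.Surgery s) Γ}

theorem continuousOn_union :
    ContinuousOn (G.spaceMap s) (visibleFromAbove G.link ∪ visibleFromBelow G.link) :=
  (G.continuousOn_spaceMap s).mono (union_subset G.above_subset G.below_subset)

theorem exists_section_union {q : Γ} (hq : ∀ z ∈ G.generic, G.transition s H z = q) :
    ∃ τ, H.IsSection (G.spaceMap s) (visibleFromAbove G.link ∪ visibleFromBelow G.link) τ ∧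
      EqOn τ (G.up s H) (visibleFromAbove G.link) := by
  have key : ∀ p ∈ visibleFromAbove G.link ∩ visibleFromBelow G.link,
      G.up s H p = G.down s H p * q := by
    rintro ⟨z, h⟩ ⟨h1, h2⟩
    have hz : z ∈ G.generic := fun h' => (le_total h h').elim (h1 h') (h2 h')
    rw [G.up_eq s H hz, hq z hz]
  have hc := continuousOn_union (G := G) (s := s)
  rw [union_eq_iUnion] at hc ⊢
  obtain ⟨τ, h1, h2⟩ := exists_glue (H := H) _
    (fun b : Bool => cond b (G.up s H) fun p => G.down s H p * q) (by
      rintro (_ | _)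
      · exact G.isCompact_link.isOpen_visibleFromBelow
      · exact G.isCompact_link.isOpen_visibleFromAbove) hc (by
      rintro (_ | _)
      · exact (G.isSection_down s H).mul_right q
      · exact G.isSection_up s H) (by
      rintro (_ | _) (_ | _) p ⟨hp, hp'⟩
      · rfl
      · exact (key p ⟨hp', hp⟩).symm
      · exact key p ⟨hp, hp'⟩
      · rfl)
  exact ⟨τ, h1, h2 true⟩

/-- A section over the points visible from above or from below extends across the edge `e`, over
a cell. -/
def Extends (H : Holonomy (G.chainmailLink.Surgery s) Γ) (τ : ℂ × ℝ → Γ) (e : E)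
    (S : Set (ℝ × ℝ)) : Prop :=
  ∃ m, H.IsSection (G.spaceMap s ∘ G.bandMap e) (slab S) m ∧
    ∀ q ∈ slab S, q.1.2 ≠ 0 → m q = τ (G.bandMap e q)

variable {τ : ℂ × ℝ → Γ} {e : E}

theorem extends_midCell (hx : G.edgeMonodromy s H e = 1)
    (hu : EqOn τ (G.up s H) (visibleFromAbove G.link)) : Extends H τ e midCell := by
  refine ⟨_, (G.isSection_mid s H e).mul_right (G.upCoeff s H e 1), fun q hq h => ?_⟩
  rw [show τ (G.bandMap e q) = G.up s H (G.bandMap e q) from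
    hu (G.mem_above_of_generic (G.band_mem_generic_of_mid hq h) _)]
  rcases lt_or_gt_of_ne h with h | h
  · rw [G.up_eq_mid s H (Or.inr rfl) hq (by linarith), inv_mul_eq_one.1 hx]
  · rw [G.up_eq_mid s H (Or.inl rfl) hq (by linarith)]

theorem Extends.of_inter {S T : Set (ℝ × ℝ)} (h : Extends H τ e S) (hS : IsCell S)
    (hT : IsCell T) (hm : ∃ p ∈ S ∩ T, p.1 ^ 2 + p.2 ^ 2 < 1)
    (hτ : H.IsSection (G.spaceMap s) (visibleFromAbove G.link ∪ visibleFromBelow G.link) τ) :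
    Extends H τ e T := by
  obtain ⟨m, hm1, hm2⟩ := h
  have hI := hS.inter hT hm
  obtain ⟨p, hp, -⟩ := hm
  have hTs := hT.isSimplyConnected_slab
  obtain ⟨x, hx, -⟩ := hTs.isPathConnected
  obtain ⟨n, hn, -⟩ := exists_section (H := H) hTs (G.continuousOn_cell s hT e) x hx 1
  obtain ⟨c, hc⟩ := (hn.mono (slab_mono inter_subset_right)).exists_const
    (hm1.mono (slab_mono inter_subset_left)) (G.continuousOn_cell s hI e)
    hI.isSimplyConnected_slab.isPathConnected
  refine ⟨_, hn.mul_right c, ?_⟩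
  have key : ∀ ε : ℝ, ε = 1 ∨ ε = -1 → ∀ q ∈ slab T, 0 < ε * q.1.2 →
      n q * c = τ (G.bandMap e q) := by
    intro ε hε q hq hpos
    have hne : ∀ y : ℝ, 0 < ε * y → y ≠ 0 := by
      rintro _ hy rfl
      simp at hy
    have hsub : {q : (ℝ × ℝ) × ℝ | (q.1.1, q.2) ∈ T ∧ q.1.2 ∈ Ioo (-1 / 4 : ℝ) (1 / 4) ∧
        0 < ε * q.1.2} ⊆ slab T := fun q hq => ⟨hq.1, hq.2.1, Or.inl (hne _ hq.2.2)⟩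
    have hε1 : ε / 8 ∈ Ioo (-1 / 4 : ℝ) (1 / 4) := by
      rcases hε with rfl | rfl <;> norm_num
    have hε2 : 0 < ε * (ε / 8) := by
      rcases hε with rfl | rfl <;> norm_num
    have hpI : ((p.1, ε / 8), p.2) ∈ slab (S ∩ T) := ⟨hp, hε1, Or.inl (hne _ hε2)⟩
    refine ((hn.mul_right c).mono hsub).eqOn (hτ.comp ((G.continuousOn_bandMap e).mono fun q hq =>
      ⟨hT.mem_closedRect (hsub hq), mem_univ _⟩) fun q hq =>
        hT.bandMap_mem_union e (hsub hq) (hne _ hq.2.2))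
      ((G.continuousOn_cell s hT e).mono hsub) (hT.isPathConnected_half ε hε)
      (x := ((p.1, ε / 8), p.2)) ⟨hp.2, hε1, hε2⟩ ?_ ⟨hq.1, hq.2.1, hpos⟩
    dsimp only [Function.comp]
    rw [← hc _ hpI, hm2 _ (slab_mono inter_subset_left hpI) (hne _ hε2)]
  intro q hq h
  rcases lt_or_gt_of_ne h with h | h
  · exact key (-1) (Or.inr rfl) q hq (by linarith)
  · exact key 1 (Or.inl rfl) q hq (by linarith)

theorem exists_cell (hx : G.edgeMonodromy s H e = 1)
    (hτ : H.IsSection (G.spaceMap s) (visibleFromAbove G.link ∪ visibleFromBelow G.link) τ)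
    (hu : EqOn τ (G.up s H) (visibleFromAbove G.link)) {t h : ℝ} (hlt : t ^ 2 + h ^ 2 < 1)
    (h0 : h = 0 → t ≠ -1 / 2 ∧ t ≠ 1 / 2) :
    ∃ S, IsCell S ∧ Extends H τ e S ∧ (t, h) ∈ S := by
  have hmid := extends_midCell hx hu
  have hup : Extends H τ e (Ioo (-1 : ℝ) 1 ×ˢ Ioi (0 : ℝ)) :=
    hmid.of_inter isCell_midCell isCell_upper
      ⟨(0, 1 / 2), ⟨by norm_num [midCell], by norm_num⟩, by norm_num⟩ hτ
  have ht := abs_lt.1 ((sq_lt_one_iff_abs_lt_one t).1 (by nlinarith [sq_nonneg h]))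
  rcases lt_trichotomy h 0 with hh | hh | hh
  · exact ⟨_, isCell_lower, hmid.of_inter isCell_midCell isCell_lower
      ⟨(0, -1 / 2), ⟨by norm_num [midCell], by norm_num⟩, by norm_num⟩ hτ, ht, hh⟩
  · obtain ⟨h1, h2⟩ := h0 hh
    rcases lt_or_gt_of_ne h1 with h1 | h1
    · exact ⟨_, isCell_source, hup.of_inter isCell_upper isCell_source
        ⟨(-3 / 4, 1 / 2), ⟨by norm_num, by norm_num⟩, by norm_num⟩ hτ, ⟨ht.1, h1⟩, mem_univ _⟩
    rcases lt_or_gt_of_ne h2 with h2 | h2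
    · exact ⟨_, isCell_midCell, hmid, abs_lt.2 ⟨by linarith, h2⟩⟩
    · exact ⟨_, isCell_target, hup.of_inter isCell_upper isCell_target
        ⟨(3 / 4, 1 / 2), ⟨by norm_num, by norm_num⟩, by norm_num⟩ hτ, ⟨h2, ht.2⟩, mem_univ _⟩
  · exact ⟨_, isCell_upper, hup, ht, hh⟩

theorem slab_section_eq {S T : Set (ℝ × ℝ)} (hS : IsCell S) (hT : IsCell T)
    {m n : (ℝ × ℝ) × ℝ → Γ} (hm : H.IsSection (G.spaceMap s ∘ G.bandMap e) (slab S) m)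
    (hm' : ∀ q ∈ slab S, q.1.2 ≠ 0 → m q = τ (G.bandMap e q))
    (hn : H.IsSection (G.spaceMap s ∘ G.bandMap e) (slab T) n)
    (hn' : ∀ q ∈ slab T, q.1.2 ≠ 0 → n q = τ (G.bandMap e q)) {q : (ℝ × ℝ) × ℝ}
    (hq : q ∈ slab S) (hq' : q ∈ slab T) : m q = n q := by
  by_cases h : q.1.2 = 0
  · have hI := hS.inter hT ⟨_, ⟨hq.1, hq'.1⟩, hq.2.2.resolve_left (not_not_intro h)⟩
    have hx : ((q.1.1, 1 / 8), q.2) ∈ slab (S ∩ T) :=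
      ⟨⟨hq.1, hq'.1⟩, by norm_num, Or.inl (by norm_num)⟩
    refine (hm.mono (slab_mono inter_subset_left)).eqOn (hn.mono (slab_mono inter_subset_right))
      (G.continuousOn_cell s hI e) hI.isSimplyConnected_slab.isPathConnected hx ?_
      ⟨⟨hq.1, hq'.1⟩, hq.2⟩
    rw [hm' _ (slab_mono inter_subset_left hx) (by norm_num),
      hn' _ (slab_mono inter_subset_right hx) (by norm_num)]
  · rw [hm' q hq h, hn' q hq' h]

theorem exists_section_compl_link (hx : ∀ e, G.edgeMonodromy s H e = 1) {q : Γ}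
    (hq : ∀ z ∈ G.generic, G.transition s H z = q) :
    ∃ σ, H.IsSection (G.spaceMap s) G.linkᶜ σ := by
  obtain ⟨τ, hτ, hu⟩ := exists_section_union hq
  let κ := {k : E × Set (ℝ × ℝ) // IsCell k.2 ∧ Extends H τ k.1 k.2}
  have hinj : ∀ k : κ, InjOn (G.bandMap k.1.1) (slab k.1.2) := fun k q hq q' hq' h =>
    (G.bandMap_inj (k.2.1.mem_closedRect hq) (k.2.1.mem_closedRect hq') h).2
  let U : Option κ → Set (ℂ × ℝ) := fun o =>
    o.elim (visibleFromAbove G.link ∪ visibleFromBelow G.link) fun k =>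
      G.bandMap k.1.1 '' slab k.1.2
  let σ : Option κ → ℂ × ℝ → Γ := fun o =>
    o.elim τ fun k => k.2.2.choose ∘ Function.invFunOn (G.bandMap k.1.1) (slab k.1.2)
  have hσ : ∀ k : κ, ∀ x ∈ slab k.1.2, σ (some k) (G.bandMap k.1.1 x) = k.2.2.choose x :=
    fun k x hx => congrArg _ ((hinj k).leftInvOn_invFunOn hx)
  have hU : ⋃ o, U o = G.linkᶜ := by
    refine subset_antisymm (iUnion_subset ?_) ?_
    · rintro (_ | k)
      · exact union_subset G.above_subset G.below_subset
      · rintro _ ⟨x, hx, rfl⟩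
        exact k.2.1.bandMap_not_mem_link G k.1.1 hx
    · rintro ⟨z, h⟩ hp
      by_cases hb : ∃ e, ∃ t ∈ Icc (-1 : ℝ) 1, z = G.band e (t, 0)
      · obtain ⟨e, t, ht, rfl⟩ := hb
        have hr := mem_rect_zero (t := t) (by linarith [ht.1]) (by linarith [ht.2])
        have hne : t ^ 2 + h ^ 2 ≠ 1 := fun h1 => hp (G.mem_link_iff.2 (Or.inr ⟨e, t, h1, rfl⟩))
        rcases lt_or_gt_of_ne hne with hlt | hlt
        · obtain ⟨S, h1, h2, h3⟩ := exists_cell (hx e) hτ hu hlt (by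
            rintro rfl
            constructor <;> rintro rfl
            · refine hp (G.mem_link_iff.2 (Or.inl ⟨rfl, G.src e, ?_⟩))
              rw [G.dist_band_src e (by norm_num) (by norm_num)]
              ring
            · refine hp (G.mem_link_iff.2 (Or.inl ⟨rfl, G.tgt e, ?_⟩))
              rw [G.dist_band_tgt e (by norm_num) (by norm_num)]
              ring)
          exact mem_iUnion.2
            ⟨some ⟨(e, S), h1, h2⟩, ((t, 0), h), ⟨h3, by norm_num, Or.inr hlt⟩, rfl⟩
        · refine mem_iUnion.2 ⟨none, ?_⟩
          rcases lt_trichotomy h 0 with hh | rfl | hh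
          · exact Or.inr (G.bandMap_mem_below hr (Or.inl hh) (Or.inr (Or.inr ⟨hh.le, hlt⟩)))
          · nlinarith [ht.1, ht.2]
          · exact Or.inl (G.bandMap_mem_above hr (Or.inl hh) (Or.inr (Or.inr ⟨hh.le, hlt⟩)))
      · have key : ∀ h', (z, h') ∈ G.link → h' = 0 := by
          intro h' hl
          obtain ⟨h0, -⟩ | ⟨e, t, ht, rfl⟩ := G.mem_link_iff.1 hl
          · exact h0
          · exact absurd ⟨e, t, abs_le.1 ((sq_le_one_iff_abs_le_one t).1
              (by nlinarith [sq_nonneg h'])), rfl⟩ hb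
        refine mem_iUnion.2 ⟨none, ?_⟩
        rcases lt_trichotomy h 0 with hh | rfl | hh
        · refine Or.inr fun h' hle hl => ?_
          have := key h' hl
          dsimp only at hle
          linarith
        · refine Or.inl fun h' hle hl => hp ?_
          rwa [key h' hl] at hl
        · refine Or.inl fun h' hle hl => ?_
          have := key h' hl
          dsimp only at hle
          linarith
  have hmix : ∀ k : κ, ∀ x ∈ slab k.1.2, G.bandMap k.1.1 x ∈
      visibleFromAbove G.link ∪ visibleFromBelow G.link →
      k.2.2.choose x = τ (G.bandMap k.1.1 x) := by
    rintro k ⟨⟨t, y⟩, h⟩ hx hx'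
    refine k.2.2.choose_spec.2 _ hx ?_
    rintro (rfl : y = 0)
    exact bandMap_not_mem_union (hx.2.2.resolve_left (not_not_intro rfl)) hx'
  rw [← hU]
  obtain ⟨ρ, hρ, -⟩ := exists_glue (H := H) U σ (by
    rintro (_ | k)
    · exact G.isCompact_link.isOpen_visibleFromAbove.union
        G.isCompact_link.isOpen_visibleFromBelow
    · exact G.isOpen_image_bandMap _ k.2.1.isOpen_slab fun x hx => k.2.1.mem_openRect hx)
    (by rw [hU]; exact G.continuousOn_spaceMap s) (by
    rintro (_ | k)
    · exact hτ
    · refine (k.2.2.choose_spec.1.comp ((hinj k).continuousOn_invFunOn k.2.1.isOpen_slab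
        fun W hW ho => G.isOpen_image_bandMap _ ho fun x hx => k.2.1.mem_openRect (hW hx))
          ?_).congr_map ?_
      · rintro _ ⟨x, hx, rfl⟩
        rwa [(hinj k).leftInvOn_invFunOn hx]
      · rintro _ ⟨x, hx, rfl⟩
        simp only [Function.comp, (hinj k).leftInvOn_invFunOn hx]) (by
    rintro (_ | k) (_ | l) p ⟨hp, hp'⟩
    · rfl
    · obtain ⟨x, hx, rfl⟩ := hp'
      rw [hσ l x hx]
      exact (hmix l x hx hp).symm
    · obtain ⟨x, hx, rfl⟩ := hp
      rw [hσ k x hx]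
      exact hmix k x hx hp'
    · obtain ⟨x, hx, rfl⟩ := hp
      obtain ⟨y, hy, hxy⟩ := hp'
      obtain ⟨⟨e, S⟩, hS, hS'⟩ := k
      obtain ⟨⟨e', T⟩, hT, hT'⟩ := l
      obtain ⟨rfl, rfl⟩ := G.bandMap_inj (hT.mem_closedRect hy) (hS.mem_closedRect hx) hxy
      rw [hσ ⟨(e', S), hS, hS'⟩ y hx, hσ ⟨(e', T), hT, hT'⟩ y hy]
      exact slab_section_eq hS hT hS'.choose_spec.1 hS'.choose_spec.2 hT'.choose_spec.1
        hT'.choose_spec.2 hx hy)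
  exact ⟨ρ, hρ⟩

end PlanarGraph

namespace OnePoint

variable {F : Type*} [NormedAddCommGroup F] [NormedSpace ℝ F]

open Classical in
/-- The inversion, as a chart of the one-point compactification at infinity. -/
noncomputable def inversion : F → OnePoint F :=
  Function.update (fun v => ((‖v‖⁻¹ ^ 2 • v : F) : OnePoint F)) 0 OnePoint.infty

theorem norm_inv_sq_smul {v : F} (hv : v ≠ 0) : ‖‖v‖⁻¹ ^ 2 • v‖ = ‖v‖⁻¹ := by
  have := norm_ne_zero_iff.2 hv
  rw [norm_smul, norm_pow, norm_inv, norm_norm]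
  field_simp

theorem inversion_zero : inversion (0 : F) = OnePoint.infty := by
  classical exact Function.update_self ..

theorem inversion_of_ne {v : F} (hv : v ≠ 0) :
    inversion v = ((‖v‖⁻¹ ^ 2 • v : F) : OnePoint F) := by
  classical exact Function.update_of_ne hv ..

theorem inversion_injective : Function.Injective (inversion : F → OnePoint F) := by
  intro v w h
  by_cases hv : v = 0 <;> by_cases hw : w = 0
  · rw [hv, hw]
  · rw [hv, inversion_zero, inversion_of_ne hw] at h
    exact absurd h (infty_ne_coe _)
  · rw [hw, inversion_zero, inversion_of_ne hv] at h
    exact absurd h (coe_ne_infty _)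
  · rw [inversion_of_ne hv, inversion_of_ne hw, coe_eq_coe] at h
    have hn := congrArg norm h
    rw [norm_inv_sq_smul hv, norm_inv_sq_smul hw, inv_inj] at hn
    rw [hn] at h
    exact smul_right_injective F (by simpa using hw : ‖w‖⁻¹ ^ 2 ≠ 0) h

theorem continuous_inversion [ProperSpace F] : Continuous (inversion : F → OnePoint F) := by
  rw [continuous_iff_continuousAt]
  intro v
  by_cases hv : v = 0
  · subst hv
    classical rw [inversion, continuousAt_update_same]
    have h : Filter.Tendsto (fun v : F => ‖v‖⁻¹ ^ 2 • v) (𝓝[≠] 0) (Filter.coclosedCompact F) := by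
      rw [Filter.coclosedCompact_eq_cocompact, ← Metric.cobounded_eq_cocompact,
        ← tendsto_norm_atTop_iff_cobounded]
      have : Filter.Tendsto (fun v : F => ‖v‖⁻¹) (𝓝[≠] 0) Filter.atTop :=
        tendsto_inv_nhdsGT_zero.comp tendsto_norm_nhdsNE_zero
      refine this.congr' ?_
      filter_upwards [self_mem_nhdsWithin] with v hv
      exact (norm_inv_sq_smul hv).symm
    exact tendsto_coe_infty.comp h
  · have hc : ContinuousAt (fun v : F => ((‖v‖⁻¹ ^ 2 • v : F) : OnePoint F)) v := by
      refine continuous_coe.continuousAt.comp (ContinuousAt.smul (ContinuousAt.pow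
        (ContinuousAt.inv₀ (by fun_prop) (norm_ne_zero_iff.2 hv)) 2) continuousAt_id)
    refine hc.congr ?_
    filter_upwards [isOpen_ne.mem_nhds hv] with w hw
    exact (inversion_of_ne hw).symm

theorem image_inversion_ball {R : ℝ} (hR : 0 < R) :
    inversion '' Metric.ball (0 : F) R⁻¹ = ((↑) '' Metric.closedBall (0 : F) R)ᶜ := by
  ext x
  constructor
  · rintro ⟨v, hv, rfl⟩ ⟨y, hy, h⟩
    by_cases h0 : v = 0
    · rw [h0, inversion_zero] at h
      exact coe_ne_infty _ h
    · rw [inversion_of_ne h0, coe_eq_coe] at h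
      rw [h, mem_closedBall_zero_iff, norm_inv_sq_smul h0] at hy
      rw [mem_ball_zero_iff] at hv
      have := inv_strictAnti₀ (norm_pos_iff.2 h0) hv
      rw [inv_inv] at this
      linarith
  · intro hx
    induction x using OnePoint.rec with
    | infty => exact ⟨0, by simpa using hR, inversion_zero⟩
    | coe y =>
      have hy : R < ‖y‖ := by
        by_contra! h
        exact hx ⟨y, mem_closedBall_zero_iff.2 h, rfl⟩
      have hy0 : y ≠ 0 := norm_pos_iff.1 (hR.trans hy)
      have hn := norm_inv_sq_smul hy0
      have h0 : ‖y‖⁻¹ ^ 2 • y ≠ 0 := by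
        rw [← norm_pos_iff, hn]
        exact inv_pos.2 (hR.trans hy)
      refine ⟨‖y‖⁻¹ ^ 2 • y, ?_, ?_⟩
      · rw [mem_ball_zero_iff, hn]
        exact inv_strictAnti₀ hR hy
      · rw [inversion_of_ne h0, hn, inv_inv, smul_smul, ← mul_pow,
          mul_inv_cancel₀ (norm_ne_zero_iff.2 hy0), one_pow, one_smul]

end OnePoint

namespace Holonomy

variable {M Γ F : Type*} [TopologicalSpace M] [Group Γ] {H : Holonomy M Γ}
  [NormedAddCommGroup F] [NormedSpace ℝ F] [ProperSpace F]

/-- Sections on the complement of a compact subset extend to infinity. -/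
theorem IsSection.exists_onePoint (hF : 1 < Module.rank ℝ F) {K : Set F} (hK : IsCompact K)
    {f : OnePoint F → M} (hf : ContinuousOn f ((↑) '' K)ᶜ) {σ : F → Γ}
    (hσ : H.IsSection (f ∘ (↑)) Kᶜ σ) : ∃ τ, H.IsSection f ((↑) '' K)ᶜ τ := by
  obtain ⟨R, hR, hKR⟩ := hK.isBounded.subset_closedBall_lt 0 0
  let B := Metric.closedBall (0 : F) R⁻¹
  have : CompactSpace B := isCompact_iff_compactSpace.1 (isCompact_closedBall _ _)
  let j : B → OnePoint F := fun v => OnePoint.inversion v.1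
  have hj : IsEmbedding j := ((OnePoint.continuous_inversion.comp
    continuous_subtype_val).isClosedEmbedding
      (OnePoint.inversion_injective.comp Subtype.val_injective)).isEmbedding
  have hfar : (((↑) '' Metric.closedBall (0 : F) R)ᶜ : Set (OnePoint F)) ⊆ ((↑) '' K)ᶜ :=
    compl_subset_compl.2 (image_mono hKR)
  have hjB : j '' (Subtype.val ⁻¹' Metric.ball (0 : F) R⁻¹) =
      ((↑) '' Metric.closedBall (0 : F) R)ᶜ := by
    rw [← OnePoint.image_inversion_ball hR]
    change OnePoint.inversion ∘ Subtype.val '' _ = _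
    rw [image_comp, Subtype.image_preimage_coe, inter_eq_right.2 Metric.ball_subset_closedBall]
  have hσ' : H.IsSection f ((↑) '' Kᶜ) (Function.extend ((↑) : F → OnePoint F) σ 1) := by
    refine IsSection.of_embedding OnePoint.isOpenEmbedding_coe.isEmbedding ?_
    rwa [Function.extend_comp OnePoint.coe_injective]
  obtain ⟨ρ, hρ, -⟩ := exists_section (H := H) (f := f ∘ OnePoint.inversion)
    (((convex_ball (0 : F) R⁻¹).starConvex (Metric.mem_ball_self (inv_pos.2 hR))).isSimplyConnected
      (Metric.mem_ball_self (inv_pos.2 hR)))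
    (hf.comp OnePoint.continuous_inversion.continuousOn fun v hv =>
      hfar ((OnePoint.image_inversion_ball hR).subset ⟨v, hv, rfl⟩)) 0
    (Metric.mem_ball_self (inv_pos.2 hR)) 1
  have hρ' : H.IsSection f ((↑) '' Metric.closedBall (0 : F) R)ᶜ
      (Function.extend j (ρ ∘ Subtype.val) 1) := by
    rw [← hjB]
    refine IsSection.of_embedding hj ?_
    rw [Function.extend_comp hj.injective]
    exact hρ.comp continuous_subtype_val.continuousOn fun v hv => hv
  have hout : ∀ y ∈ {y : F | R < ‖y‖}, y ∈ Kᶜ := fun y hy h =>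
    absurd (mem_closedBall_zero_iff.1 (hKR h)) (not_le.2 hy)
  have hout' : ∀ y ∈ {y : F | R < ‖y‖},
      (y : OnePoint F) ∈ ((↑) '' Metric.closedBall (0 : F) R)ᶜ := by
    rintro y hy ⟨x, hx, h⟩
    rw [OnePoint.coe_eq_coe] at h
    subst h
    exact absurd (mem_closedBall_zero_iff.1 hx) (not_le.2 hy)
  have hout2 : ∀ y ∈ Kᶜ, (y : OnePoint F) ∈ ((↑) '' K)ᶜ := by
    rintro y hy ⟨x, hx, h⟩
    rw [OnePoint.coe_eq_coe] at h
    exact hy (h ▸ hx)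
  obtain ⟨c, hc⟩ := (hρ'.comp (g := ((↑) : F → OnePoint F)) (S' := {y | R < ‖y‖})
    OnePoint.continuous_coe.continuousOn hout').exists_const (hσ.mono hout)
    (hf.comp OnePoint.continuous_coe.continuousOn fun y hy => hout2 y (hout y hy))
    (isPathConnected_norm_gt hF hR.le)
  have hU : (((↑) '' K)ᶜ : Set (OnePoint F)) =
      ⋃ b : Bool, cond b ((↑) '' Kᶜ) ((↑) '' Metric.closedBall (0 : F) R)ᶜ := by
    rw [← union_eq_iUnion]
    refine subset_antisymm (fun x hx => ?_) (union_subset ?_ hfar)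
    · induction x using OnePoint.rec with
      | infty => exact Or.inr OnePoint.infty_notMem_image_coe
      | coe y => exact Or.inl ⟨y, fun h => hx ⟨y, h, rfl⟩, rfl⟩
    · rintro _ ⟨y, hy, rfl⟩
      exact hout2 y hy
  have hag : ∀ x ∈ ((↑) '' Kᶜ) ∩ (((↑) '' Metric.closedBall (0 : F) R)ᶜ : Set (OnePoint F)),
      Function.extend ((↑) : F → OnePoint F) σ 1 x =
        Function.extend j (ρ ∘ Subtype.val) 1 x * c := by
    rintro _ ⟨⟨y, hy, rfl⟩, hy'⟩
    rw [OnePoint.coe_injective.extend_apply]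
    refine hc y ?_
    by_contra h
    exact hy' ⟨y, mem_closedBall_zero_iff.2 (not_lt.1 h), rfl⟩
  rw [hU] at hf ⊢
  obtain ⟨τ, hτ, -⟩ := exists_glue (H := H) _
    (fun b : Bool => cond b (Function.extend ((↑) : F → OnePoint F) σ 1)
      fun x => Function.extend j (ρ ∘ Subtype.val) 1 x * c) (by
      rintro (_ | _)
      · exact OnePoint.isOpen_compl_image_coe.2
          ⟨Metric.isClosed_closedBall, isCompact_closedBall _ _⟩
      · exact OnePoint.isOpenEmbedding_coe.isOpenMap _ hK.isClosed.isOpen_compl) hf (by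
      rintro (_ | _)
      · exact hρ'.mul_right c
      · exact hσ') (by
      rintro (_ | _) (_ | _) x ⟨hx, hx'⟩
      · rfl
      · exact (hag x ⟨hx', hx⟩).symm
      · exact hag x ⟨hx, hx'⟩
      · rfl)
  exact ⟨τ, hτ⟩

end Holonomy

namespace Holonomy

open CategoryTheory

variable {M N Γ : Type*} [TopologicalSpace M] [TopologicalSpace N] [Group Γ]

/-- The pullback of a holonomy along a continuous map. -/
def comap (H : Holonomy M Γ) (f : C(N, M)) : Holonomy N Γ where
  hol γ := H.hol (γ.map f.continuous)
  hol_trans γ δ := by rw [Path.map_trans, H.hol_trans]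
  hol_homotopic _ _ h := H.hol_homotopic _ _ (h.map f)

/-- The arrow of the fundamental groupoid given by a path. -/
def arrow {a b : M} (γ : Path a b) : FundamentalGroupoid.mk a ⟶ FundamentalGroupoid.mk b :=
  Path.Homotopic.Quotient.mk γ

open Classical in
/-- The holonomy with values in the fundamental group: paths are completed to loops by means of
chosen paths from the base point. -/
noncomputable def ofBasePoint (x : M) : Holonomy M (FundamentalGroup M x) where
  hol {_ _} γ := if h : Joined x _ then
    arrow (h.trans ⟨γ⟩).somePath ≫ inv (arrow γ) ≫ inv (arrow h.somePath) else 1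
  hol_trans {a b c} γ δ := by
    by_cases h : Joined x a
    · have hb : Joined x b := h.trans ⟨γ⟩
      have e : arrow (γ.trans δ) = arrow γ ≫ arrow δ := rfl
      rw [dif_pos h, dif_pos h, dif_pos hb, End.mul_def, e]
      simp
    · have hb : ¬ Joined x b := fun hb => h (hb.trans ⟨γ.symm⟩)
      rw [dif_neg h, dif_neg h, dif_neg hb, one_mul]
  hol_homotopic γ δ h := by
    have : arrow γ = arrow δ := Path.Homotopic.Quotient.eq.2 h
    simp only [this]

theorem eq_one_of_isSection {x : M} {σ : M → FundamentalGroup M x}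
    (h : (ofBasePoint x).IsSection id univ σ) (g : FundamentalGroup M x) : g = 1 := by
  obtain ⟨γ, rfl⟩ : ∃ γ : Path x x, Path.Homotopic.Quotient.mk γ = g :=
    Path.Homotopic.Quotient.mk_surjective g
  have h1 := h.eq_hol continuous_id.continuousOn γ fun _ => mem_univ _
  have h2 : (ofBasePoint x).hol γ = 1 := right_eq_mul.1 h1
  have h3 : (ofBasePoint x).hol γ = arrow (Joined.refl x).somePath ≫ inv (arrow γ) ≫
      inv (arrow (Joined.refl x).somePath) := dif_pos (Joined.refl x)
  rw [h3, End.one_def] at h2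
  have h4 : arrow γ = 𝟙 _ := by
    rw [← cancel_epi (inv (arrow γ)), IsIso.inv_hom_id, Category.comp_id,
      ← cancel_epi (arrow (Joined.refl x).somePath),
      ← cancel_mono (inv (arrow (Joined.refl x).somePath))]
    simp only [Category.assoc, h2, Category.comp_id, IsIso.hom_inv_id]
  exact h4

end Holonomy

theorem PlanarGraph.complement_chainmailLink {V E : Type*} (G : PlanarGraph V E) :
    G.chainmailLink.Complement = ((↑) '' G.link)ᶜ := by
  ext x
  constructor
  · rintro hx ⟨p, hp | hp, rfl⟩
    · obtain ⟨v, u, rfl⟩ := mem_iUnion.1 hp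
      exact hx (Sum.inl v) u (by simp [chainmailLink, tube, vertexTube, UnitDisc.zero])
    · obtain ⟨e, u, rfl⟩ := mem_iUnion.1 hp
      exact hx (Sum.inr e) u (by simp [chainmailLink, tube, edgeTube, UnitDisc.zero])
  · intro hx
    induction x using OnePoint.rec with
    | infty =>
      rintro (v | e) u h
      · exact OnePoint.coe_ne_infty _ h
      · exact OnePoint.coe_ne_infty _ h
    | coe p => exact G.coe_mem_complement fun hp => hx ⟨p, hp, rfl⟩

/-- A space homeomorphic to an alternating surgery on the flat fully augmented chainmail link of a
finite planar graph does not have a left-orderable fundamental group. -/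
theorem theorem1p1 {V E : Type*} [Finite V] [Finite E] (G : PlanarGraph V E)
    (a : V → ℚ) (b : E → ℚ) (hab : G.IsAlternating a b)
    (M : Type*) [TopologicalSpace M]
    (hM : Nonempty (M ≃ₜ G.chainmailLink.Surgery (Sum.elim a b))) (x : M) :
    ¬ LeftOrderable (FundamentalGroup M x) := by
  rintro ⟨hn, hord, hle⟩
  obtain ⟨e⟩ := hM
  let H := (Holonomy.ofBasePoint x).comap (e.symm : C(G.chainmailLink.Surgery (Sum.elim a b), M))
  obtain ⟨q, hq⟩ := PlanarGraph.exists_transition_eq (H := H) hle hab.vertex_nonneg hab.edge_neg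
    hab.exists_pos
  obtain ⟨σ, hσ⟩ := PlanarGraph.exists_section_compl_link
    (PlanarGraph.edgeMonodromy_eq_one hle hab.vertex_nonneg hab.edge_neg) hq
  have hc := G.chainmailLink.continuousOn_toSurgery (Sum.elim a b) G.hasOpenTubes
  rw [G.complement_chainmailLink] at hc
  obtain ⟨τ, hτ⟩ := hσ.exists_onePoint (by norm_num) G.isCompact_link hc
  rw [← G.complement_chainmailLink] at hτ
  obtain ⟨ρ, hρ⟩ := G.chainmailLink.section_of_section_complement _ G.hasOpenTubes hτ
  have hρ' : (Holonomy.ofBasePoint x).IsSection e.symm univ ρ := fun γ hγ hm hc' => hρ γ hγ hm hγ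
  have hs := (hρ'.comp e.continuous.continuousOn fun _ _ => mem_univ _).congr_map (f' := id)
    (S := univ) fun y _ => e.symm_apply_apply y
  obtain ⟨g, hg⟩ := exists_ne (1 : FundamentalGroup M x)
  exact hg (Holonomy.eq_one_of_isSection hs g)
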